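/- **Theorem (Abstract error estimate).** Let $d\in\{2,3\}$ and let $\Omega\subset\mathbb R^d$ be a polytopal domain (a nonempty connected set which is the interior of a finite union of closed $d$-simplices). For constant Lamé coefficients $\mu\in[\mu_1,\mu_2]$, $0<\mu_1\le\mu_2$, $\lambda\in(0,\infty)$, and $\mathbf f\in L^2(\Omega)^d$, let $\mathbf u\in\mathbf U_0=H^1_0(\Omega)^d$ denote the weak solution of linear elasticity, $$\int_\Omega \sigma(\mathbf u):\varepsilon(\mathbf v)=\int_\Omega \mathbf f\cdot\mathbf v\quad\forall \mathbf v\in\mathbf U_0,\qquad \sigma(\mathbf u)=2\mu\,\varepsilon(\mathbf u)+\lambda(\operatorname{div}\mathbf u)I,\quad \varepsilon(\mathbf u)=\tfrac12(\nabla\mathbf u+{}^t\nabla\mathbf u).$$ *Mesh.* Consider a polytopal mesh of $\Omega$ with finite sets of open polytopal cells $K\in\mathcal M$, flat relatively open faces $\sigma\in\mathcal F$ and nodes $s\in\mathcal V$ (the edge end points) with coordinates $\mathbf x_s$. $\mathcal F_K$ is the set of faces of $K$, $\mathcal V_K$ and $\mathcal V_\sigma$ are the sets of nodes of $K$ and $\sigma$,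 $h_K$ is the diameter of $K$, and $|K|$, $|\sigma|$ are measures. Each face has a fixed unit normal $\mathbf n_\sigma$; $\mathbf n_{K\sigma}$ is the outward normal to $K$ on $\sigma\in\mathcal F_K$. The mesh is *regular with parameter $\rho\in(0,1)$* if it has a matching simplicial submesh (each simplex is contained in one cell, each open $(d-1)$-dimensional simplicial face is either contained in or disjoint from each mesh face) in which each simplex $\tau$ has inradius at least $\rho h_\tau$, and $h_\tau\ge\rho h_K$ if $\tau\subset K$. Fix nonnegative weights with $\sum_{s\in\mathcal V_X}\omega^X_s=1$ and $\sum_{s\in\mathcal V_X}\omega^X_s\mathbf x_s=\overline{\mathbf x}_X$, the center of mass of $X$, for all $X\in\mathcal M\cup\mathcal F$. *Scheme.* $\mathbf U_{\mathcal D}$ is the space of families $\mathbf v_{\mathcal D}=((\mathbf v_s)_{s\in\mathcal V},(v_\sigma)_{\sigma\in\mathcal F})$ with $\mathbf v_s\in\mathbb R^d$, $v_\sigma\in\mathbb R$, and $\mathbf U_{0,\mathcal D}$ its subspace given by $\mathbf v_s=0$ and $v_\sigma=0$ for nodes and faces on $\partial\Omega$. Set $\overline{\mathbf v}_X=\sum_{s\in\mathcal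 V_X}\omega_s^X\mathbf v_s$ and, on each cell $K$, $$\nabla^K\mathbf v_{\mathcal D}=\frac1{|K|}\sum_{\sigma\in\mathcal F_K}|\sigma|\,(\overline{\mathbf v}_\sigma+v_\sigma\mathbf n_\sigma)\otimes\mathbf n_{K\sigma},\qquad \Pi^K\mathbf v_{\mathcal D}(\mathbf x)=\nabla^K\mathbf v_{\mathcal D}(\mathbf x-\overline{\mathbf x}_K)+\overline{\mathbf v}_K,$$ $(\nabla^{\mathcal D}\mathbf v_{\mathcal D})_{|K}=\nabla^K\mathbf v_{\mathcal D}$, $(\widetilde\Pi^{\mathcal D}\mathbf v_{\mathcal D})_{|K}=\overline{\mathbf v}_K$, $\varepsilon_{\mathcal D}$ the symmetric part of $\nabla^{\mathcal D}$, and $\sigma_{\mathcal D}=2\mu\varepsilon_{\mathcal D}+\lambda\operatorname{Tr}(\varepsilon_{\mathcal D})I$. Let $S_{\mathcal D}=\sum_{K\in\mathcal M}S_K$ with $$S_K(\mathbf u_{\mathcal D},\mathbf v_{\mathcal D})=h_K^{d-2}\sum_{s\in\mathcal V_K}(\mathbf u_s-\Pi^K\mathbf u_{\mathcal D}(\mathbf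 x_s))\cdot(\mathbf v_s-\Pi^K\mathbf v_{\mathcal D}(\mathbf x_s))+h_K^{d-2}\sum_{\sigma\in\mathcal F_K}u_\sigma v_\sigma .$$ The scheme is: find $\mathbf u_{\mathcal D}\in\mathbf U_{0,\mathcal D}$ such that, for all $\mathbf v_{\mathcal D}\in\mathbf U_{0,\mathcal D}$, $$\int_\Omega\sigma_{\mathcal D}(\mathbf u_{\mathcal D}):\varepsilon_{\mathcal D}(\mathbf v_{\mathcal D})+\mu_1S_{\mathcal D}(\mathbf u_{\mathcal D},\mathbf v_{\mathcal D})=\int_\Omega\mathbf f\cdot\widetilde\Pi^{\mathcal D}\mathbf v_{\mathcal D}.\tag{1}$$ *Interpolator and errors.* $(I_{\mathcal D}\mathbf u)_s=\mathbf u(\mathbf x_s)$ and $(I_{\mathcal D}\mathbf u)_\sigma=\frac1{|\sigma|}\int_\sigma\gamma^\sigma\mathbf u\cdot\mathbf n_\sigma-\sum_{s\in\mathcal V_\sigma}\omega_s^\sigma\,\mathbf u(\mathbf x_s)\cdot\mathbf n_\sigma$, where $\gamma^\sigma$ is the trace on $\sigma$ and the nodal values $\mathbf u(\mathbf x_s)$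 are those of the representative of $\mathbf u$ that is continuous on $\overline\Omega$ and vanishes on $\partial\Omega$ (they are set to $0$ by convention should there be none, so that no regularity of $\mathbf u$ is assumed). Moreover $$\|\mathbf v_{\mathcal D}\|_{1,\mathcal D}^2=\sum_{K\in\mathcal M}\left(\|\nabla^K\mathbf v_{\mathcal D}\|_{L^2(K)}^2+S_K(\mathbf v_{\mathcal D},\mathbf v_{\mathcal D})\right),\qquad C_{\mathcal D}(\mathbf u,\mathbf v_{\mathcal D})=\left(\|\nabla\mathbf u-\nabla^{\mathcal D}\mathbf v_{\mathcal D}\|_{L^2(\Omega)}^2+S_{\mathcal D}(\mathbf v_{\mathcal D},\mathbf v_{\mathcal D})\right)^{1/2},$$ $$\mathcal W_{\mathcal D}(\tau)=\sup_{\mathbf v_{\mathcal D}\in\mathbf U_{0,\mathcal D}}\frac{\int_\Omega\tau:\varepsilon_{\mathcal D}(\mathbf v_{\mathcal D})+\int_\Omega\widetilde\Pi^{\mathcal D}\mathbf v_{\mathcal D}\cdot\operatorname{\mathbf{div}}\tau}{\|\mathbf v_{\mathcal D}\|_{1,\mathcal D}}$$ (with the quotient read as $0$ at $\mathbf v_{\mathcal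 D}=0$). *Claim.* For every such $\Omega$ and every $\rho\in(0,1)$ there is a constant $C>0$, depending only on $\Omega$ and $\rho$ (in particular not on $\mu,\mu_1,\mu_2,\lambda,\mathbf f$, the mesh, or the weights), such that for every polytopal mesh of $\Omega$ that is regular with parameter $\rho$, every choice of weights, and every $\mu_1,\mu_2,\mu,\lambda,\mathbf f$ as above, the scheme (1) has a unique solution $\mathbf u_{\mathcal D}\in\mathbf U_{0,\mathcal D}$, and if $\mathbf u$ is the weak solution then $$\mu_1\|\nabla^{\mathcal D}\mathbf u_{\mathcal D}-\nabla\mathbf u\|_{L^2(\Omega)}\le C\left(\mathcal W_{\mathcal D}(\sigma(\mathbf u))+\mu_2\,C_{\mathcal D}(\mathbf u,I_{\mathcal D}\mathbf u)\right).$$ -/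

import Mathlib

open scoped ContDiff
open MeasureTheory Filter Topology

noncomputable section

/-! ## Vectors, matrices and `L²` norms -/

/-- The Euclidean space `ℝᵈ`. -/
abbrev Euc (d : ℕ) : Type := EuclideanSpace ℝ (Fin d)

/-- Real `d × d` matrices. -/
abbrev Mat (d : ℕ) : Type := Matrix (Fin d) (Fin d) ℝ

/-- The Frobenius product `A : B`. -/
def ddot {d : ℕ} (A B : Mat d) : ℝ := ∑ i, ∑ j, A i j * B i j

/-- The tensor product `(a ⊗ b)ᵢⱼ = aᵢ bⱼ`. -/
def tens {d : ℕ} (a b : Euc d) : Mat d := Matrix.of fun i j => a i * b j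

/-- The action of a matrix on a vector of `ℝᵈ`. -/
def matVec {d : ℕ} (A : Mat d) (x : Euc d) : Euc d :=
  WithLp.toLp 2 fun i => ∑ j, A i j * x j

/-- The symmetric part of a matrix. -/
def symPart {d : ℕ} (A : Mat d) : Mat d := (1 / 2 : ℝ) • (A + A.transpose)

/-- The stress attached to a displacement gradient `A`, for the Lamé coefficients `μ` and `lam`:
`2 μ ε + lam (tr ε) I` with `ε` the symmetric part of `A`. -/
def stress {d : ℕ} (μ lam : ℝ) (A : Mat d) : Mat d :=
  (2 * μ) • symPart A + (lam * (symPart A).trace) • (1 : Mat d)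

/-- The `L²(Ω)` norm of a matrix field (with the Frobenius norm on matrices). -/
def matL2Norm {d : ℕ} (Ω : Set (Euc d)) (G : Euc d → Mat d) : ℝ :=
  Real.sqrt (∫ x in Ω, ddot (G x) (G x))

/-- `G ∈ L²(Ω)^{d × d}`. -/
def MatMemL2 {d : ℕ} (Ω : Set (Euc d)) (G : Euc d → Mat d) : Prop :=
  ∀ i j, MemLp (fun x => G x i j) 2 (volume.restrict Ω)

/-! ## Weak derivatives, `H¹₀(Ω)^d`, traces -/

/-- `φ ∈ C_c^∞(Ω; F)`. -/
def IsTest {d : ℕ} {F : Type*} [NormedAddCommGroup F] [NormedSpace ℝ F]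
    (Ω : Set (Euc d)) (φ : Euc d → F) : Prop :=
  ContDiff ℝ ∞ φ ∧ HasCompactSupport φ ∧ tsupport φ ⊆ Ω

/-- The gradient of a vector field which is differentiable in the usual sense:
`(∇φ)ᵢⱼ = ∂ⱼ φᵢ`. -/
def classicalGrad {d : ℕ} (φ : Euc d → Euc d) (x : Euc d) : Mat d :=
  Matrix.of fun i j => (fderiv ℝ φ x (EuclideanSpace.single j 1)) i

/-- `G` is a weak gradient of the vector field `u` in `Ω`: `Gᵢⱼ = ∂ⱼ uᵢ`. -/
def IsWeakGrad {d : ℕ} (Ω : Set (Euc d)) (u : Euc d → Euc d) (G : Euc d → Mat d) : Prop :=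
  ∀ φ : Euc d → ℝ, IsTest Ω φ → ∀ i j,
    ∫ x in Ω, u x i * fderiv ℝ φ x (EuclideanSpace.single j 1) = - ∫ x in Ω, G x i j * φ x

/-- `u ∈ H¹(Ω)^d`. -/
def MemH1 {d : ℕ} (Ω : Set (Euc d)) (u : Euc d → Euc d) : Prop :=
  MemLp u 2 (volume.restrict Ω) ∧ ∃ G, MatMemL2 Ω G ∧ IsWeakGrad Ω u G

open Classical in
/-- The `L²(Ω)` weak gradient of `u` (unique almost everywhere in `Ω`; `0` if there is none). -/
def weakGrad {d : ℕ} (Ω : Set (Euc d)) (u : Euc d → Euc d) : Euc d → Mat d :=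
  if h : ∃ G, MatMemL2 Ω G ∧ IsWeakGrad Ω u G then h.choose else 0

/-- `g` is a weak (row-wise) divergence of the matrix field `τ` in `Ω`. -/
def IsWeakDiv {d : ℕ} (Ω : Set (Euc d)) (τ : Euc d → Mat d) (g : Euc d → Euc d) : Prop :=
  ∀ φ : Euc d → Euc d, IsTest Ω φ →
    ∫ x in Ω, inner ℝ (g x) (φ x) = - ∫ x in Ω, ddot (τ x) (classicalGrad φ x)

open Classical in
/-- The `L²(Ω)` weak divergence of `τ` (unique almost everywhere in `Ω`; `0` if there is none). -/
def weakDiv {d : ℕ} (Ω : Set (Euc d)) (τ : Euc d → Mat d) : Euc d → Euc d :=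
  if h : ∃ g, MemLp g 2 (volume.restrict Ω) ∧ IsWeakDiv Ω τ g then h.choose else 0

/-- The sequence `φ` in `C_c^∞(Ω)^d` converges to `u` in `H¹(Ω)^d`. -/
def TestApprox {d : ℕ} (Ω : Set (Euc d)) (u : Euc d → Euc d) (φ : ℕ → Euc d → Euc d) : Prop :=
  (∀ n, IsTest Ω (φ n)) ∧
  Tendsto (fun n => eLpNorm (fun x => φ n x - u x) 2 (volume.restrict Ω)) atTop (𝓝 0) ∧
  ∀ i j, Tendsto (fun n => eLpNorm (fun x => classicalGrad (φ n) x i j - weakGrad Ω u x i j) 2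
    (volume.restrict Ω)) atTop (𝓝 0)

/-- `u ∈ H¹₀(Ω)^d`, the closure of `C_c^∞(Ω)^d` in `H¹(Ω)^d`. -/
def MemH10 {d : ℕ} (Ω : Set (Euc d)) (u : Euc d → Euc d) : Prop :=
  MemH1 Ω u ∧ ∃ φ, TestApprox Ω u φ

/-- The surface (that is, `(d-1)`-dimensional) measure in `ℝᵈ`. -/
def surfMeasure (d : ℕ) : Measure (Euc d) := Measure.euclideanHausdorffMeasure (d - 1)

/-- `g ∈ L²(S)^d` is the trace on `S` of `u ∈ H¹₀(Ω)^d`: the trace operator is the extension by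
continuity of the restriction `φ ↦ φ|_S`, `φ ∈ C_c^∞(Ω)^d`. -/
def IsTrace {d : ℕ} (Ω : Set (Euc d)) (u : Euc d → Euc d) (S : Set (Euc d))
    (g : Euc d → Euc d) : Prop :=
  MemLp g 2 ((surfMeasure d).restrict S) ∧ ∃ φ, TestApprox Ω u φ ∧
    Tendsto (fun n => eLpNorm (fun x => φ n x - g x) 2 ((surfMeasure d).restrict S)) atTop (𝓝 0)

open Classical in
/-- The trace on `S` of `u ∈ H¹₀(Ω)^d`. -/
def trace {d : ℕ} (Ω : Set (Euc d)) (u : Euc d → Euc d) (S : Set (Euc d)) : Euc d → Euc d :=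
  if h : ∃ g, IsTrace Ω u S g then h.choose else 0

open Classical in
/-- The representative of `u` that is continuous on `closure Ω` and vanishes on `∂Ω` (its values
on `closure Ω` are unique; by convention the zero function if `u` has no such representative). -/
def contRep {d : ℕ} (Ω : Set (Euc d)) (u : Euc d → Euc d) : Euc d → Euc d :=
  if h : ∃ v : Euc d → Euc d, ContinuousOn v (closure Ω) ∧ (∀ x ∈ frontier Ω, v x = 0) ∧
    u =ᵐ[volume.restrict Ω] v then h.choose else 0

/-! ## The model -/

/-- `u ∈ H¹₀(Ω)^d` is the weak solution of the linear elasticity problem with load `f`. -/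
def IsWeakSolution {d : ℕ} (Ω : Set (Euc d)) (μ lam : ℝ) (f u : Euc d → Euc d) : Prop :=
  MemH10 Ω u ∧ ∀ v, MemH10 Ω v →
    ∫ x in Ω, ddot (stress μ lam (weakGrad Ω u x)) (symPart (weakGrad Ω v x)) =
      ∫ x in Ω, inner ℝ (f x) (v x)

/-! ## Polytopal meshes -/

/-- A polytope: a nonempty connected set that is the interior of a finite union of closed
`d`-simplices. -/
def IsPolytope {d : ℕ} (P : Set (Euc d)) : Prop :=
  IsConnected P ∧ ∃ T : Finset (Finset (Euc d)),
    (∀ t ∈ T, t.card = d + 1 ∧ AffineIndependent ℝ ((↑) : t → Euc d)) ∧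
    P = interior (⋃ t ∈ T, convexHull ℝ (t : Set (Euc d)))

/-- A polytopal mesh of the domain `Ω ⊆ ℝᵈ`, `d ∈ {2, 3}`: finitely many cells, faces, edges and
nodes (in dimension 2, the faces are the edges). Cells are open in `ℝᵈ`, faces are open in their
hyperplane, edges are open segments. -/
structure PolyMesh (d : ℕ) (Ω : Set (Euc d)) where
  nC : ℕ
  nF : ℕ
  nE : ℕ
  nV : ℕ
  cell : Fin nC → Set (Euc d)
  face : Fin nF → Set (Euc d)
  /-- the two end points of an edge -/
  edge : Fin nE → Fin nV × Fin nV
  node : Fin nV → Euc d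
  /-- the fixed unit normal `n_σ` of a face -/
  normal : Fin nF → Euc d
  /-- the relative orientation `w_{Kσ} = ± 1` of a face with respect to a cell -/
  orient : Fin nC → Fin nF → ℝ
  -- cells
  cell_polytope : ∀ K, IsPolytope (cell K)
  cell_disjoint : ∀ K L, K ≠ L → Disjoint (cell K) (cell L)
  cell_cover : closure Ω = ⋃ K, closure (cell K)
  -- faces: disjoint nonempty connected relatively open subsets of hyperplanes
  face_connected : ∀ σ, IsConnected (face σ)
  face_disjoint : ∀ σ τ, σ ≠ τ → Disjoint (face σ) (face τ)
  normal_unit : ∀ σ, ‖normal σ‖ = 1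
  face_planar : ∀ σ, ∃ (c : ℝ) (O : Set (Euc d)), IsOpen O ∧
    face σ = O ∩ {x | inner ℝ (normal σ) x = c}
  -- the faces of a cell make up its boundary
  cell_frontier : ∀ K, frontier (cell K) =
    ⋃ σ ∈ {σ : Fin nF | face σ ⊆ frontier (cell K)}, closure (face σ)
  -- a face is either a boundary face, of one cell, or an interface between two cells
  face_cells : ∀ σ,
    (face σ ⊆ frontier Ω ∧ {K | face σ ⊆ frontier (cell K)}.ncard = 1) ∨
    (face σ ⊆ Ω ∧ {K | face σ ⊆ frontier (cell K)}.ncard = 2)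
  -- `w_{Kσ} n_σ` is the unit normal to `σ` that points out of `K`
  orient_eq : ∀ K σ, face σ ⊆ frontier (cell K) → orient K σ = 1 ∨ orient K σ = -1
  orient_outward : ∀ K σ, face σ ⊆ frontier (cell K) → ∀ x ∈ face σ, ∀ᶠ t in 𝓝[>] (0 : ℝ),
    x - t • (orient K σ • normal σ) ∈ cell K ∧ x + t • (orient K σ • normal σ) ∉ cell K
  -- nodes and edges
  node_injective : Function.Injective node
  edge_ne : ∀ e, (edge e).1 ≠ (edge e).2
  edge_disjoint : ∀ e e', e ≠ e' →
    Disjoint (openSegment ℝ (node (edge e).1) (node (edge e).2))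
      (openSegment ℝ (node (edge e').1) (node (edge e').2))
  node_notMem_edge : ∀ s e, node s ∉ openSegment ℝ (node (edge e).1) (node (edge e).2)
  node_edge : ∀ s, ∃ e, s = (edge e).1 ∨ s = (edge e).2
  -- in dimension 2 the faces are the edges
  face_edge_two : d = 2 →
    (∀ σ, ∃ e, face σ = openSegment ℝ (node (edge e).1) (node (edge e).2)) ∧
    (∀ e, ∃ σ, face σ = openSegment ℝ (node (edge e).1) (node (edge e).2))
  -- in dimension 3 the relative boundary of a face is made of edges, each edge being of this kind
  face_edge_three : d = 3 →
    (∀ σ, closure (face σ) \ face σ =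
      ⋃ e ∈ {e | openSegment ℝ (node (edge e).1) (node (edge e).2) ⊆ closure (face σ) \ face σ},
        segment ℝ (node (edge e).1) (node (edge e).2)) ∧
    (∀ e, ∃ σ, openSegment ℝ (node (edge e).1) (node (edge e).2) ⊆ closure (face σ) \ face σ)

namespace PolyMesh

variable {d : ℕ} {Ω : Set (Euc d)} (D : PolyMesh d Ω)

/-- The diameter `h_K` of a cell. -/
def diamC (K : Fin D.nC) : ℝ := Metric.diam (D.cell K)

/-- The measure `|K|` of a cell. -/
def measC (K : Fin D.nC) : ℝ := volume.real (D.cell K)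

/-- The measure `|σ|` of a face. -/
def measF (σ : Fin D.nF) : ℝ := (surfMeasure d).real (D.face σ)

open Classical in
/-- The faces `F_K` of a cell. -/
def facesC (K : Fin D.nC) : Finset (Fin D.nF) :=
  Finset.univ.filter fun σ => D.face σ ⊆ frontier (D.cell K)

open Classical in
/-- The nodes `V_σ` of a face. -/
def nodesF (σ : Fin D.nF) : Finset (Fin D.nV) :=
  Finset.univ.filter fun s => D.node s ∈ closure (D.face σ)

open Classical in
/-- The nodes `V_K` of a cell. -/
def nodesC (K : Fin D.nC) : Finset (Fin D.nV) :=
  Finset.univ.filter fun s => D.node s ∈ closure (D.cell K)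

/-- The unit normal `n_{Kσ}` to the face `σ` of `K`, outward to `K`. -/
def outNormal (K : Fin D.nC) (σ : Fin D.nF) : Euc d := D.orient K σ • D.normal σ

/-- The mesh is regular with parameter `ρ`: it has a matching simplicial submesh whose simplices
are `ρ`-shape-regular (they contain a ball of radius `ρ` times their diameter) and of diameter at
least `ρ h_K` when contained in the cell `K`. -/
def IsRegular (ρ : ℝ) : Prop :=
  ∃ S : Geometry.SimplicialComplex ℝ (Euc d),
    S.faces.Finite ∧ S.space = closure Ω ∧
    (∀ t ∈ S.faces, ∃ t' ∈ S.faces, t ⊆ t' ∧ t'.card = d + 1) ∧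
    (∀ t ∈ S.faces, t.card = d + 1 →
      (∃ x, Metric.ball x (ρ * Metric.diam (convexHull ℝ (t : Set (Euc d)))) ⊆
        convexHull ℝ (t : Set (Euc d))) ∧
      ∃ K, interior (convexHull ℝ (t : Set (Euc d))) ⊆ D.cell K ∧
        ρ * D.diamC K ≤ Metric.diam (convexHull ℝ (t : Set (Euc d)))) ∧
    (∀ t ∈ S.faces, t.card = d → ∀ σ,
      Disjoint (intrinsicInterior ℝ (convexHull ℝ (t : Set (Euc d)))) (D.face σ) ∨
      intrinsicInterior ℝ (convexHull ℝ (t : Set (Euc d))) ⊆ D.face σ)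

/-- The discrete space `U_D`: one vector per node, one scalar per face. -/
abbrev DOF : Type := (Fin D.nV → Euc d) × (Fin D.nF → ℝ)

/-- The subspace `U_{0,D}`: zero values at the nodes and faces that lie on `∂Ω`. -/
def U0 : Set D.DOF :=
  {v | (∀ s, D.node s ∈ frontier Ω → v.1 s = 0) ∧
    ∀ σ, D.face σ ⊆ frontier Ω → v.2 σ = 0}

end PolyMesh

/-! ## The scheme -/

/-- A polytopal mesh with nonnegative weights that express the centers of mass of its faces and
cells as convex combinations of their nodes. -/
structure Discretization (d : ℕ) (Ω : Set (Euc d)) extends PolyMesh d Ω where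
  wF : Fin nF → Fin nV → ℝ
  wC : Fin nC → Fin nV → ℝ
  wF_nonneg : ∀ σ, ∀ s ∈ toPolyMesh.nodesF σ, 0 ≤ wF σ s
  wF_sum : ∀ σ, ∑ s ∈ toPolyMesh.nodesF σ, wF σ s = 1
  wF_center : ∀ σ, ∑ s ∈ toPolyMesh.nodesF σ, wF σ s • node s = ⨍ x in face σ, x ∂(surfMeasure d)
  wC_nonneg : ∀ K, ∀ s ∈ toPolyMesh.nodesC K, 0 ≤ wC K s
  wC_sum : ∀ K, ∑ s ∈ toPolyMesh.nodesC K, wC K s = 1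
  wC_center : ∀ K, ∑ s ∈ toPolyMesh.nodesC K, wC K s • node s = ⨍ x in cell K, x

namespace Discretization

variable {d : ℕ} {Ω : Set (Euc d)} (D : Discretization d Ω)

/-- The face average of the nodal values. -/
def avgF (v : D.DOF) (σ : Fin D.nF) : Euc d := ∑ s ∈ D.nodesF σ, D.wF σ s • v.1 s

/-- The cell average of the nodal values. -/
def avgC (v : D.DOF) (K : Fin D.nC) : Euc d := ∑ s ∈ D.nodesC K, D.wC K s • v.1 s

/-- The gradient reconstruction `∇^K` (a constant matrix). -/
def gradC (v : D.DOF) (K : Fin D.nC) : Mat d :=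
  (1 / D.measC K) • ∑ σ ∈ D.facesC K, D.measF σ • tens (D.avgF v σ) (D.outNormal K σ) +
  (1 / D.measC K) • ∑ σ ∈ D.facesC K,
    (D.measF σ * v.2 σ) • tens (D.normal σ) (D.outNormal K σ)

/-- The displacement reconstruction `Π^K`. -/
def dispC (v : D.DOF) (K : Fin D.nC) (x : Euc d) : Euc d :=
  matVec (D.gradC v K) (x - ⨍ y in D.cell K, y) + D.avgC v K

/-- The global piecewise constant gradient `∇^D`. -/
def gradD (v : D.DOF) (x : Euc d) : Mat d :=
  ∑ K, (D.cell K).indicator (fun _ => D.gradC v K) x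

/-- The global piecewise constant displacement reconstruction. -/
def dispD (v : D.DOF) (x : Euc d) : Euc d :=
  ∑ K, (D.cell K).indicator (fun _ => D.avgC v K) x

/-- The local stabilisation `S_K`. -/
def stabC (K : Fin D.nC) (u v : D.DOF) : ℝ :=
  D.diamC K ^ (d - 2) * ∑ s ∈ D.nodesC K,
    inner ℝ (u.1 s - D.dispC u K (D.node s)) (v.1 s - D.dispC v K (D.node s)) +
  D.diamC K ^ (d - 2) * ∑ σ ∈ D.facesC K, u.2 σ * v.2 σ

/-- The stabilisation `S_D`. -/
def stab (u v : D.DOF) : ℝ := ∑ K, D.stabC K u v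

/-- The discrete `H¹`-like norm `‖·‖_{1,D}`. -/
def norm1 (v : D.DOF) : ℝ :=
  Real.sqrt (∑ K, (matL2Norm (D.cell K) (fun _ => D.gradC v K) ^ 2 + D.stabC K v v))

/-- `uD ∈ U_{0,D}` solves the scheme. -/
def IsSolution (μ₁ μ lam : ℝ) (f : Euc d → Euc d) (uD : D.DOF) : Prop :=
  uD ∈ D.U0 ∧ ∀ vD ∈ D.U0,
    (∫ x in Ω, ddot (stress μ lam (D.gradD uD x)) (symPart (D.gradD vD x))) + μ₁ * D.stab uD vD =
      ∫ x in Ω, inner ℝ (f x) (D.dispD vD x)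

/-- The interpolator: nodal values are those of (the continuous representative of) `u`, and the
value at a face `σ` is the mean over `σ` of `(γ^σ u - Π^σ (I_D u)) · n_σ`, in which the affine
function `Π^σ (I_D u)` has the mean value `∑ ω_s^σ u(x_s)` over `σ`. -/
def interp (u : Euc d → Euc d) : D.DOF :=
  (fun s => contRep Ω u (D.node s),
   fun σ => (1 / D.measF σ) *
      (∫ x in D.face σ, inner ℝ (trace Ω u (D.face σ) x) (D.normal σ) ∂(surfMeasure d)) -
      inner ℝ (∑ s ∈ D.nodesF σ, D.wF σ s • contRep Ω u (D.node s)) (D.normal σ))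

/-- The primal consistency error `C_D(u, v)`. -/
def primalErr (u : Euc d → Euc d) (v : D.DOF) : ℝ :=
  Real.sqrt (matL2Norm Ω (fun x => weakGrad Ω u x - D.gradD v x) ^ 2 + D.stab v v)

/-- The form `w_D(τ, v)`. -/
def adjForm (τ : Euc d → Mat d) (v : D.DOF) : ℝ :=
  (∫ x in Ω, ddot (τ x) (symPart (D.gradD v x))) +
    ∫ x in Ω, inner ℝ (D.dispD v x) (weakDiv Ω τ x)

/-- The adjoint consistency error `W_D(τ)`. -/
def adjErr (τ : Euc d → Mat d) : ℝ :=
  ⨆ v : D.U0, D.adjForm τ v / D.norm1 v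

end Discretization

end

/-! The estimate is a second Strang lemma for e = I_D u − u_D, arranged so that λ never enters the
constant. Subtracting the scheme from the discrete form at I_D u, and using div σ(u) = −f, writes
the form at (e, e) as the adjoint form of σ(u) at e, plus 2μ ∫ ε(∇^D I_D u − ∇u) : ε_D(e), plus μ₁
S(I_D u, e), plus λ times the integral of tr(∇^D I_D u − ∇u) tr(∇^D e). The last term is zero
(`integral_trace_interp`): the face unknowns of I_D u correct the normal flux of the nodal averages
to the exact flux of u, so by the divergence theorem on K the trace of ∇^K I_D u is the mean of div
u over K, while the trace of ∇^D e is constant on K. Writing W for the adjoint and P for the primal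
consistency error, what remains is at most (W + 3μ₂P)‖e‖_{1,D}.

Coercivity (`mul_norm1_sq_le`) rests on a discrete Korn inequality (`integral_gradD_le`) whose
constant depends on d and ρ only. The reconstructions of a discrete field are discontinuous across
cells; they are compared with a continuous, piecewise affine field w on the simplicial submesh that
vanishes outside Ω (`exists_conforming`). The vertices of the submesh need not be nodes. Such a
vertex is either inside a cell, where the reconstruction is its value, or a convex combination of
nodes common to all the cells at that vertex (`exists_carrier`), and the same combination of the
nodal vectors is its value. The distance of that value to each reconstruction is bounded by nodal
residuals, hence by S_K, and an inverse estimate on shape-regular simplices bounds ∇w − ∇^K v. For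
compactly supported Lipschitz fields Korn's inequality holds with constant 2, because the integral
of ∂ⱼwᵢ ∂ᵢwⱼ, summed over i and j, is that of (div w)². The same w shows that ‖·‖_{1,D} is definite
on U_{0,D}; this gives unique solvability and the finiteness of W.

The divergence theorem on a polytopal cell is proved by slicing (`indicator_cell_eq`): at almost
every point the indicator of the cell is a signed sum of indicators of half-infinite cylinders over
its faces, because the relative boundaries of the faces have codimension two. It extends to H¹₀ by
density and the trace inequality on hyperplanes. -/

noncomputable section

/-! ## Slicing along a unit vector, surface measure on hyperplanes -/

/-- The hyperplane through the origin that is orthogonal to `n`. -/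
abbrev perp {d : ℕ} (n : Euc d) : Submodule ℝ (Euc d) := (Submodule.span ℝ {n})ᗮ

lemma inner_perp {d : ℕ} (n : Euc d) (y : perp n) : inner ℝ n (y : Euc d) = 0 :=
  Submodule.mem_orthogonal_singleton_iff_inner_right.1 y.2

lemma finrank_perp {d : ℕ} {n : Euc d} (hn : ‖n‖ = 1) : Module.finrank ℝ (perp n) = d - 1 := by
  have h0 : n ≠ 0 := by rintro rfl; simp at hn
  have h1 := (Submodule.span ℝ {n}).finrank_add_finrank_orthogonal
  rw [finrank_span_singleton h0, finrank_euclideanSpace, Fintype.card_fin] at h1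
  change Module.finrank ℝ (Submodule.span ℝ {n})ᗮ = _
  omega

/-- The parametrisation of `ℝᵈ` by `n^⊥ × ℝ`. -/
def sliceMap {d : ℕ} (n : Euc d) (q : perp n × ℝ) : Euc d := (q.1 : Euc d) + q.2 • n

lemma measurePreserving_sliceMap {d : ℕ} {n : Euc d} (hn : ‖n‖ = 1) :
    MeasurePreserving (sliceMap n) (volume.prod volume) volume := by
  have h0 : n ≠ 0 := by rintro rfl; simp at hn
  have hf := LinearIsometryEquiv.measurePreserving (LinearIsometryEquiv.toSpanUnitSingleton n hn)
  have h2 := (Submodule.measurePreserving_measurableEquivProd (Submodule.span ℝ {n}) (0 : Euc d)).symm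
  rw [InnerProductSpace.euclideanHausdorffMeasure_eq_volume] at h2
  have h3 : MeasurePreserving (fun q : perp n × ℝ => (q.2, q.1)) (volume.prod volume)
      (volume.prod volume) := Measure.measurePreserving_swap
  have h4 := (h2.comp ((hf.prod (MeasurePreserving.id volume)).comp h3))
  have h5 : sliceMap n = _ := funext fun q => (by simp [sliceMap, add_comm] : _ = (⇑((Submodule.span ℝ {n}).measurableEquivProd (0 : Euc d)).symm ∘
      Prod.map (⇑(LinearIsometryEquiv.toSpanUnitSingleton n hn)) id ∘ fun q => (q.2, q.1)) q)
  rw [h5]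
  exact h4

/-- Both sides are Hausdorff measures of dimension d − 1: on n^⊥ that measure is Lebesgue measure,
and an isometric embedding carries it to its restriction to the range. -/
lemma map_perp_volume {d : ℕ} {n : Euc d} (hn : ‖n‖ = 1) (c : ℝ) :
    Measure.map (fun y : perp n => (y : Euc d) + c • n) volume =
      (surfMeasure d).restrict {x | inner ℝ n x = c} := by
  have hiso : Isometry (fun y : perp n => (y : Euc d) + c • n) :=
    (IsometryEquiv.addRight (c • n)).isometry.comp isometry_subtype_coe
  rw [surfMeasure, ← finrank_perp hn, ← InnerProductSpace.euclideanHausdorffMeasure_eq_volume,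
    hiso.map_euclideanHausdorffMeasure]
  congr 1
  ext x
  simp only [Set.mem_range, Set.mem_ofPred_eq]
  constructor
  · rintro ⟨y, rfl⟩
    rw [inner_add_right, inner_perp, inner_smul_right, real_inner_self_eq_norm_sq, hn]; simp
  · intro hx
    refine ⟨⟨x - c • n, ?_⟩, by simp⟩
    rw [Submodule.mem_orthogonal_singleton_iff_inner_right, inner_sub_right, hx, inner_smul_right,
      real_inner_self_eq_norm_sq, hn]; simp

/-- The parametrisation of the hyperplane `⟨n, x⟩ = c` by `n^⊥`. -/
lemma measurableEmbedding_planeMap {d : ℕ} (n : Euc d) (c : ℝ) :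
    MeasurableEmbedding (fun y : perp n => (y : Euc d) + c • n) :=
  ((Homeomorph.addRight (c • n)).isClosedEmbedding.comp
    (Submodule.closed_of_finiteDimensional _).isClosedEmbedding_subtypeVal).measurableEmbedding

/-- `f` decreases along the line `x + ℝ e`: the restriction of a compactly supported function to
a line is compactly supported. -/
lemma isClosedEmbedding_line {d : ℕ} (x : Euc d) {e : Euc d} (he : e ≠ 0) :
    Topology.IsClosedEmbedding (fun r : ℝ => x + r • e) :=
  (Homeomorph.addLeft x).isClosedEmbedding.comp (isClosedEmbedding_smul_left he)

lemma hasDerivAt_line {d : ℕ} {F : Type*} [NormedAddCommGroup F] [NormedSpace ℝ F] {g : Euc d → F}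
    (hg : ContDiff ℝ 1 g) (x e : Euc d) (r : ℝ) :
    HasDerivAt (fun r : ℝ => g (x + r • e)) (fderiv ℝ g (x + r • e) e) r := by
  have h1 : HasDerivAt (fun r : ℝ => x + r • e) e r := by
    simpa using ((hasDerivAt_id r).smul_const e).const_add x
  exact ((hg.differentiable one_ne_zero) _).hasFDerivAt.comp_hasDerivAt r h1

lemma contDiff_line {d : ℕ} {F : Type*} [NormedAddCommGroup F] [NormedSpace ℝ F] {g : Euc d → F}
    (hg : ContDiff ℝ 1 g) (x e : Euc d) : ContDiff ℝ 1 (fun r : ℝ => g (x + r • e)) :=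
  hg.comp (by fun_prop)

/-- On each line parallel to n, the value of |g| at height c is at most the integral of |∂ₙg| over a
half-line, by compact support. Fubini's theorem then gives the bound. -/
lemma lintegral_plane_le {d : ℕ} {n : Euc d} (hn : ‖n‖ = 1) (c : ℝ) {g : Euc d → ℝ}
    (hg : ContDiff ℝ 1 g) (hc : HasCompactSupport g) :
    ∫⁻ x in {x | inner ℝ n x = c}, ‖g x‖ₑ ∂(surfMeasure d) ≤ ∫⁻ x, ‖fderiv ℝ g x n‖ₑ := by
  have h0 : n ≠ 0 := by rintro rfl; simp at hn
  rw [← map_perp_volume hn c, (measurableEmbedding_planeMap n c).lintegral_map,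
    ← (measurePreserving_sliceMap hn).lintegral_comp
      (by have := hg.continuous_fderiv one_ne_zero; fun_prop),
    lintegral_prod _ (by
      have := hg.continuous_fderiv one_ne_zero
      have := (measurePreserving_sliceMap hn).measurable
      fun_prop)]
  refine lintegral_mono fun y => ?_
  refine (HasCompactSupport.enorm_le_lintegral_Ici_deriv (contDiff_line hg (y : Euc d) n)
    (hc.comp_isClosedEmbedding (isClosedEmbedding_line _ h0)) c).trans ?_
  refine (setLIntegral_le_lintegral _ _).trans_eq ?_
  simp only [(hasDerivAt_line hg _ _ _).deriv, sliceMap]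

/-- The trace inequality on hyperplanes. -/
lemma eLpNorm_plane_sq_le {d : ℕ} {n : Euc d} (hn : ‖n‖ = 1) (c : ℝ) {φ : Euc d → Euc d}
    (hφ : ContDiff ℝ 1 φ) (hc : HasCompactSupport φ) :
    eLpNorm φ 2 ((surfMeasure d).restrict {x | inner ℝ n x = c}) ^ 2 ≤
      eLpNorm φ 2 volume ^ 2 + eLpNorm (fun x => fderiv ℝ φ x n) 2 volume ^ 2 := by
  have key : ∀ (μ : Measure (Euc d)) (ψ : Euc d → Euc d), eLpNorm ψ 2 μ ^ 2 = ∫⁻ x, ‖ψ x‖ₑ ^ 2 ∂μ := by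
    intro μ ψ
    have := eLpNorm_nnreal_pow_eq_lintegral (f := ψ) (μ := μ) (p := 2) two_ne_zero
    simpa using this
  have hg : ContDiff ℝ 1 (fun x => ‖φ x‖ ^ 2) := hφ.norm_sq ℝ
  have hgc : HasCompactSupport (fun x => ‖φ x‖ ^ 2) :=
    hc.comp_left (g := fun v => ‖v‖ ^ 2) (by simp)
  rw [key, key, key, ← lintegral_add_left (by have := hφ.continuous; fun_prop)]
  calc _ = ∫⁻ x in {x | inner ℝ n x = c}, ‖‖φ x‖ ^ 2‖ₑ ∂(surfMeasure d) := by simp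
    _ ≤ _ := lintegral_plane_le hn c hg hgc
    _ ≤ _ := ?_
  refine lintegral_mono fun x => ?_
  -- The inequality for hyperplanes is applied to |φ|², whose derivative 2 φ · ∂ₙφ is at most |φ|² +
  -- |∂ₙφ|² in absolute value.
  have h1 : fderiv ℝ (fun x => ‖φ x‖ ^ 2) x n = 2 * inner ℝ (φ x) (fderiv ℝ φ x n) := by
    have := ((hφ.differentiable one_ne_zero) x).hasFDerivAt.norm_sq
    rw [this.fderiv]; simp
  rw [h1, ← enorm_norm (φ x), ← enorm_norm (fderiv ℝ φ x n), ← enorm_pow, ← enorm_pow,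
    ← Real.enorm_abs, Real.enorm_of_nonneg (abs_nonneg _), Real.enorm_of_nonneg (sq_nonneg _),
    Real.enorm_of_nonneg (sq_nonneg _), ← ENNReal.ofReal_add (sq_nonneg _) (sq_nonneg _)]
  apply ENNReal.ofReal_le_ofReal
  rw [abs_mul, abs_two]
  have := abs_real_inner_le_norm (φ x) (fderiv ℝ φ x n)
  nlinarith [sq_nonneg (‖φ x‖ - ‖fderiv ℝ φ x n‖)]

/-! ## Integration over slanted cylinders -/

/-- The half-infinite open cylinder with base `S` and direction `e`. -/
def cylinder {d : ℕ} (S : Set (Euc d)) (e : Euc d) : Set (Euc d) :=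
  {x | ∃ y ∈ S, ∃ s : ℝ, 0 < s ∧ x = y + s • e}

/-- The height of a point over the base is read off its component along n, which grows at the
nonzero rate ⟨n, e⟩ in the direction e. -/
lemma mem_cylinder_iff {d : ℕ} {n e : Euc d} {c : ℝ} {S : Set (Euc d)}
    (hS : ∀ x ∈ S, inner ℝ n x = c) (hne : inner ℝ n e ≠ (0 : ℝ)) (x : Euc d) :
    x ∈ cylinder S e ↔ 0 < (inner ℝ n x - c) / inner ℝ n e ∧
      x - ((inner ℝ n x - c) / inner ℝ n e) • e ∈ S := by
  constructor
  · rintro ⟨y, hy, s, hs, rfl⟩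
    have : (inner ℝ n (y + s • e) - c) / inner ℝ n e = s := by
      rw [inner_add_right, hS y hy, inner_smul_right]; field_simp; ring
    rw [this]
    simpa [hs] using hy
  · rintro ⟨h1, h2⟩
    exact ⟨_, h2, _, h1, by simp⟩

lemma measurableSet_cylinder {d : ℕ} {n e : Euc d} {c : ℝ} {S : Set (Euc d)}
    (hS : ∀ x ∈ S, inner ℝ n x = c) (hne : inner ℝ n e ≠ (0 : ℝ)) (hm : MeasurableSet S) :
    MeasurableSet (cylinder S e) := by
  have : cylinder S e = {x | 0 < (inner ℝ n x - c) / inner ℝ n e} ∩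
      (fun x => x - ((inner ℝ n x - c) / inner ℝ n e) • e) ⁻¹' S := by
    ext x; exact mem_cylinder_iff hS hne x
  rw [this]
  exact (measurableSet_lt measurable_const (by fun_prop)).inter (hm.preimage (by fun_prop))

/-- The oblique coordinates (y, s) come from the orthogonal ones by a shear along n^⊥, which
preserves measure, and by the rescaling r = c + ⟨n, e⟩ s, which produces the factor |⟨n, e⟩|. -/
lemma integral_slanted {d : ℕ} {n e : Euc d} (hn : ‖n‖ = 1) (hne : inner ℝ n e ≠ (0 : ℝ)) (c : ℝ)
    {F : Euc d → ℝ} (hF : Integrable F) :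
    Integrable (fun q : perp n × ℝ => F ((q.1 : Euc d) + c • n + q.2 • e)) (volume.prod volume) ∧
    ∫ x, F x = |inner ℝ n e| * ∫ y : perp n, ∫ s : ℝ, F ((y : Euc d) + c • n + s • e) := by
  set a : ℝ := inner ℝ n e with ha
  -- The tangential part of e is the direction of the shear.
  have het : e - a • n ∈ perp n := by
    rw [Submodule.mem_orthogonal_singleton_iff_inner_right, inner_sub_right, inner_smul_right,
      real_inner_self_eq_norm_sq, hn, ← ha]; ring
  let t : perp n := ⟨e - a • n, het⟩
  have hskew : MeasurePreserving (fun q : ℝ × perp n => (q.1, q.2 + (a⁻¹ * (q.1 - c)) • t))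
      (volume.prod volume) (volume.prod volume) := by
    refine (MeasurePreserving.id volume).skew_product (g := fun r y => y + (a⁻¹ * (r - c)) • t)
      ?_ (Eventually.of_forall fun r => ?_)
    · simp only [Function.uncurry_def]; fun_prop
    · exact (measurePreserving_add_right volume _).map_eq
  have hmp := ((measurePreserving_sliceMap hn).comp
    (Measure.measurePreserving_swap (μ := volume) (ν := volume))).comp hskew
  have hval : ∀ q : ℝ × perp n, (sliceMap n ∘ Prod.swap) (q.1, q.2 + (a⁻¹ * (q.1 - c)) • t) =
      (q.2 : Euc d) + c • n + (a⁻¹ * (q.1 - c)) • e := by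
    intro q
    simp only [sliceMap, Function.comp, Prod.swap, Submodule.coe_add, Submodule.coe_smul, t,
      smul_sub, smul_smul]
    have : a⁻¹ * (q.1 - c) * a = q.1 - c := by field_simp
    rw [this, sub_smul]; abel
  have hI := hmp.integrable_comp_of_integrable hF
  have hI' : Integrable (fun q : ℝ × perp n => F ((q.2 : Euc d) + c • n + (a⁻¹ * (q.1 - c)) • e))
      (volume.prod volume) := by
    refine hI.congr (Eventually.of_forall fun q => ?_)
    simp only [Function.comp_apply] at hval ⊢
    rw [← hval]
  have hemb : MeasurePreserving (fun q : ℝ × perp n => (c + a * q.1, q.2))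
      (volume.prod volume) ((ENNReal.ofReal |a⁻¹| • volume).prod volume) := by
    refine MeasurePreserving.prod (f := fun r : ℝ => c + a * r) (g := id) ?_ (MeasurePreserving.id _)
    refine ⟨by fun_prop, ?_⟩
    have h1 : (fun r : ℝ => c + a * r) = (fun r => c + r) ∘ (fun r => a * r) := rfl
    rw [h1, ← Measure.map_map (by fun_prop) (by fun_prop), Real.map_volume_mul_left hne,
      Measure.map_smul, map_add_left_eq_self]
  have hI2 : Integrable (fun q : ℝ × perp n => F ((q.2 : Euc d) + c • n + q.1 • e))
      (volume.prod volume) := by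
    have h2 : Integrable (fun q : ℝ × perp n => F ((q.2 : Euc d) + c • n + (a⁻¹ * (q.1 - c)) • e))
        ((ENNReal.ofReal |a⁻¹| • volume).prod volume) := by
      rw [Measure.prod_smul_left]
      exact hI'.smul_measure ENNReal.ofReal_ne_top
    refine (hemb.integrable_comp_of_integrable h2).congr (Eventually.of_forall fun q => ?_)
    have : a⁻¹ * (c + a * q.1 - c) = q.1 := by field_simp; ring
    simp only [Function.comp_apply, this]
  have hI3 : Integrable (fun q : perp n × ℝ => F ((q.1 : Euc d) + c • n + q.2 • e))
      (volume.prod volume) := hI2.swap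
  refine ⟨hI3, ?_⟩
  calc ∫ x, F x = ∫ q : ℝ × perp n, F ((q.2 : Euc d) + c • n + (a⁻¹ * (q.1 - c)) • e)
        ∂(volume.prod volume) := by
        rw [← hmp.map_eq, integral_map hmp.measurable.aemeasurable
          (by rw [hmp.map_eq]; exact hF.aestronglyMeasurable)]
        refine integral_congr_ae (Eventually.of_forall fun q => ?_)
        simp only [Function.comp_apply] at hval ⊢
        rw [← hval]
    _ = ∫ r : ℝ, ∫ y : perp n, F ((y : Euc d) + c • n + (a⁻¹ * (r - c)) • e) :=
        integral_prod _ hI'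
    _ = |a| * ∫ s : ℝ, ∫ y : perp n, F ((y : Euc d) + c • n + s • e) := by
        have := Measure.integral_comp_mul_left
          (fun s : ℝ => ∫ y : perp n, F ((y : Euc d) + c • n + s • e)) a⁻¹
        rw [integral_sub_right_eq_self
          (fun r => ∫ y : perp n, F ((y : Euc d) + c • n + (a⁻¹ * r) • e)) c, this]
        simp
    _ = _ := by rw [integral_integral_swap hI2]

/-- The integral of a directional derivative over a half-infinite cylinder. -/
lemma integral_cylinder {d : ℕ} {n e : Euc d} (hn : ‖n‖ = 1) (hne : inner ℝ n e ≠ (0 : ℝ)) {c : ℝ}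
    {S : Set (Euc d)} (hS : ∀ x ∈ S, inner ℝ n x = c) (hm : MeasurableSet S) {g : Euc d → ℝ}
    (hg : ContDiff ℝ 1 g) (hc : HasCompactSupport g) :
    ∫ x in cylinder S e, fderiv ℝ g x e = - (|inner ℝ n e| * ∫ x in S, g x ∂(surfMeasure d)) := by
  have h0 : e ≠ 0 := by rintro rfl; simp at hne
  have hcont : Continuous (fun x => fderiv ℝ g x e) :=
    (hg.continuous_fderiv one_ne_zero).clm_apply continuous_const
  have hcs : HasCompactSupport (fun x => fderiv ℝ g x e) := hc.fderiv_apply (𝕜 := ℝ) e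
  have hint : Integrable (fun x => fderiv ℝ g x e) := hcont.integrable_of_hasCompactSupport hcs
  rw [← integral_indicator (measurableSet_cylinder hS hne hm),
    (integral_slanted hn hne c (hint.indicator (measurableSet_cylinder hS hne hm))).2, ← mul_neg]
  congr 1
  have hres : (surfMeasure d).restrict S =
      ((surfMeasure d).restrict {x | inner ℝ n x = c}).restrict S := by
    rw [Measure.restrict_restrict hm]
    congr 1
    exact (Set.inter_eq_left.2 hS).symm
  rw [hres, ← map_perp_volume hn c, ← integral_indicator hm,
    (measurableEmbedding_planeMap n c).integral_map, ← integral_neg]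
  refine integral_congr_ae (Eventually.of_forall fun y => ?_)
  -- In oblique coordinates the cylinder is the product of its base with the half-line s > 0, so the
  -- inner integral is that of a derivative.
  have hmem : ∀ s : ℝ, (y : Euc d) + c • n + s • e ∈ cylinder S e ↔
      0 < s ∧ (y : Euc d) + c • n ∈ S := by
    intro s
    rw [mem_cylinder_iff hS hne]
    have : (inner ℝ n ((y : Euc d) + c • n + s • e) - c) / inner ℝ n e = s := by
      rw [inner_add_right, inner_add_right, inner_perp, inner_smul_right, inner_smul_right,
        real_inner_self_eq_norm_sq, hn]; field_simp; ring
    rw [this]; simp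
  simp only
  by_cases hy : (y : Euc d) + c • n ∈ S
  · rw [Set.indicator_of_mem hy]
    have : (fun s : ℝ => (cylinder S e).indicator (fun x => fderiv ℝ g x e)
        ((y : Euc d) + c • n + s • e)) = (Set.Ioi (0 : ℝ)).indicator
        (deriv (fun s : ℝ => g ((y : Euc d) + c • n + s • e))) := by
      ext s
      by_cases hs : 0 < s
      · rw [Set.indicator_of_mem ((hmem s).2 ⟨hs, hy⟩), Set.indicator_of_mem (Set.mem_Ioi.2 hs),
          (hasDerivAt_line hg _ _ _).deriv]
      · rw [Set.indicator_of_notMem (fun h => hs ((hmem s).1 h).1),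
          Set.indicator_of_notMem (by simpa using hs)]
    rw [this, integral_indicator measurableSet_Ioi, HasCompactSupport.integral_Ioi_deriv_eq
      (contDiff_line hg _ e) (hc.comp_isClosedEmbedding (isClosedEmbedding_line _ h0))]
    simp
  · rw [Set.indicator_of_notMem hy]
    have : ∀ s : ℝ, (cylinder S e).indicator (fun x => fderiv ℝ g x e)
        ((y : Euc d) + c • n + s • e) = 0 :=
      fun s => Set.indicator_of_notMem (fun h => hy ((hmem s).1 h).2) _
    simp [this]

/-! ## Null sets -/

lemma volume_hyperplane {d : ℕ} {n : Euc d} (hn : ‖n‖ = 1) (c : ℝ) :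
    volume {x : Euc d | inner ℝ n x = c} = 0 := by
  have hm : MeasurableSet {x : Euc d | inner ℝ n x = c} :=
    (isClosed_eq (by fun_prop) continuous_const).measurableSet
  rw [← (measurePreserving_sliceMap hn).measure_preimage hm.nullMeasurableSet]
  have : sliceMap n ⁻¹' {x : Euc d | inner ℝ n x = c} = Set.univ ×ˢ {c} := by
    ext ⟨y, r⟩
    change inner ℝ n ((y : Euc d) + r • n) = c ↔ _
    rw [inner_add_right, inner_perp, inner_smul_right, real_inner_self_eq_norm_sq, hn]
    simp
  rw [this, Measure.prod_prod]
  simp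

/-- `Z` is contained in a finite union of affine subspaces of codimension at least two. -/
def IsThin {d : ℕ} (Z : Set (Euc d)) : Prop :=
  ∃ L : Set (AffineSubspace ℝ (Euc d)), L.Finite ∧
    (∀ A ∈ L, Module.finrank ℝ A.direction + 2 ≤ d) ∧ Z ⊆ ⋃ A ∈ L, (A : Set (Euc d))

lemma IsThin.iUnion {d : ℕ} {ι : Type*} [Finite ι] {Z : ι → Set (Euc d)} (h : ∀ i, IsThin (Z i)) :
    IsThin (⋃ i, Z i) := by
  choose L hf hr hs using h
  refine ⟨⋃ i, L i, Set.finite_iUnion hf, ?_, ?_⟩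
  · rintro A hA
    obtain ⟨i, hi⟩ := Set.mem_iUnion.1 hA
    exact hr i A hi
  · rw [Set.iUnion_subset_iff]
    intro i x hx
    obtain ⟨A, hA, hxA⟩ := Set.mem_iUnion₂.1 (hs i hx)
    exact Set.mem_iUnion₂.2 ⟨A, Set.mem_iUnion.2 ⟨i, hA⟩, hxA⟩

lemma IsThin.mono {d : ℕ} {Z Z' : Set (Euc d)} (h : IsThin Z) (hZ : Z' ⊆ Z) : IsThin Z' := by
  obtain ⟨L, h1, h2, h3⟩ := h
  exact ⟨L, h1, h2, hZ.trans h3⟩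

lemma isThin_segment {a b : Euc 3} : IsThin (segment ℝ a b) := by
  refine ⟨{affineSpan ℝ {a, b}}, Set.finite_singleton _, ?_, ?_⟩
  · rintro A rfl
    rw [direction_affineSpan]
    have := (collinear_iff_finrank_le_one (k := ℝ) (s := {a, b})).1 (collinear_pair ℝ a b)
    omega
  · simp only [Set.mem_singleton_iff, Set.iUnion_iUnion_eq_left]
    rw [← convexHull_pair]
    exact convexHull_subset_affineSpan _

lemma isThin_singleton {d : ℕ} (hd : 2 ≤ d) (a : Euc d) : IsThin {a} := by
  refine ⟨{affineSpan ℝ {a}}, Set.finite_singleton _, ?_, ?_⟩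
  · rintro A rfl
    rw [direction_affineSpan, vectorSpan_singleton, finrank_bot]
    omega
  · simp

/-- The lines of direction e that meet an affine subspace of direction W through p fill p + W + ℝe,
a subspace of dimension at most d − 1. -/
lemma volume_mk'_sup_span {d : ℕ} (p e : Euc d) (W : Submodule ℝ (Euc d))
    (hW : Module.finrank ℝ W + 2 ≤ d) :
    volume (AffineSubspace.mk' p (W ⊔ Submodule.span ℝ {e}) : Set (Euc d)) = 0 := by
  refine Measure.addHaar_affineSubspace _ _ fun h => ?_
  have h1 : (AffineSubspace.mk' p (W ⊔ Submodule.span ℝ {e})).direction = ⊤ := by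
    rw [h, AffineSubspace.direction_top]
  rw [AffineSubspace.direction_mk'] at h1
  have h2 := Submodule.finrank_add_le_finrank_add_finrank W (Submodule.span ℝ {e})
  rw [h1, finrank_top, finrank_euclideanSpace, Fintype.card_fin] at h2
  have h3 := finrank_span_le_card (R := ℝ) ({e} : Set (Euc d))
  simp at h3
  omega

/-- Almost no line of a given direction meets a thin set. -/
lemma IsThin.ae_line {d : ℕ} {Z : Set (Euc d)} (hZ : IsThin Z) (e : Euc d) :
    ∀ᵐ x : Euc d, ∀ t : ℝ, x + t • e ∉ Z := by
  obtain ⟨L, hf, hr, hs⟩ := hZ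
  have key : ∀ A ∈ L, ∀ᵐ x : Euc d, ∀ t : ℝ, x + t • e ∉ A := by
    intro A hA
    rcases (A : Set (Euc d)).eq_empty_or_nonempty with h | ⟨p, hp⟩
    · refine Eventually.of_forall fun x t hx => ?_
      have : x + t • e ∈ (A : Set (Euc d)) := hx
      simp [h] at this
    · refine measure_mono_null ?_ (volume_mk'_sup_span p e _ (hr A hA))
      intro x hx
      simp only [Set.mem_compl_iff, Set.mem_ofPred_eq, not_forall, not_not] at hx
      obtain ⟨t, ht⟩ := hx
      rw [SetLike.mem_coe, AffineSubspace.mem_mk', vsub_eq_sub]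
      have h1 := AffineSubspace.vsub_mem_direction ht hp
      rw [vsub_eq_sub] at h1
      have : x - p = (x + t • e - p) + (-t) • e := by rw [neg_smul]; abel
      rw [this]
      exact Submodule.add_mem_sup h1 (Submodule.smul_mem _ _ (Submodule.mem_span_singleton_self e))
  have := (ae_ball_iff hf.countable).2 key
  filter_upwards [this] with x hx t ht
  obtain ⟨A, hA, hxA⟩ := Set.mem_iUnion₂.1 (hs ht)
  exact hx A hA t hxA

/-- A point is joined to almost every point by a segment that misses a given thin set. -/
lemma IsThin.ae_join {d : ℕ} {Z : Set (Euc d)} (hZ : IsThin Z) :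
    ∀ᵐ q : Euc d, ∀ᵐ q' : Euc d, ∀ t : ℝ, q + t • (q' - q) ∉ Z := by
  obtain ⟨L, hf, hr, hs⟩ := hZ
  have h0 : ∀ A ∈ L, ∀ᵐ q : Euc d, q ∉ A := by
    intro A hA
    refine measure_mono_null (t := (A : Set (Euc d))) (fun x hx => ?_)
      (Measure.addHaar_affineSubspace _ _ fun h => ?_)
    · simpa using hx
    · have := hr A hA
      rw [h, AffineSubspace.direction_top, finrank_top, finrank_euclideanSpace,
        Fintype.card_fin] at this
      omega
  filter_upwards [(ae_ball_iff hf.countable).2 h0] with q hq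
  have key : ∀ A ∈ L, ∀ᵐ q' : Euc d, ∀ t : ℝ, q + t • (q' - q) ∉ A := by
    intro A hA
    rcases (A : Set (Euc d)).eq_empty_or_nonempty with h | ⟨p, hp⟩
    · refine Eventually.of_forall fun x t hx => ?_
      have : q + t • (x - q) ∈ (A : Set (Euc d)) := hx
      simp [h] at this
    -- For q off A and p in A, every line from q that meets A stays in q + A.direction + ℝ(p − q),
    -- which is a null set.
    · refine measure_mono_null ?_ (volume_mk'_sup_span q (p - q) _ (hr A hA))
      intro x hx
      simp only [Set.mem_compl_iff, Set.mem_ofPred_eq, not_forall, not_not] at hx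
      obtain ⟨t, ht⟩ := hx
      rw [SetLike.mem_coe, AffineSubspace.mem_mk', vsub_eq_sub]
      have h1 := AffineSubspace.vsub_mem_direction ht hp
      rw [vsub_eq_sub] at h1
      have ht0 : t ≠ 0 := by
        rintro rfl
        exact hq A hA (by simpa using ht)
      have : x - q = t⁻¹ • (q + t • (x - q) - p) + t⁻¹ • (p - q) := by
        rw [← smul_add, sub_add_sub_cancel, add_sub_cancel_left, smul_smul, inv_mul_cancel₀ ht0,
          one_smul]
      rw [this]
      exact Submodule.add_mem_sup (Submodule.smul_mem _ _ h1)
        (Submodule.smul_mem _ _ (Submodule.mem_span_singleton_self _))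
  filter_upwards [(ae_ball_iff hf.countable).2 key] with x hx t ht
  obtain ⟨A, hA, hxA⟩ := Set.mem_iUnion₂.1 (hs ht)
  exact hx A hA t hxA

/-- Otherwise the interior of `t` and the complement of its closure would separate `s`. -/
lemma inter_frontier_nonempty {X : Type*} [TopologicalSpace X] {s t : Set X}
    (hs : IsPreconnected s) (h1 : (s ∩ t).Nonempty) (h2 : (s ∩ tᶜ).Nonempty) :
    (s ∩ frontier t).Nonempty := by
  by_contra h
  rw [Set.not_nonempty_iff_eq_empty] at h
  have hf : ∀ x ∈ s, x ∉ frontier t := fun x hx hxt => by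
    have : x ∈ s ∩ frontier t := ⟨hx, hxt⟩
    simp [h] at this
  obtain ⟨x, hx, hxt⟩ := h1
  obtain ⟨y, hy, hyt⟩ := h2
  obtain ⟨z, _, hz1, hz2⟩ := hs (interior t) (closure t)ᶜ isOpen_interior isClosed_closure.isOpen_compl
    (fun z hz => by
      by_cases hzc : z ∈ closure t
      · exact Or.inl (by_contra fun h' => hf z hz ⟨hzc, h'⟩)
      · exact Or.inr hzc)
    ⟨x, hx, by_contra fun h' => hf x hx ⟨subset_closure hxt, h'⟩⟩
    ⟨y, hy, fun h' => hf y hy ⟨h', fun h'' => hyt (interior_subset h'')⟩⟩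
  exact hz2 (subset_closure (interior_subset hz1))

/-! ## Elementary properties of polytopes and meshes -/

namespace IsPolytope

variable {d : ℕ} {P : Set (Euc d)} (hP : IsPolytope P)
include hP

lemma isOpen : IsOpen P := by
  obtain ⟨_, T, _, h⟩ := hP
  rw [h]; exact isOpen_interior

lemma nonempty : P.Nonempty := hP.1.nonempty

/-- A finite union of simplices is compact, and the interior of any closed set equals the interior
of its own closure. -/
lemma isCompact_closure_and_interior : IsCompact (closure P) ∧ interior (closure P) = P := by
  obtain ⟨_, T, _, h⟩ := hP
  have hc : IsCompact (⋃ t ∈ T, convexHull ℝ (t : Set (Euc d))) :=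
    T.isCompact_biUnion fun t _ => t.finite_toSet.isCompact_convexHull ℝ
  have hs : closure P ⊆ ⋃ t ∈ T, convexHull ℝ (t : Set (Euc d)) := by
    rw [h]
    exact hc.isClosed.closure_subset_iff.2 interior_subset
  refine ⟨hc.of_isClosed_subset isClosed_closure hs, subset_antisymm ?_ ?_⟩
  · conv_rhs => rw [h]
    exact interior_mono hs
  · refine interior_maximal subset_closure ?_
    rw [h]; exact isOpen_interior

lemma isCompact_closure : IsCompact (closure P) := hP.isCompact_closure_and_interior.1

lemma interior_closure : interior (closure P) = P := hP.isCompact_closure_and_interior.2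

lemma isBounded : Bornology.IsBounded P := hP.isCompact_closure.isBounded.subset subset_closure

lemma measurableSet : MeasurableSet P := hP.isOpen.measurableSet

lemma volume_ne_top : volume P ≠ ⊤ := hP.isBounded.measure_lt_top.ne

end IsPolytope

namespace PolyMesh

variable {d : ℕ} {Ω : Set (Euc d)} (D : PolyMesh d Ω)

lemma mem_facesC {K : Fin D.nC} {σ : Fin D.nF} : σ ∈ D.facesC K ↔ D.face σ ⊆ frontier (D.cell K) := by
  simp [facesC]

lemma mem_nodesF {σ : Fin D.nF} {s : Fin D.nV} : s ∈ D.nodesF σ ↔ D.node s ∈ closure (D.face σ) := by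
  simp [nodesF]

lemma mem_nodesC {K : Fin D.nC} {s : Fin D.nV} : s ∈ D.nodesC K ↔ D.node s ∈ closure (D.cell K) := by
  simp [nodesC]

lemma exists_mem_facesC (σ : Fin D.nF) : ∃ K, σ ∈ D.facesC K := by
  have : {K | D.face σ ⊆ frontier (D.cell K)}.ncard ≠ 0 := by
    rcases D.face_cells σ with h | h <;> rw [h.2] <;> norm_num
  obtain ⟨K, hK⟩ := Set.nonempty_of_ncard_ne_zero this
  exact ⟨K, D.mem_facesC.2 hK⟩

lemma closure_face_subset {K : Fin D.nC} {σ : Fin D.nF} (h : σ ∈ D.facesC K) :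
    closure (D.face σ) ⊆ frontier (D.cell K) :=
  closure_minimal (D.mem_facesC.1 h) isClosed_frontier

lemma mem_frontier_cell {K : Fin D.nC} {x : Euc d} :
    x ∈ frontier (D.cell K) ↔ ∃ σ ∈ D.facesC K, x ∈ closure (D.face σ) := by
  constructor
  · intro h
    rw [D.cell_frontier K] at h
    obtain ⟨σ, hσ, hx⟩ := Set.mem_iUnion₂.1 h
    exact ⟨σ, D.mem_facesC.2 hσ, hx⟩
  · rintro ⟨σ, hσ, hx⟩
    exact D.closure_face_subset hσ hx

lemma isBounded_face (σ : Fin D.nF) : Bornology.IsBounded (D.face σ) := by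
  obtain ⟨K, hK⟩ := D.exists_mem_facesC σ
  exact (D.cell_polytope K).isCompact_closure.isBounded.subset
    ((D.mem_facesC.1 hK).trans frontier_subset_closure)

/-- The constant `c` in the equation `⟨n_σ, x⟩ = c` of the hyperplane of a face. -/
def level (σ : Fin D.nF) : ℝ := (D.face_planar σ).choose

lemma face_eq_inter (σ : Fin D.nF) : ∃ O : Set (Euc d), IsOpen O ∧
    D.face σ = O ∩ {x | inner ℝ (D.normal σ) x = D.level σ} :=
  (D.face_planar σ).choose_spec

lemma inner_normal {σ : Fin D.nF} {x : Euc d} (hx : x ∈ D.face σ) :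
    inner ℝ (D.normal σ) x = D.level σ := by
  obtain ⟨O, _, h⟩ := D.face_eq_inter σ
  rw [h] at hx
  exact hx.2

lemma inner_normal_closure {σ : Fin D.nF} {x : Euc d} (hx : x ∈ closure (D.face σ)) :
    inner ℝ (D.normal σ) x = D.level σ :=
  (closure_minimal (fun _ h => D.inner_normal h)
    (isClosed_eq (f := fun x : Euc d => inner ℝ (D.normal σ) x) (by fun_prop)
      continuous_const)) hx

lemma measurableSet_face (σ : Fin D.nF) : MeasurableSet (D.face σ) := by
  obtain ⟨O, hO, h⟩ := D.face_eq_inter σ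
  rw [h]
  exact hO.measurableSet.inter (isClosed_eq (by fun_prop) continuous_const).measurableSet

lemma ae_notMem_closure_face : ∀ᵐ x : Euc d, ∀ σ, x ∉ closure (D.face σ) := by
  rw [ae_all_iff]
  intro σ
  refine measure_mono_null (fun x hx => ?_) (volume_hyperplane (D.normal_unit σ) (D.level σ))
  exact D.inner_normal_closure (by simpa using hx)

/-- The relative boundary of a face. -/
def relBd (σ : Fin D.nF) : Set (Euc d) := closure (D.face σ) \ D.face σ

lemma relBd_two (hd : d = 2) (σ : Fin D.nF) : ∃ e, D.face σ =
    openSegment ℝ (D.node (D.edge e).1) (D.node (D.edge e).2) ∧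
    closure (D.face σ) = segment ℝ (D.node (D.edge e).1) (D.node (D.edge e).2) ∧
    D.relBd σ ⊆ {D.node (D.edge e).1, D.node (D.edge e).2} := by
  obtain ⟨e, he⟩ := (D.face_edge_two hd).1 σ
  refine ⟨e, he, by rw [he, closure_openSegment], ?_⟩
  rw [relBd, he, closure_openSegment]
  rintro x ⟨hx, hx'⟩
  have := insert_endpoints_openSegment ℝ (D.node (D.edge e).1) (D.node (D.edge e).2)
  rw [← this] at hx
  rcases hx with h | h | h
  · exact Or.inl h
  · exact Or.inr h
  · exact absurd h hx'

/-- A relative boundary point of a face is a node in dimension 2 and lies on an edge in dimension 3.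
-/
lemma isThin_relBd (hd : d = 2 ∨ d = 3) : IsThin (⋃ σ, D.relBd σ) := by
  refine IsThin.iUnion fun σ => ?_
  rcases hd with rfl | rfl
  · obtain ⟨e, -, -, he⟩ := D.relBd_two rfl σ
    refine IsThin.mono (IsThin.iUnion (Z := fun s => {D.node s}) fun s =>
      isThin_singleton le_rfl _) (he.trans ?_)
    rintro x (rfl | rfl)
    · exact Set.mem_iUnion.2 ⟨_, rfl⟩
    · exact Set.mem_iUnion.2 ⟨_, rfl⟩
  · refine IsThin.mono (IsThin.iUnion (Z := fun e =>
      segment ℝ (D.node (D.edge e).1) (D.node (D.edge e).2)) fun e => isThin_segment) ?_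
    rw [relBd, (D.face_edge_three rfl).1 σ]
    exact Set.iUnion₂_subset fun e _ => Set.subset_iUnion_of_subset e subset_rfl

lemma inner_outNormal (K : Fin D.nC) (σ : Fin D.nF) (x : Euc d) :
    inner ℝ (D.outNormal K σ) x = D.orient K σ * inner ℝ (D.normal σ) x := by
  rw [outNormal, real_inner_smul_left]

lemma norm_outNormal {K : Fin D.nC} {σ : Fin D.nF} (h : σ ∈ D.facesC K) :
    ‖D.outNormal K σ‖ = 1 := by
  rcases D.orient_eq K σ (D.mem_facesC.1 h) with h | h <;> simp [outNormal, h, D.normal_unit]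

/-- Near a point of a face, off the other faces of the cell, a cell is a half ball. -/
lemma eventually_mem_cell_iff {K : Fin D.nC} {σ : Fin D.nF} (hσ : σ ∈ D.facesC K) {x : Euc d}
    (hx : x ∈ D.face σ) (hτ : ∀ τ ∈ D.facesC K, τ ≠ σ → x ∉ closure (D.face τ)) :
    ∀ᶠ y in 𝓝 x, y ∈ D.cell K ↔ inner ℝ (D.outNormal K σ) y < inner ℝ (D.outNormal K σ) x := by
  obtain ⟨O, hO, hface⟩ := D.face_eq_inter σ
  set ν := D.outNormal K σ with hν
  have hνn : ‖ν‖ = 1 := D.norm_outNormal hσ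
  have hplane : ∀ y, inner ℝ ν y = inner ℝ ν x ↔ inner ℝ (D.normal σ) y = D.level σ := by
    intro y
    rw [hν, D.inner_outNormal, D.inner_outNormal, D.inner_normal hx]
    have h1 : D.orient K σ ≠ 0 := by
      rcases D.orient_eq K σ (D.mem_facesC.1 hσ) with h | h <;> rw [h] <;> norm_num
    exact ⟨fun h => mul_left_cancel₀ h1 h, fun h => by rw [h]⟩
  have h1 : ∀ᶠ y in 𝓝 x, ∀ τ ∈ D.facesC K, τ ≠ σ → y ∉ closure (D.face τ) := by
    rw [(D.facesC K).eventually_all]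
    intro τ hτK
    by_cases h : τ = σ
    · exact Eventually.of_forall fun y h' => absurd h h'
    · filter_upwards [isClosed_closure.isOpen_compl.mem_nhds (hτ τ hτK h)] with y hy _
      exact hy
  have h2 : ∀ᶠ y in 𝓝 x, y ∈ O := hO.mem_nhds (by rw [hface] at hx; exact hx.1)
  obtain ⟨r, hr, hball⟩ := Metric.eventually_nhds_iff_ball.1 (h1.and h2)
  -- In a small ball the boundary of the cell is confined to the hyperplane of σ. Each open half
  -- ball is connected and misses it, so it is entirely inside or entirely outside the cell;
  -- `orient_outward` tells which.
  have hfr : ∀ y ∈ Metric.ball x r, y ∈ frontier (D.cell K) → inner ℝ ν y = inner ℝ ν x := by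
    intro y hy hyK
    obtain ⟨τ, hτK, hyτ⟩ := D.mem_frontier_cell.1 hyK
    have : τ = σ := by
      by_contra h
      exact (hball y hy).1 τ hτK h hyτ
    subst this
    exact (hplane y).2 (D.inner_normal_closure hyτ)
  have hout := D.orient_outward K σ (D.mem_facesC.1 hσ) x hx
  have hsmall : ∀ᶠ t in 𝓝[>] (0 : ℝ), t < r ∧ 0 < t :=
    ((gt_mem_nhds hr).filter_mono nhdsWithin_le_nhds).and self_mem_nhdsWithin
  obtain ⟨t, ⟨hin, hnot⟩, htr, ht0⟩ := (hout.and hsmall).exists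
  rw [← outNormal, ← hν] at hin hnot
  have hlin : ∀ s : ℝ, inner ℝ ν (x + s • ν) = inner ℝ ν x + s := by
    intro s
    rw [inner_add_right, inner_smul_right, real_inner_self_eq_norm_sq, hνn]; ring
  have hb : ∀ s : ℝ, |s| < r → x + s • ν ∈ Metric.ball x r := by
    intro s hs
    simpa [norm_smul, hνn] using hs
  have hconv1 : IsPreconnected (Metric.ball x r ∩ {y | inner ℝ ν y < inner ℝ ν x}) :=
    ((convex_ball x r).inter (convex_halfSpace_lt (innerSL ℝ ν).isLinear _)).isPreconnected
  have hconv2 : IsPreconnected (Metric.ball x r ∩ {y | inner ℝ ν x < inner ℝ ν y}) :=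
    ((convex_ball x r).inter (convex_halfSpace_gt (innerSL ℝ ν).isLinear _)).isPreconnected
  filter_upwards [Metric.ball_mem_nhds x hr] with y hy
  constructor
  · intro hyK
    by_contra hlt
    rcases (not_lt.1 hlt).lt_or_eq with h | h
    · obtain ⟨z, hz, hzf⟩ := inter_frontier_nonempty hconv2 (t := D.cell K) ⟨y, ⟨hy, h⟩, hyK⟩
        ⟨x + t • ν, ⟨hb t (by rwa [abs_of_pos ht0]), by
          change inner ℝ ν x < inner ℝ ν (x + t • ν); rw [hlin]; linarith⟩, hnot⟩
      exact hz.2.ne' (hfr z hz.1 hzf)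
    -- On the hyperplane itself, y belongs to the face, hence to the boundary of the open cell.
    · have : y ∈ D.face σ := by
        rw [hface]
        exact ⟨(hball y hy).2, (hplane y).1 h.symm⟩
      have := D.mem_facesC.1 hσ this
      rw [(D.cell_polytope K).isOpen.frontier_eq] at this
      exact this.2 hyK
  · intro hlt
    by_contra hyK
    rw [sub_eq_add_neg, ← neg_smul] at hin
    obtain ⟨z, hz, hzf⟩ := inter_frontier_nonempty hconv1 (t := D.cell K)
      ⟨x + (-t) • ν, ⟨hb (-t) (by rwa [abs_neg, abs_of_pos ht0]), by
          change inner ℝ ν (x + (-t) • ν) < inner ℝ ν x; rw [hlin]; linarith⟩, hin⟩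
      ⟨y, ⟨hy, hlt⟩, hyK⟩
    exact hz.2.ne (hfr z hz.1 hzf)

end PolyMesh

/-! ### The divergence theorem on a cell, by counting crossings along lines -/

namespace PolyMesh

variable {d : ℕ} {Ω : Set (Euc d)} (D : PolyMesh d Ω)

/-- The parameter at which the line `x + ℝ e` crosses the hyperplane of the face `σ`. -/
def crossing (e x : Euc d) (σ : Fin D.nF) : ℝ :=
  (D.level σ - inner ℝ (D.normal σ) x) / inner ℝ (D.normal σ) e

lemma crossing_eq {e x : Euc d} {σ : Fin D.nF} {s : ℝ} (hne : inner ℝ (D.normal σ) e ≠ (0 : ℝ))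
    (h : x + s • e ∈ closure (D.face σ)) : D.crossing e x σ = s := by
  have := D.inner_normal_closure h
  rw [inner_add_right, inner_smul_right] at this
  rw [crossing, ← this]
  field_simp; ring

open Classical in
/-- The contribution of the face `σ` to the counting function along the line `x + ℝ e`. -/
def faceStep (K : Fin D.nC) (e x : Euc d) (σ : Fin D.nF) (s : ℝ) : ℝ :=
  if x + D.crossing e x σ • e ∈ D.face σ ∧ (D.crossing e x σ < s ∨
    (D.crossing e x σ = s ∧ 0 < inner ℝ (D.outNormal K σ) e)) then
    SignType.sign (inner ℝ (D.outNormal K σ) e : ℝ) else 0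

open Classical in
-- The step can only change at the crossing parameter, and only if the crossing point lies in the
-- face.
lemma faceStep_eventually {K : Fin D.nC} {e x : Euc d} {σ : Fin D.nF} {s : ℝ}
    (h : x + s • e ∉ D.face σ) : ∀ᶠ t in 𝓝 s, D.faceStep K e x σ t = D.faceStep K e x σ s := by
  by_cases hm : x + D.crossing e x σ • e ∈ D.face σ
  · have hne : D.crossing e x σ ≠ s := by rintro rfl; exact h hm
    rcases hne.lt_or_gt with hlt | hlt
    · filter_upwards [lt_mem_nhds hlt] with t ht
      exact if_congr (by simp [ht, hlt]) rfl rfl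
    · filter_upwards [gt_mem_nhds hlt] with t ht
      exact if_congr (by simp [hlt.not_gt, ht.not_gt, hlt.ne', ht.ne']) rfl rfl
  · exact Eventually.of_forall fun t => by simp [faceStep, hm]

open Classical in
-- On exit the indicator drops from 1 to 0 while the step rises from 0 to 1; on entry the indicator
-- rises and the step falls to −1. The cell is open, so its indicator is 0 at the crossing itself:
-- this is why the step is already counted there on exit but not on entry.
lemma indicator_add_faceStep_eventually {K : Fin D.nC} {e x : Euc d} {σ : Fin D.nF} {s : ℝ}
    (hσ : σ ∈ D.facesC K) (hx : x + s • e ∈ D.face σ)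
    (hτ : ∀ τ ∈ D.facesC K, τ ≠ σ → x + s • e ∉ closure (D.face τ))
    (hne : inner ℝ (D.normal σ) e ≠ (0 : ℝ)) :
    ∀ᶠ t in 𝓝 s, (if x + t • e ∈ D.cell K then (1 : ℝ) else 0) + D.faceStep K e x σ t =
      (if x + s • e ∈ D.cell K then (1 : ℝ) else 0) + D.faceStep K e x σ s := by
  have hcr := D.crossing_eq hne (subset_closure hx)
  have hc : ContinuousAt (fun t : ℝ => x + t • e) s := by fun_prop
  have hev := hc.eventually (D.eventually_mem_cell_iff hσ hx hτ)
  have hno : x + s • e ∉ D.cell K := by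
    have := hev.self_of_nhds
    simp [this]
  filter_upwards [hev] with t ht
  have hin : (inner ℝ (D.outNormal K σ) (x + t • e) < inner ℝ (D.outNormal K σ) (x + s • e)) ↔
      (t - s) * inner ℝ (D.outNormal K σ) e < 0 := by
    simp only [inner_add_right, inner_smul_right]
    constructor <;> intro h <;> nlinarith
  rw [hin] at ht
  have hne' : inner ℝ (D.outNormal K σ) e ≠ (0 : ℝ) := by
    rw [D.inner_outNormal]
    refine mul_ne_zero ?_ hne
    rcases D.orient_eq K σ (D.mem_facesC.1 hσ) with h | h <;> rw [h] <;> norm_num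
  simp only [faceStep, hcr, hx, true_and, ht, hno, if_false, lt_irrefl, false_or, zero_add]
  rcases hne'.lt_or_gt with ha | ha
  · have h1 : (t - s) * inner ℝ (D.outNormal K σ) e < 0 ↔ s < t := by
      rw [mul_neg_iff]; simp [ha, ha.not_gt]
    by_cases hst : s < t
    · simp [h1, hst, ha.not_gt, sign_neg ha]
    · simp [h1, hst, ha.not_gt]
  · have h1 : (t - s) * inner ℝ (D.outNormal K σ) e < 0 ↔ t < s := by
      rw [mul_neg_iff]; simp [ha, ha.not_gt]
    rcases lt_trichotomy t s with hst | hst | hst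
    · simp [h1, hst, ha, sign_pos ha, hst.not_gt, hst.ne']
    · simp [hst, ha, sign_pos ha]
    · simp [h1, hst, ha, sign_pos ha, hst.not_gt]

open Classical in
/-- The indicator function of a cell in terms of cylinders over its faces. -/
lemma indicator_cell_eq {K : Fin D.nC} {e x : Euc d} (he : e ≠ 0)
    (h1 : ∀ t : ℝ, x + t • e ∉ ⋃ σ, D.relBd σ)
    (h2 : ∀ σ, inner ℝ (D.normal σ) e = (0 : ℝ) → inner ℝ (D.normal σ) x ≠ D.level σ)
    (h3 : ∀ σ, x ∉ closure (D.face σ)) :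
    (D.cell K).indicator (fun _ => (1 : ℝ)) x = - ∑ σ ∈ D.facesC K,
      SignType.sign (inner ℝ (D.outNormal K σ) e : ℝ) *
        (cylinder (D.face σ) e).indicator (fun _ => (1 : ℝ)) x := by
  -- The indicator plus the signed count of the crossings so far is locally constant along the line
  -- and zero near −∞, hence zero at s = 0. There, the crossings so far are those at negative
  -- parameters, that is, the cylinders that contain x.
  let k : ℝ → ℝ := fun s => (if x + s • e ∈ D.cell K then (1 : ℝ) else 0) +
    ∑ σ ∈ D.facesC K, D.faceStep K e x σ s
  have hcl : ∀ σ (s : ℝ), x + s • e ∈ closure (D.face σ) → x + s • e ∈ D.face σ ∧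
      inner ℝ (D.normal σ) e ≠ (0 : ℝ) := by
    intro σ s hs
    constructor
    · by_contra hn
      exact h1 s (Set.mem_iUnion.2 ⟨σ, hs, hn⟩)
    · intro h0
      have := D.inner_normal_closure hs
      rw [inner_add_right, inner_smul_right, h0, mul_zero, add_zero] at this
      exact h2 σ h0 this
  have hloc : IsLocallyConstant k := by
    rw [IsLocallyConstant.iff_eventually_eq]
    intro s
    by_cases hfr : x + s • e ∈ frontier (D.cell K)
    · obtain ⟨σ, hσ, hxσ⟩ := D.mem_frontier_cell.1 hfr
      obtain ⟨hxσ', hne⟩ := hcl σ s hxσ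
      have hτ : ∀ τ ∈ D.facesC K, τ ≠ σ → x + s • e ∉ closure (D.face τ) := fun τ _ hτσ h =>
        Set.disjoint_left.1 (D.face_disjoint τ σ hτσ) (hcl τ s h).1 hxσ'
      have hA := D.indicator_add_faceStep_eventually hσ hxσ' hτ hne
      have hB : ∀ᶠ t in 𝓝 s, ∀ τ ∈ (D.facesC K).erase σ,
          D.faceStep K e x τ t = D.faceStep K e x τ s := by
        rw [Finset.eventually_all]
        intro τ hτ'
        exact D.faceStep_eventually fun h => hτ τ (Finset.mem_of_mem_erase hτ')
          (Finset.ne_of_mem_erase hτ') (subset_closure h)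
      filter_upwards [hA, hB] with t hA hB
      simp only [k]
      rw [← Finset.add_sum_erase _ _ hσ, ← Finset.add_sum_erase _ _ hσ, ← add_assoc, ← add_assoc, hA,
        Finset.sum_congr rfl hB]
    · have hB : ∀ᶠ t in 𝓝 s, ∀ τ ∈ D.facesC K,
          D.faceStep K e x τ t = D.faceStep K e x τ s := by
        rw [Finset.eventually_all]
        intro τ hτ
        exact D.faceStep_eventually fun h => hfr (D.mem_facesC.1 hτ h)
      have hc : ContinuousAt (fun t : ℝ => x + t • e) s := by fun_prop
      have hA : ∀ᶠ t in 𝓝 s, (x + t • e ∈ D.cell K ↔ x + s • e ∈ D.cell K) := by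
        by_cases hin : x + s • e ∈ D.cell K
        · filter_upwards [hc.eventually ((D.cell_polytope K).isOpen.mem_nhds hin)] with t ht
          exact ⟨fun _ => hin, fun _ => ht⟩
        · have : x + s • e ∈ (closure (D.cell K))ᶜ := fun h => hfr ⟨h, fun h' =>
            hin (interior_subset h')⟩
          filter_upwards [hc.eventually (isClosed_closure.isOpen_compl.mem_nhds this)] with t ht
          exact ⟨fun h => absurd (subset_closure h) ht, fun h => absurd h hin⟩
      filter_upwards [hA, hB] with t hA hB
      simp only [k]
      rw [Finset.sum_congr rfl hB]
      simp only [hA]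
  have hzero : ∀ᶠ s in atBot, k s = 0 := by
    have hA : ∀ᶠ s : ℝ in atBot, x + s • e ∉ D.cell K := by
      have h := (isClosedEmbedding_line x he).tendsto_cocompact
      have h' := (h.mono_left (atBot_le_cocompact (α := ℝ))).eventually
        (D.cell_polytope K).isCompact_closure.compl_mem_cocompact
      filter_upwards [h'] with s hs hmem
      exact hs (subset_closure hmem)
    have hB : ∀ᶠ s : ℝ in atBot, ∀ σ, s < D.crossing e x σ := by
      rw [eventually_all]
      exact fun σ => eventually_lt_atBot _
    filter_upwards [hA, hB] with s hA hB
    simp only [k, hA, if_false, zero_add]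
    refine Finset.sum_eq_zero fun σ _ => ?_
    simp [faceStep, (hB σ).not_gt, (hB σ).ne']
  obtain ⟨s, hs⟩ := hzero.exists
  have hk0 : k 0 = 0 := by rw [← hs]; exact hloc.apply_eq_of_preconnectedSpace _ _
  have hfin : ∀ σ ∈ D.facesC K, D.faceStep K e x σ 0 =
      SignType.sign (inner ℝ (D.outNormal K σ) e : ℝ) *
        (cylinder (D.face σ) e).indicator (fun _ => (1 : ℝ)) x := by
    intro σ hσ
    by_cases h0 : inner ℝ (D.normal σ) e = (0 : ℝ)
    · simp [faceStep, D.inner_outNormal, h0]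
    · have hiff := mem_cylinder_iff (fun y hy => D.inner_normal hy) h0 x (S := D.face σ)
      have hcr : (inner ℝ (D.normal σ) x - D.level σ) / inner ℝ (D.normal σ) e =
          - D.crossing e x σ := by rw [crossing, ← neg_div, neg_sub]
      rw [hcr, neg_smul, sub_neg_eq_add, neg_pos] at hiff
      -- As x is on no face, the convention at the crossing parameter is irrelevant at s = 0.
      have hne : x + D.crossing e x σ • e ∈ D.face σ → D.crossing e x σ ≠ 0 := by
        intro h h'
        rw [h', zero_smul, add_zero] at h
        exact h3 σ (subset_closure h)
      by_cases hmem : x ∈ cylinder (D.face σ) e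
      · rw [Set.indicator_of_mem hmem]
        obtain ⟨ha, hb⟩ := hiff.1 hmem
        simp [faceStep, ha, hb]
      · rw [Set.indicator_of_notMem hmem, mul_zero, faceStep, if_neg]
        rintro ⟨ha, hb | hb⟩
        · exact hmem (hiff.2 ⟨hb, ha⟩)
        · exact hne ha hb.1
  simp only [k, zero_smul, add_zero] at hk0
  rw [Finset.sum_congr rfl hfin] at hk0
  rw [Set.indicator_apply]
  linarith

/-- The divergence theorem on a cell. -/
theorem integral_cell_fderiv (hd : d = 2 ∨ d = 3) (K : Fin D.nC) (e : Euc d) {g : Euc d → ℝ}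
    (hg : ContDiff ℝ 1 g) (hc : HasCompactSupport g) :
    ∫ x in D.cell K, fderiv ℝ g x e =
      ∑ σ ∈ D.facesC K, inner ℝ (D.outNormal K σ) e * ∫ x in D.face σ, g x ∂(surfMeasure d) := by
  by_cases he : e = 0
  · simp [he]
  have hint : Integrable (fun x => fderiv ℝ g x e) :=
    ((hg.continuous_fderiv one_ne_zero).clm_apply continuous_const).integrable_of_hasCompactSupport
      (hc.fderiv_apply (𝕜 := ℝ) e)
  have h2 : ∀ᵐ x : Euc d, ∀ σ, inner ℝ (D.normal σ) e = (0 : ℝ) →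
      inner ℝ (D.normal σ) x ≠ D.level σ := by
    rw [ae_all_iff]
    intro σ
    have : ∀ᵐ x : Euc d, inner ℝ (D.normal σ) x ≠ D.level σ := by
      refine measure_mono_null (fun x hx => ?_) (volume_hyperplane (D.normal_unit σ) (D.level σ))
      simpa using hx
    filter_upwards [this] with x hx _ using hx
  have hmeas : ∀ σ, inner ℝ (D.normal σ) e ≠ (0 : ℝ) →
      MeasurableSet (cylinder (D.face σ) e) := fun σ h =>
    measurableSet_cylinder (fun y hy => D.inner_normal hy) h (D.measurableSet_face σ)
  -- The identity of indicators is multiplied by the derivative. A face parallel to e has sign 0 and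
  -- drops out, which also disposes of its degenerate cylinder.
  have hae : (D.cell K).indicator (fun x => fderiv ℝ g x e) =ᵐ[volume] fun x =>
      ∑ σ ∈ D.facesC K, - (SignType.sign (inner ℝ (D.outNormal K σ) e : ℝ) : ℝ) *
        (cylinder (D.face σ) e).indicator (fun x => fderiv ℝ g x e) x := by
    filter_upwards [(D.isThin_relBd hd).ae_line e, h2, D.ae_notMem_closure_face] with x h1 h2 h3
    have := D.indicator_cell_eq (K := K) he h1 h2 h3
    have hmul : ∀ S : Set (Euc d), S.indicator (fun x => fderiv ℝ g x e) x =
        S.indicator (fun _ => (1 : ℝ)) x * fderiv ℝ g x e := by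
      intro S
      by_cases hx : x ∈ S <;> simp [hx]
    simp only [hmul]
    rw [this, neg_mul, Finset.sum_mul, ← Finset.sum_neg_distrib]
    exact Finset.sum_congr rfl fun σ _ => by ring
  rw [← integral_indicator (D.cell_polytope K).measurableSet, integral_congr_ae hae,
    integral_finsetSum]
  · refine Finset.sum_congr rfl fun σ hσ => ?_
    rw [integral_const_mul]
    by_cases h0 : inner ℝ (D.normal σ) e = (0 : ℝ)
    · simp [D.inner_outNormal, h0]
    · rw [integral_indicator (hmeas σ h0), integral_cylinder (D.normal_unit σ) h0
        (fun y hy => D.inner_normal hy) (D.measurableSet_face σ) hg hc, neg_mul_neg, ← mul_assoc]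
      congr 1
      have habs : |inner ℝ (D.normal σ) e| = |inner ℝ (D.outNormal K σ) e| := by
        rw [D.inner_outNormal, abs_mul]
        rcases D.orient_eq K σ (D.mem_facesC.1 hσ) with h | h <;> simp [h]
      rw [habs, sign_mul_abs]
  · intro σ hσ
    by_cases h0 : inner ℝ (D.normal σ) e = (0 : ℝ)
    · simp [D.inner_outNormal, h0]
    · exact (hint.indicator (hmeas σ h0)).const_mul _

end PolyMesh

/-! ## Convergence in `L²` -/

/-- On a finite measure space, convergence in L² implies convergence in L¹. -/
lemma tendsto_integral_of_tendsto_eLpNorm_two {α ι E : Type*} [MeasurableSpace α]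
    [NormedAddCommGroup E] [NormedSpace ℝ E] {μ : Measure α} [IsFiniteMeasure μ] {l : Filter ι}
    {F : ι → α → E} {f : α → E} (hF : ∀ i, MemLp (F i) 2 μ) (hf : MemLp f 2 μ)
    (h : Tendsto (fun i => eLpNorm (fun x => F i x - f x) 2 μ) l (𝓝 0)) :
    Tendsto (fun i => ∫ x, F i x ∂μ) l (𝓝 (∫ x, f x ∂μ)) := by
  refine tendsto_integral_of_L1' f hf.1
    (Eventually.of_forall fun i => (hF i).integrable one_le_two) ?_
  have hle : ∀ i, eLpNorm (F i - f) 1 μ ≤ eLpNorm (fun x => F i x - f x) 2 μ *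
      μ Set.univ ^ (1 / (1 : ENNReal).toReal - 1 / (2 : ENNReal).toReal) := fun i =>
    eLpNorm_le_eLpNorm_mul_rpow_measure_univ one_le_two ((hF i).1.sub hf.1)
  refine tendsto_of_tendsto_of_tendsto_of_le_of_le tendsto_const_nhds ?_ (fun _ => zero_le) hle
  have hfin : μ Set.univ ^ (1 / (1 : ENNReal).toReal - 1 / (2 : ENNReal).toReal) ≠ ⊤ :=
    ENNReal.rpow_ne_top_of_nonneg (by norm_num) (measure_ne_top _ _)
  simpa using ENNReal.Tendsto.mul_const h (Or.inr hfin)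

lemma tendsto_eLpNorm_sub {α ι E : Type*} [MeasurableSpace α]
    [NormedAddCommGroup E] {μ : Measure α} {l : Filter ι} {F G : ι → α → E} {f : α → E}
    (hF : ∀ i, AEStronglyMeasurable (F i) μ) (hG : ∀ i, AEStronglyMeasurable (G i) μ)
    (hf : AEStronglyMeasurable f μ)
    (h1 : Tendsto (fun i => eLpNorm (fun x => F i x - f x) 2 μ) l (𝓝 0))
    (h2 : Tendsto (fun i => eLpNorm (fun x => G i x - f x) 2 μ) l (𝓝 0)) :
    Tendsto (fun i => eLpNorm (fun x => F i x - G i x) 2 μ) l (𝓝 0) := by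
  refine tendsto_of_tendsto_of_tendsto_of_le_of_le tendsto_const_nhds
    (by simpa using h1.add h2) (fun _ => zero_le) fun i => ?_
  have := eLpNorm_sub_le ((hF i).sub hf) ((hG i).sub hf) (one_le_two (α := ENNReal))
  refine le_trans (le_of_eq ?_) this
  congr 1
  ext x
  simp

/-! ## Test functions -/

namespace IsTest

variable {d : ℕ} {Ω : Set (Euc d)} {φ ψ : Euc d → Euc d}

lemma contDiff_one {F : Type*} [NormedAddCommGroup F] [NormedSpace ℝ F] {φ : Euc d → F}
    (hφ : IsTest Ω φ) : ContDiff ℝ 1 φ := hφ.1.of_le (by exact_mod_cast le_top)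

lemma sub (hφ : IsTest Ω φ) (hψ : IsTest Ω ψ) : IsTest Ω (fun x => φ x - ψ x) := by
  refine ⟨hφ.1.sub hψ.1, hφ.2.1.sub hψ.2.1, ?_⟩
  exact (tsupport_sub φ ψ).trans (Set.union_subset hφ.2.2 hψ.2.2)

lemma continuous_fderiv {F : Type*} [NormedAddCommGroup F] [NormedSpace ℝ F] {φ : Euc d → F}
    (hφ : IsTest Ω φ) : Continuous (fderiv ℝ φ) :=
  hφ.contDiff_one.continuous_fderiv one_ne_zero

lemma continuous_classicalGrad (hφ : IsTest Ω φ) (i j : Fin d) :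
    Continuous (fun x => classicalGrad φ x i j) := by
  have := hφ.continuous_fderiv
  simp only [classicalGrad, Matrix.of_apply]
  exact (EuclideanSpace.proj (𝕜 := ℝ) i).continuous.comp
    (this.clm_apply continuous_const)

lemma hasCompactSupport_classicalGrad (hφ : IsTest Ω φ) (i j : Fin d) :
    HasCompactSupport (fun x => classicalGrad φ x i j) :=
  (hφ.2.1.fderiv_apply (𝕜 := ℝ) (EuclideanSpace.single j 1)).comp_left
    (g := fun v : Euc d => v i) (by simp)

lemma memLp (hφ : IsTest Ω φ) (μ : Measure (Euc d)) [IsFiniteMeasureOnCompacts μ] :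
    MemLp φ 2 μ :=
  hφ.1.continuous.memLp_of_hasCompactSupport hφ.2.1

lemma memLp_classicalGrad (hφ : IsTest Ω φ) (i j : Fin d) (μ : Measure (Euc d))
    [IsFiniteMeasureOnCompacts μ] : MemLp (fun x => classicalGrad φ x i j) 2 μ :=
  (hφ.continuous_classicalGrad i j).memLp_of_hasCompactSupport
    (hφ.hasCompactSupport_classicalGrad i j)

lemma classicalGrad_sub (hφ : IsTest Ω φ) (hψ : IsTest Ω ψ) (x : Euc d) (i j : Fin d) :
    classicalGrad (fun x => φ x - ψ x) x i j = classicalGrad φ x i j - classicalGrad ψ x i j := by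
  have h1 := (hφ.contDiff_one.differentiable one_ne_zero) x
  have h2 := (hψ.contDiff_one.differentiable one_ne_zero) x
  simp [classicalGrad, fderiv_fun_sub h1 h2]

/-- The trace inequality involves the whole space, while H¹ convergence is known in Ω only; the
support of φ reconciles the two. The coefficients |n j| are at most 1. -/
lemma eLpNorm_fderiv_le (hφ : IsTest Ω φ) {n : Euc d} (hn : ‖n‖ = 1) :
    eLpNorm (fun x => fderiv ℝ φ x n) 2 volume ≤
      ∑ i, ∑ j, eLpNorm (fun x => classicalGrad φ x i j) 2 (volume.restrict Ω) := by
  have hsupp : ∀ i j, eLpNorm (fun x => classicalGrad φ x i j) 2 (volume.restrict Ω) =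
      eLpNorm (fun x => classicalGrad φ x i j) 2 volume := by
    intro i j
    refine eLpNorm_restrict_eq_of_support_subset fun x hx => hφ.2.2 ?_
    by_contra h
    refine hx ?_
    have := fderiv_of_notMem_tsupport (𝕜 := ℝ) h
    simp [classicalGrad, this]
  simp only [hsupp]
  have heq : (fun x => fderiv ℝ φ x n) = ∑ i, ∑ j, fun x =>
      (n j * classicalGrad φ x i j) • (EuclideanSpace.single i (1 : ℝ) : Euc d) := by
    ext x k
    have h1 : n = ∑ j, n j • (EuclideanSpace.single j (1 : ℝ) : Euc d) := by
      ext l; simp [Pi.single_apply]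
    conv_lhs => rw [h1]
    rw [Finset.sum_comm]
    simp only [map_sum, map_smul, Finset.sum_apply, classicalGrad, Matrix.of_apply]
    simp [Pi.single_apply]
  rw [heq]
  have hcont : ∀ i j, Continuous (fun x => (n j * classicalGrad φ x i j) •
      (EuclideanSpace.single i (1 : ℝ) : Euc d)) := fun i j =>
    (continuous_const.mul (hφ.continuous_classicalGrad i j)).smul continuous_const
  refine (eLpNorm_sum_le (fun i _ => Finset.aestronglyMeasurable_sum _ fun j _ =>
    (hcont i j).aestronglyMeasurable) one_le_two).trans (Finset.sum_le_sum fun i _ => ?_)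
  refine (eLpNorm_sum_le (fun j _ => (hcont i j).aestronglyMeasurable) one_le_two).trans
    (Finset.sum_le_sum fun j _ => ?_)
  refine eLpNorm_mono fun x => ?_
  have hnj : ‖n j‖ ≤ 1 := hn ▸ PiLp.norm_apply_le n j
  rw [norm_smul, norm_mul]
  simp only [PiLp.norm_single, norm_one, mul_one]
  exact mul_le_of_le_one_left (norm_nonneg _) hnj

end IsTest

/-! ## Weak gradients and approximation by test functions -/

section H1

variable {d : ℕ} {Ω : Set (Euc d)} {u : Euc d → Euc d}

lemma weakGrad_spec (h : MemH1 Ω u) : MatMemL2 Ω (weakGrad Ω u) ∧ IsWeakGrad Ω u (weakGrad Ω u) := by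
  rw [weakGrad, dif_pos h.2]
  exact h.2.choose_spec

/-- The free indices serve two purposes: two independent indices into one sequence give the Cauchy
property, and equal indices into two sequences show that the limit does not depend on the sequence.
-/
lemma TestApprox.tendsto_sub (h : MemH1 Ω u) {φ ψ : ℕ → Euc d → Euc d} (hφ : TestApprox Ω u φ)
    (hψ : TestApprox Ω u ψ) {ι : Type*} {l : Filter ι} {a b : ι → ℕ} (ha : Tendsto a l atTop)
    (hb : Tendsto b l atTop) :
    Tendsto (fun k => eLpNorm (fun x => φ (a k) x - ψ (b k) x) 2 (volume.restrict Ω)) l (𝓝 0) ∧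
    ∀ i j, Tendsto (fun k => eLpNorm (fun x => classicalGrad (fun x => φ (a k) x - ψ (b k) x) x i j) 2
      (volume.restrict Ω)) l (𝓝 0) := by
  constructor
  · exact tendsto_eLpNorm_sub (fun k => (hφ.1 _).1.continuous.aestronglyMeasurable)
      (fun k => (hψ.1 _).1.continuous.aestronglyMeasurable) h.1.1 (hφ.2.1.comp ha) (hψ.2.1.comp hb)
  · intro i j
    simp only [(hφ.1 _).classicalGrad_sub (hψ.1 _)]
    exact tendsto_eLpNorm_sub
      (fun k => ((hφ.1 _).continuous_classicalGrad i j).aestronglyMeasurable)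
      (fun k => ((hψ.1 _).continuous_classicalGrad i j).aestronglyMeasurable)
      ((weakGrad_spec h).1 i j).1 ((hφ.2.2 i j).comp ha) ((hψ.2.2 i j).comp hb)

end H1

/-! ### Traces on faces of functions of H¹₀ -/

namespace PolyMesh

variable {d : ℕ} {Ω : Set (Euc d)} (D : PolyMesh d Ω)

lemma restrict_face (σ : Fin D.nF) : (surfMeasure d).restrict (D.face σ) =
    (Measure.map (fun y : perp (D.normal σ) => (y : Euc d) + D.level σ • D.normal σ) volume).restrict
      (D.face σ) := by
  rw [map_perp_volume (D.normal_unit σ), Measure.restrict_restrict (D.measurableSet_face σ)]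
  congr 1
  exact (Set.inter_eq_left.2 fun x hx => D.inner_normal hx).symm

instance isFiniteMeasure_face (σ : Fin D.nF) :
    IsFiniteMeasure ((surfMeasure d).restrict (D.face σ)) := by
  rw [restrict_face]
  refine ⟨?_⟩
  rw [Measure.restrict_apply_univ, (measurableEmbedding_planeMap _ _).map_apply]
  refine Bornology.IsBounded.measure_lt_top ?_
  have hiso : Isometry (fun y : perp (D.normal σ) => (y : Euc d) + D.level σ • D.normal σ) :=
    (IsometryEquiv.addRight _).isometry.comp isometry_subtype_coe
  exact hiso.antilipschitz.isBounded_preimage (D.isBounded_face σ)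

/-- Convergence in `H¹` of test functions implies convergence in `L²` of a face. -/
lemma tendsto_eLpNorm_face (σ : Fin D.nF) {ι : Type*} {l : Filter ι} {ψ : ι → Euc d → Euc d}
    (hψ : ∀ k, IsTest Ω (ψ k))
    (h1 : Tendsto (fun k => eLpNorm (ψ k) 2 (volume.restrict Ω)) l (𝓝 0))
    (h2 : ∀ i j, Tendsto (fun k => eLpNorm (fun x => classicalGrad (ψ k) x i j) 2
      (volume.restrict Ω)) l (𝓝 0)) :
    Tendsto (fun k => eLpNorm (ψ k) 2 ((surfMeasure d).restrict (D.face σ))) l (𝓝 0) := by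
  have hle : ∀ k, eLpNorm (ψ k) 2 ((surfMeasure d).restrict (D.face σ)) ^ 2 ≤
      eLpNorm (ψ k) 2 (volume.restrict Ω) ^ 2 +
      (∑ i, ∑ j, eLpNorm (fun x => classicalGrad (ψ k) x i j) 2 (volume.restrict Ω)) ^ 2 := by
    intro k
    calc _ ≤ eLpNorm (ψ k) 2 ((surfMeasure d).restrict
          {x | inner ℝ (D.normal σ) x = D.level σ}) ^ 2 := by
          refine pow_le_pow_left₀ zero_le (eLpNorm_mono_measure (ψ k)
            (Measure.restrict_mono (fun x hx => D.inner_normal hx) le_rfl)) 2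
      _ ≤ _ := eLpNorm_plane_sq_le (D.normal_unit σ) _ (hψ k).contDiff_one (hψ k).2.1
      _ ≤ _ := by
          refine add_le_add (le_of_eq ?_) (pow_le_pow_left₀ zero_le
            ((hψ k).eLpNorm_fderiv_le (D.normal_unit σ)) 2)
          rw [eLpNorm_restrict_eq_of_support_subset ((subset_tsupport _).trans (hψ k).2.2)]
  have hlim : Tendsto (fun k => eLpNorm (ψ k) 2 (volume.restrict Ω) ^ 2 +
      (∑ i, ∑ j, eLpNorm (fun x => classicalGrad (ψ k) x i j) 2 (volume.restrict Ω)) ^ 2) l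
      (𝓝 0) := by
    have hs : Tendsto (fun k => ∑ i, ∑ j, eLpNorm (fun x => classicalGrad (ψ k) x i j) 2
        (volume.restrict Ω)) l (𝓝 0) := by
      simpa using tendsto_finsetSum Finset.univ fun i _ =>
        tendsto_finsetSum Finset.univ fun j _ => h2 i j
    simpa using (ENNReal.Tendsto.pow (n := 2) h1).add (ENNReal.Tendsto.pow (n := 2) hs)
  have hsq := tendsto_of_tendsto_of_tendsto_of_le_of_le tendsto_const_nhds hlim
    (fun _ => zero_le) hle
  have := (ENNReal.continuous_rpow_const (y := 1 / 2)).continuousAt.tendsto.comp hsq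
  simp only [Function.comp_def] at this
  rw [ENNReal.zero_rpow_of_pos (by norm_num)] at this
  refine this.congr fun k => ?_
  rw [← ENNReal.rpow_natCast, ← ENNReal.rpow_mul]
  norm_num

/-- Differences of approximating test functions tend to 0 in H¹, hence in L²(σ), which is complete.
-/
lemma exists_isTrace (σ : Fin D.nF) {u : Euc d → Euc d} (hu : MemH10 Ω u) :
    ∃ g, IsTrace Ω u (D.face σ) g := by
  obtain ⟨h1, φ, hφ⟩ := hu
  have hL : ∀ n, MemLp (φ n) 2 ((surfMeasure d).restrict (D.face σ)) := by
    intro n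
    exact MemLp.of_bound (hφ.1 n).1.continuous.aestronglyMeasurable _
      (Eventually.of_forall ((hφ.1 n).1.continuous.bounded_above_of_compact_support
        (hφ.1 n).2.1).choose_spec)
  have hcau : CauchySeq (fun n => (hL n).toLp (φ n)) := by
    rw [Lp.cauchySeq_Lp_iff_cauchySeq_eLpNorm]
    have hsub := hφ.tendsto_sub h1 hφ (l := (atTop : Filter (ℕ × ℕ))) (a := Prod.fst) (b := Prod.snd)
      (by rw [← prod_atTop_atTop_eq]; exact tendsto_fst)
      (by rw [← prod_atTop_atTop_eq]; exact tendsto_snd)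
    have h3 := D.tendsto_eLpNorm_face σ (ψ := fun (k : ℕ × ℕ) x => φ k.1 x - φ k.2 x)
      (fun k => (hφ.1 k.1).sub (hφ.1 k.2)) hsub.1 hsub.2
    refine Tendsto.congr (fun k => eLpNorm_congr_ae ?_) h3
    filter_upwards [(hL k.1).coeFn_toLp, (hL k.2).coeFn_toLp] with x hx1 hx2
    rw [Pi.sub_apply, hx1, hx2]
  obtain ⟨G, hG⟩ := cauchySeq_tendsto_of_complete hcau
  refine ⟨G, Lp.memLp G, φ, hφ, ?_⟩
  rw [Lp.tendsto_Lp_iff_tendsto_eLpNorm'] at hG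
  refine hG.congr fun n => eLpNorm_congr_ae ?_
  filter_upwards [(hL n).coeFn_toLp] with x hx
  rw [Pi.sub_apply, hx]

lemma trace_spec (σ : Fin D.nF) {u : Euc d → Euc d} (hu : MemH10 Ω u) :
    IsTrace Ω u (D.face σ) (trace Ω u (D.face σ)) := by
  rw [trace, dif_pos (D.exists_isTrace σ hu)]
  exact (D.exists_isTrace σ hu).choose_spec

/-- The trace comes with some approximating sequence ψ, not with the given φ. Since φ − ψ tends to 0
in H¹, it tends to 0 in L² of the face. -/
lemma tendsto_integral_face (σ : Fin D.nF) {u : Euc d → Euc d} (hu : MemH10 Ω u)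
    {φ : ℕ → Euc d → Euc d} (hφ : TestApprox Ω u φ) (ν : Euc d) :
    Tendsto (fun n => ∫ x in D.face σ, inner ℝ (φ n x) ν ∂(surfMeasure d)) atTop
      (𝓝 (∫ x in D.face σ, inner ℝ (trace Ω u (D.face σ) x) ν ∂(surfMeasure d))) := by
  obtain ⟨hg, ψ, hψ, hlim⟩ := D.trace_spec σ hu
  have hL : ∀ {χ : Euc d → Euc d}, IsTest Ω χ →
      MemLp χ 2 ((surfMeasure d).restrict (D.face σ)) := fun {χ} hχ =>
    MemLp.of_bound hχ.1.continuous.aestronglyMeasurable _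
      (Eventually.of_forall (hχ.1.continuous.bounded_above_of_compact_support hχ.2.1).choose_spec)
  have hsub := hφ.tendsto_sub hu.1 hψ tendsto_id tendsto_id
  have h0 := D.tendsto_eLpNorm_face σ (fun k => (hφ.1 k).sub (hψ.1 k)) hsub.1 hsub.2
  have hlim' : Tendsto (fun n => eLpNorm (fun x => trace Ω u (D.face σ) x - ψ n x) 2
      ((surfMeasure d).restrict (D.face σ))) atTop (𝓝 0) := by
    refine hlim.congr fun n => ?_
    rw [← eLpNorm_neg]
    congr 1
    ext1 x
    simp
  have hfin : Tendsto (fun n => eLpNorm (fun x => φ n x - trace Ω u (D.face σ) x) 2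
      ((surfMeasure d).restrict (D.face σ))) atTop (𝓝 0) := by
    refine tendsto_of_tendsto_of_tendsto_of_le_of_le tendsto_const_nhds
      (by simpa using h0.add hlim') (fun _ => zero_le) fun n => ?_
    refine le_trans (le_of_eq ?_) (eLpNorm_sub_le ((hL (hφ.1 n)).sub (hL (hψ.1 n))).1
      (hg.sub (hL (hψ.1 n))).1 (one_le_two (α := ENNReal)))
    congr 1
    ext x
    simp
  have hI := tendsto_integral_of_tendsto_eLpNorm_two (fun n => hL (hφ.1 n)) hg hfin
  have hin : ∀ {χ : Euc d → Euc d}, MemLp χ 2 ((surfMeasure d).restrict (D.face σ)) →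
      ∫ x in D.face σ, inner ℝ (χ x) ν ∂(surfMeasure d) =
        inner ℝ ν (∫ x in D.face σ, χ x ∂(surfMeasure d)) := by
    intro χ hχ
    rw [← integral_inner (hχ.integrable one_le_two)]
    simp only [real_inner_comm]
  simp only [hin (hL (hφ.1 _)), hin hg]
  exact ((innerSL ℝ ν).continuous.tendsto _).comp hI

/-- The approximating test functions are supported in the open set Ω, hence vanish on the face. -/
lemma integral_trace_boundary (hΩ : IsOpen Ω) {σ : Fin D.nF} (hσ : D.face σ ⊆ frontier Ω)
    {u : Euc d → Euc d} (hu : MemH10 Ω u) (ν : Euc d) :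
    ∫ x in D.face σ, inner ℝ (trace Ω u (D.face σ) x) ν ∂(surfMeasure d) = 0 := by
  obtain ⟨φ, hφ⟩ := hu.2
  refine tendsto_nhds_unique (D.tendsto_integral_face σ hu hφ ν) ?_
  refine tendsto_const_nhds.congr fun n => ?_
  rw [setIntegral_congr_fun (g := fun _ => 0) (D.measurableSet_face σ)]
  · simp
  · intro x hx
    have : φ n x = 0 := by
      by_contra h
      have h1 := (hφ.1 n).2.2 (subset_tsupport _ h)
      have h2 := hσ hx
      rw [hΩ.frontier_eq] at h2
      exact h2.2 h1
    simp [this]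

/-- An open subset of `closure Ω` lies in the interior of that closure, which is Ω for a polytope.
-/
lemma cell_subset (hΩ : IsPolytope Ω) (K : Fin D.nC) : D.cell K ⊆ Ω := by
  refine (interior_maximal ?_ (D.cell_polytope K).isOpen).trans hΩ.interior_closure.subset
  rw [D.cell_cover]
  exact subset_closure.trans (Set.subset_iUnion (fun K => closure (D.cell K)) K)

instance isFiniteMeasure_cell (K : Fin D.nC) :
    IsFiniteMeasure (volume.restrict (D.cell K)) :=
  ⟨by rw [Measure.restrict_apply_univ]; exact (D.cell_polytope K).volume_ne_top.lt_top⟩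

/-- The divergence theorem on a cell, for functions of `H¹₀(Ω)^d`. -/
theorem integral_cell_trace_weakGrad (hd : d = 2 ∨ d = 3) (hΩ : IsPolytope Ω) (K : Fin D.nC)
    {u : Euc d → Euc d} (hu : MemH10 Ω u) :
    ∫ x in D.cell K, (weakGrad Ω u x).trace = ∑ σ ∈ D.facesC K,
      ∫ x in D.face σ, inner ℝ (trace Ω u (D.face σ) x) (D.outNormal K σ) ∂(surfMeasure d) := by
  obtain ⟨φ, hφ⟩ := hu.2
  have hW := (weakGrad_spec hu.1).1
  have hle : volume.restrict (D.cell K) ≤ volume.restrict Ω :=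
    Measure.restrict_mono (D.cell_subset hΩ K) le_rfl
  have hL : Tendsto (fun n => ∫ x in D.cell K, (classicalGrad (φ n) x).trace) atTop
      (𝓝 (∫ x in D.cell K, (weakGrad Ω u x).trace)) := by
    simp only [Matrix.trace, Matrix.diag]
    have hi : ∀ i, Tendsto (fun n => ∫ x in D.cell K, classicalGrad (φ n) x i i) atTop
        (𝓝 (∫ x in D.cell K, weakGrad Ω u x i i)) := fun i =>
      tendsto_integral_of_tendsto_eLpNorm_two
        (fun n => (hφ.1 n).memLp_classicalGrad i i _) ((hW i i).mono_measure hle)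
        (tendsto_of_tendsto_of_tendsto_of_le_of_le tendsto_const_nhds (hφ.2.2 i i)
          (fun _ => zero_le) fun n => eLpNorm_mono_measure _ hle)
    have hs := tendsto_finsetSum Finset.univ fun i _ => hi i
    rw [integral_finsetSum _ fun i _ => ((hW i i).mono_measure hle).integrable one_le_two]
    refine hs.congr fun n => ?_
    rw [integral_finsetSum _ fun i _ =>
      ((hφ.1 n).memLp_classicalGrad i i _).integrable one_le_two]
  -- Both sides are limits of the corresponding quantities for test functions, to which the smooth
  -- divergence theorem applies component by component.
  refine tendsto_nhds_unique hL ?_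
  refine (tendsto_finsetSum (D.facesC K) fun σ _ =>
    D.tendsto_integral_face σ hu hφ (D.outNormal K σ)).congr fun n => ?_
  have hcomp : ∀ i, ContDiff ℝ 1 (fun x => φ n x i) := fun i =>
    (EuclideanSpace.proj (𝕜 := ℝ) i : Euc d →L[ℝ] ℝ).contDiff.comp (hφ.1 n).contDiff_one
  have hcs : ∀ i, HasCompactSupport (fun x => φ n x i) := fun i =>
    (hφ.1 n).2.1.comp_left (g := fun v : Euc d => v i) (by simp)
  have hder : ∀ i x, classicalGrad (φ n) x i i =
      fderiv ℝ (fun x => φ n x i) x (EuclideanSpace.single i 1) := by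
    intro i x
    have h1 := ((hφ.1 n).contDiff_one.differentiable one_ne_zero x).hasFDerivAt
    have h2 := (EuclideanSpace.proj (𝕜 := ℝ) i : Euc d →L[ℝ] ℝ).hasFDerivAt.comp x h1
    have h3 : fderiv ℝ (fun x => φ n x i) x =
      (EuclideanSpace.proj (𝕜 := ℝ) i : Euc d →L[ℝ] ℝ).comp (fderiv ℝ (φ n) x) := h2.fderiv
    rw [h3]; rfl
  have hbd : ∀ σ i, Integrable (fun x => φ n x i) ((surfMeasure d).restrict (D.face σ)) := by
    intro σ i
    refine Integrable.of_bound (hcomp i).continuous.aestronglyMeasurable _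
      (Eventually.of_forall ((hcomp i).continuous.bounded_above_of_compact_support
        (hcs i)).choose_spec)
  simp only [Matrix.trace, Matrix.diag]
  rw [integral_finsetSum _ fun i _ =>
      ((hφ.1 n).memLp_classicalGrad i i _).integrable one_le_two]
  simp only [hder, D.integral_cell_fderiv hd K _ (hcomp _) (hcs _)]
  rw [Finset.sum_comm]
  refine Finset.sum_congr rfl fun σ _ => ?_
  simp only [← integral_const_mul]
  rw [← integral_finsetSum _ fun i _ => (hbd σ i).const_mul _]
  refine integral_congr_ae (Eventually.of_forall fun x => ?_)
  simp [PiLp.inner_apply, mul_comm]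

end PolyMesh

/-! ### The skeleton of the mesh: boundary faces, edges and nodes -/

namespace PolyMesh

variable {d : ℕ} {Ω : Set (Euc d)} (D : PolyMesh d Ω)

lemma face_cases (hΩ : IsPolytope Ω) {σ : Fin D.nF} {x : Euc d} (hx : x ∈ D.face σ)
    (hxΩ : x ∈ frontier Ω) : D.face σ ⊆ frontier Ω := by
  rcases D.face_cells σ with h | h
  · exact h.1
  · rw [hΩ.isOpen.frontier_eq] at hxΩ
    exact absurd (h.1 hx) hxΩ.2

lemma exists_mem_closure_cell {x : Euc d} (hx : x ∈ closure Ω) : ∃ K, x ∈ closure (D.cell K) := by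
  rw [D.cell_cover] at hx
  exact Set.mem_iUnion.1 hx

lemma exists_mem_closure_face {x : Euc d} {K : Fin D.nC} (hx : x ∈ closure (D.cell K))
    (hxK : x ∉ D.cell K) : ∃ σ ∈ D.facesC K, x ∈ closure (D.face σ) := by
  refine D.mem_frontier_cell.1 ?_
  rw [(D.cell_polytope K).isOpen.frontier_eq]
  exact ⟨hx, hxK⟩

/-- The boundary of the domain is covered by the closures of the boundary faces. -/
lemma exists_boundary_face (hd : d = 2 ∨ d = 3) (hΩ : IsPolytope Ω) {p : Euc d}
    (hp : p ∈ frontier Ω) : ∃ σ, D.face σ ⊆ frontier Ω ∧ p ∈ closure (D.face σ) := by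
  by_contra! hcon
  have hev : ∀ᶠ y in 𝓝 p, ∀ σ, D.face σ ⊆ frontier Ω → y ∉ closure (D.face σ) := by
    rw [eventually_all]
    intro σ
    by_cases hσ : D.face σ ⊆ frontier Ω
    · filter_upwards [isClosed_closure.isOpen_compl.mem_nhds (hcon σ hσ)] with y hy _ using hy
    · exact Eventually.of_forall fun y h => absurd h hσ
  obtain ⟨r, hr, hball⟩ := Metric.eventually_nhds_iff_ball.1 hev
  have hpos : ∀ U : Set (Euc d), IsOpen U → U.Nonempty → ∀ {P : Euc d → Prop},
      (∀ᵐ x, P x) → ∃ x ∈ U, P x := by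
    intro U hU hne P hP
    by_contra! h
    have : volume U = 0 := measure_mono_null (fun x hx => h x hx) hP
    exact (hU.measure_pos volume hne).ne' this
  have h1 : (Metric.ball p r ∩ Ω).Nonempty :=
    mem_closure_iff_nhds.1 (frontier_subset_closure hp) _ (Metric.ball_mem_nhds p hr)
  -- Otherwise p would be interior to `closure Ω`, hence in Ω.
  have h2 : (Metric.ball p r ∩ (closure Ω)ᶜ).Nonempty := by
    by_contra h
    rw [Set.not_nonempty_iff_eq_empty] at h
    have hsub : Metric.ball p r ⊆ closure Ω := fun y hy => by
      by_contra hy'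
      have : y ∈ Metric.ball p r ∩ (closure Ω)ᶜ := ⟨hy, hy'⟩
      simp [h] at this
    have : p ∈ interior (closure Ω) :=
      interior_maximal hsub Metric.isOpen_ball (Metric.mem_ball_self hr)
    rw [hΩ.interior_closure] at this
    rw [hΩ.isOpen.frontier_eq] at hp
    exact hp.2 this
  -- A generic segment in the ball from Ω to the outside misses all relative boundaries. It crosses
  -- ∂Ω at a point of some face, and a face that meets ∂Ω is a boundary face.
  obtain ⟨q, hq, hqP⟩ := hpos _ (Metric.isOpen_ball.inter hΩ.isOpen) h1
    (D.isThin_relBd hd).ae_join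
  obtain ⟨q', hq', hP⟩ := hpos _ (Metric.isOpen_ball.inter isClosed_closure.isOpen_compl) h2 hqP
  obtain ⟨z, hz, hzΩ⟩ := inter_frontier_nonempty (convex_segment q q').isPreconnected
    (t := Ω) ⟨q, left_mem_segment ℝ q q', hq.2⟩
    ⟨q', right_mem_segment ℝ q q', fun h => hq'.2 (subset_closure h)⟩
  have hzB : z ∈ Metric.ball p r := (convex_ball p r).segment_subset hq.1 hq'.1 hz
  obtain ⟨K, hK⟩ := D.exists_mem_closure_cell (frontier_subset_closure hzΩ)
  obtain ⟨σ, hσ, hzσ⟩ := D.exists_mem_closure_face hK fun h => by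
    have := D.cell_subset hΩ K h
    rw [hΩ.isOpen.frontier_eq] at hzΩ
    exact hzΩ.2 this
  have hzσ' : z ∈ D.face σ := by
    by_contra hn
    rw [segment_eq_image'] at hz
    obtain ⟨t, _, rfl⟩ := hz
    exact hP t (Set.mem_iUnion.2 ⟨σ, hzσ, hn⟩)
  exact hball z hzB σ (D.face_cases hΩ hzσ' hzΩ) hzσ

/-- A connected subset of the hyperplane of a face that misses the relative boundary of the face
and meets the face is contained in it. -/
lemma subset_face_of_isPreconnected {σ : Fin D.nF} {C : Set (Euc d)} (hC : IsPreconnected C)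
    (hplane : ∀ x ∈ C, inner ℝ (D.normal σ) x = D.level σ) (hbd : ∀ x ∈ C, x ∉ D.relBd σ)
    (hne : (C ∩ D.face σ).Nonempty) : C ⊆ D.face σ := by
  obtain ⟨O, hO, hface⟩ := D.face_eq_inter σ
  -- On C the face is cut out by the open set O and also by its own closure, so it is both open and
  -- closed in C.
  have hmem : ∀ x ∈ C, x ∈ O → x ∈ D.face σ := fun x hx hxO => by
    rw [hface]; exact ⟨hxO, hplane x hx⟩
  have hcl : ∀ x ∈ C, x ∉ O → x ∉ closure (D.face σ) := fun x hx hxO h =>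
    hbd x hx ⟨h, fun h' => hxO (by rw [hface] at h'; exact h'.1)⟩
  have hsub : C ⊆ O := by
    intro x hx
    by_contra hxO
    obtain ⟨y, hy, hyσ⟩ := hne
    obtain ⟨z, hz, hzO, hz'⟩ := hC O (closure (D.face σ))ᶜ hO isClosed_closure.isOpen_compl
      (fun z hz => or_iff_not_imp_left.2 (hcl z hz))
      ⟨y, hy, by rw [hface] at hyσ; exact hyσ.1⟩ ⟨x, hx, hcl x hx hxO⟩
    exact hz' (subset_closure (hmem z hz hzO))
  exact fun x hx => hmem x hx (hsub hx)

variable (e : Fin D.nE)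

/-- The open segment of an edge. -/
def openEdge : Set (Euc d) := openSegment ℝ (D.node (D.edge e).1) (D.node (D.edge e).2)

/-- The closed segment of an edge. -/
def closedEdge : Set (Euc d) := segment ℝ (D.node (D.edge e).1) (D.node (D.edge e).2)

lemma closure_openEdge : closure (D.openEdge e) = D.closedEdge e := closure_openSegment _ _

lemma mem_closedEdge_cases {x : Euc d} (hx : x ∈ D.closedEdge e) (hn : ∀ s, D.node s ≠ x) :
    x ∈ D.openEdge e := by
  rw [closedEdge, ← insert_endpoints_openSegment] at hx
  rcases hx with h | h | h
  · exact absurd h.symm (hn _)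
  · exact absurd h.symm (hn _)
  · exact h

lemma relBd_three (hd : d = 3) {σ : Fin D.nF} {x : Euc d} (hx : x ∈ D.relBd σ) :
    ∃ e, D.openEdge e ⊆ D.relBd σ ∧ x ∈ D.closedEdge e := by
  rw [relBd, (D.face_edge_three hd).1 σ] at hx
  obtain ⟨e, he, hx⟩ := Set.mem_iUnion₂.1 hx
  exact ⟨e, he, hx⟩

variable {e}

/-- Open edges are pairwise disjoint and contain no node, so an end point of the second edge cannot
be x either. -/
lemma openEdge_unique {e' : Fin D.nE} {x : Euc d} (hx : x ∈ D.openEdge e)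
    (hx' : x ∈ D.closedEdge e') : e' = e := by
  have hn : ∀ s, D.node s ≠ x := by
    rintro s rfl
    exact D.node_notMem_edge s e hx
  by_contra h
  exact Set.disjoint_left.1 (D.edge_disjoint e' e h) (D.mem_closedEdge_cases e' hx' hn) hx

lemma openEdge_subset_relBd (hd : d = 3) {σ : Fin D.nF} {x : Euc d} (hx : x ∈ D.openEdge e)
    (hxσ : x ∈ D.relBd σ) : D.openEdge e ⊆ D.relBd σ := by
  obtain ⟨e', he', hx'⟩ := D.relBd_three hd hxσ
  rwa [D.openEdge_unique hx hx'] at he'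

/-- Near a point of an edge in the relative boundary of a face, that relative boundary
is the edge. -/
lemma eventually_relBd (hd : d = 3) (σ : Fin D.nF) {x : Euc d} (hx : x ∈ D.openEdge e) :
    ∀ᶠ y in 𝓝 x, y ∈ D.relBd σ → y ∈ D.closedEdge e := by
  have hev : ∀ᶠ y in 𝓝 x, ∀ e', e' ≠ e → y ∉ D.closedEdge e' := by
    rw [eventually_all]
    intro e'
    by_cases h : e' = e
    · exact Eventually.of_forall fun y h' => absurd h h'
    · have hcl : IsClosed (D.closedEdge e') := by
        rw [← closure_openEdge]; exact isClosed_closure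
      filter_upwards [hcl.isOpen_compl.mem_nhds fun h' => h (D.openEdge_unique hx h')] with y hy _
      exact hy
  filter_upwards [hev] with y hy hyσ
  obtain ⟨e', _, hy'⟩ := D.relBd_three hd hyσ
  by_contra hne
  exact hy e' (by rintro rfl; exact hne hy') hy'

/-- An open segment is relatively open in its line. -/
lemma eventually_openEdge {x : Euc d} (hx : x ∈ D.openEdge e) :
    ∀ᶠ y in 𝓝 x, (∃ t : ℝ, y = x + t • (D.node (D.edge e).2 - D.node (D.edge e).1)) →
      y ∈ D.openEdge e := by
  set a := D.node (D.edge e).1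
  set b := D.node (D.edge e).2
  have hab : b - a ≠ 0 := sub_ne_zero.2 fun h => D.edge_ne e (D.node_injective h.symm)
  have hx' := hx
  rw [openEdge, openSegment_eq_image'] at hx'
  obtain ⟨θ, hθ, rfl⟩ := hx'
  have hcl := isClosedEmbedding_line (a + θ • (b - a)) hab
  have h1 : {t : ℝ | θ + t ∈ Set.Ioo (0 : ℝ) 1} ∈ 𝓝 (0 : ℝ) := by
    have : ContinuousAt (fun t : ℝ => θ + t) 0 := by fun_prop
    exact this.eventually (isOpen_Ioo.mem_nhds (by simpa using hθ))
  have h2 := hcl.isInducing.nhds_eq_comap 0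
  rw [h2] at h1
  obtain ⟨V, hV, hsub⟩ := h1
  simp only [zero_smul, add_zero] at hV
  filter_upwards [hV] with y hy
  rintro ⟨t, rfl⟩
  have := hsub hy
  rw [openEdge, openSegment_eq_image']
  exact ⟨θ + t, this, by simp only [add_smul]; abel⟩

/-- An edge that meets the closure of a face is contained in it. -/
lemma closedEdge_subset (hd : d = 3) {σ : Fin D.nF} {p : Euc d} (hp : p ∈ D.openEdge e)
    (hpσ : p ∈ closure (D.face σ)) : D.closedEdge e ⊆ closure (D.face σ) := by
  rw [← closure_openEdge]
  by_cases hσ : p ∈ D.face σ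
  swap
  · exact closure_mono ((D.openEdge_subset_relBd hd hp ⟨hpσ, hσ⟩).trans Set.sdiff_subset) |>.trans
      closure_closure.subset
  refine closure_mono ?_
  have hmiss : ∀ x ∈ D.openEdge e, x ∉ D.relBd σ := fun x hx hx' =>
    (D.openEdge_subset_relBd hd hx hx' hp).2 hσ
  set a := D.node (D.edge e).1 with ha
  set b := D.node (D.edge e).2 with hb
  set w := b - a with hw
  have hline : ∀ x ∈ D.openEdge e, ∃ t : ℝ, x = p + t • w := by
    intro x hx
    rw [openEdge, openSegment_eq_image'] at hx hp
    obtain ⟨t, _, rfl⟩ := hx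
    obtain ⟨θ, _, rfl⟩ := hp
    exact ⟨t - θ, by simp only [sub_smul]; abel⟩
  -- If the edge is parallel to the plane of σ, it lies in that plane and cannot leave the face
  -- without meeting its relative boundary.
  by_cases h0 : inner ℝ (D.normal σ) w = (0 : ℝ)
  · refine D.subset_face_of_isPreconnected (convex_openSegment _ _).isPreconnected ?_ hmiss
      ⟨p, hp, hσ⟩
    intro x hx
    obtain ⟨t, rfl⟩ := hline x hx
    rw [inner_add_right, inner_smul_right, h0, D.inner_normal hσ]
    simp
  -- If the edge crosses σ transversally at p, it also bounds some other face τ. A point q of τ near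
  -- p is slid along w to the point f q of the plane of σ. The sliding stays in τ, because near p
  -- the relative boundary of τ is the edge; so τ would meet σ.
  exfalso
  obtain ⟨τ, hτ⟩ := (D.face_edge_three hd).2 e
  change D.openEdge e ⊆ D.relBd τ at hτ
  have hτσ : τ ≠ σ := by
    rintro rfl
    exact hmiss p hp (hτ hp)
  have hwτ : inner ℝ (D.normal τ) w = (0 : ℝ) := by
    have h1 : D.closedEdge e ⊆ closure (D.face τ) := by
      rw [← closure_openEdge]
      exact (closure_mono (hτ.trans Set.sdiff_subset)).trans closure_closure.subset
    have h2 := D.inner_normal_closure (h1 (left_mem_segment ℝ _ _))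
    have h3 := D.inner_normal_closure (h1 (right_mem_segment ℝ _ _))
    rw [hw, inner_sub_right, h2, h3, sub_self]
  obtain ⟨O, hO, hface⟩ := D.face_eq_inter σ
  have hev := ((D.eventually_relBd hd τ hp).and (D.eventually_openEdge hp)).and
    (hO.mem_nhds (by rw [hface] at hσ; exact hσ.1))
  obtain ⟨r, hr, hball⟩ := Metric.eventually_nhds_iff_ball.1 hev
  let f : Euc d → Euc d := fun q =>
    q + ((D.level σ - inner ℝ (D.normal σ) q) / inner ℝ (D.normal σ) w) • w
  have hf : ContinuousAt f p := by
    have : Continuous f := by fun_prop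
    exact this.continuousAt
  have hfp : f p = p := by simp [f, D.inner_normal hσ]
  have hfb : ∀ᶠ q in 𝓝 p, f q ∈ Metric.ball p r ∧ q ∈ Metric.ball p r :=
    (hf.eventually (by rw [hfp]; exact Metric.ball_mem_nhds p hr)).and (Metric.ball_mem_nhds p hr)
  obtain ⟨q, ⟨hfq, hqb⟩, hqτ⟩ := mem_closure_iff_nhds.1 (hτ hp).1 _ hfb
  have hseg : ∀ x ∈ segment ℝ q (f q), ∃ t : ℝ, x = q + t • w := by
    intro x hx
    rw [segment_eq_image'] at hx
    obtain ⟨t, _, rfl⟩ := hx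
    exact ⟨t * ((D.level σ - inner ℝ (D.normal σ) q) / inner ℝ (D.normal σ) w), by
      simp [f, smul_smul]⟩
  have hsub : segment ℝ q (f q) ⊆ D.face τ := by
    refine D.subset_face_of_isPreconnected (convex_segment _ _).isPreconnected ?_ ?_
      ⟨q, left_mem_segment ℝ _ _, hqτ⟩
    · intro x hx
      obtain ⟨t, rfl⟩ := hseg x hx
      rw [inner_add_right, inner_smul_right, hwτ, D.inner_normal hqτ]
      simp
    · intro x hx hxτ
      have hxb : x ∈ Metric.ball p r := (convex_ball p r).segment_subset hqb hfq hx
      have hxe := (hball x hxb).1.1 hxτ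
      obtain ⟨t, rfl⟩ := hseg x hx
      -- If the sliding met the edge, q itself would be on the line of the edge, hence in the
      -- relative boundary of τ, although it belongs to τ.
      have hlin : ∃ t' : ℝ, q = p + t' • w := by
        rw [openEdge, openSegment_eq_image'] at hp
        obtain ⟨θ, _, hθ⟩ := hp
        rw [closedEdge, segment_eq_image'] at hxe
        obtain ⟨θ', _, hθ'⟩ := hxe
        refine ⟨θ' - θ - t, ?_⟩
        have h1 : q = a + θ' • w - t • w := eq_sub_of_add_eq hθ'.symm
        rw [h1, ← hθ]
        simp only [sub_smul]; abel
      have := hτ ((hball q hqb).1.2 hlin)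
      exact this.2 hqτ
  have hfσ : f q ∈ D.face σ := by
    rw [hface]
    refine ⟨(hball _ hfq).2, ?_⟩
    change inner ℝ (D.normal σ) (q + _ • w) = _
    rw [inner_add_right, inner_smul_right]
    field_simp
    ring
  exact Set.disjoint_left.1 (D.face_disjoint τ σ hτσ) (hsub (right_mem_segment ℝ _ _)) hfσ

/-- A face is contained in the convex hull of its nodes. -/
lemma face_subset_convexHull (hd : d = 2 ∨ d = 3) (σ : Fin D.nF) :
    D.face σ ⊆ convexHull ℝ (D.node '' (D.nodesF σ : Set (Fin D.nV))) := by
  intro p hp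
  rcases hd with hd | hd
  · obtain ⟨e, he, hecl, -⟩ := D.relBd_two hd σ
    rw [he] at hp
    refine (convex_convexHull ℝ _).openSegment_subset
      (subset_convexHull ℝ _ (Set.mem_image_of_mem D.node ?_))
      (subset_convexHull ℝ _ (Set.mem_image_of_mem D.node ?_)) hp
    · exact D.mem_nodesF.2 (hecl ▸ left_mem_segment ℝ _ _)
    · exact D.mem_nodesF.2 (hecl ▸ right_mem_segment ℝ _ _)
  have hbd : ∀ x ∈ D.relBd σ, x ∈ convexHull ℝ (D.node '' (D.nodesF σ : Set (Fin D.nV))) := by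
    intro x hx
    obtain ⟨e, he, hxe⟩ := D.relBd_three hd hx
    have hcl : D.closedEdge e ⊆ closure (D.face σ) := by
      rw [← closure_openEdge]
      exact (closure_mono (he.trans Set.sdiff_subset)).trans closure_closure.subset
    refine (convex_convexHull ℝ _).segment_subset
      (subset_convexHull ℝ _ (Set.mem_image_of_mem D.node ?_))
      (subset_convexHull ℝ _ (Set.mem_image_of_mem D.node ?_)) hxe
    · exact D.mem_nodesF.2 (hcl (left_mem_segment ℝ _ _))
    · exact D.mem_nodesF.2 (hcl (right_mem_segment ℝ _ _))
  -- A face is bounded, so a ray in its plane from p must leave it, through a point of the relative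
  -- boundary. Two opposite rays enclose p between two such points, which are already in the convex
  -- hull.
  have hexit : ∀ w : Euc d, w ≠ 0 → inner ℝ (D.normal σ) w = (0 : ℝ) →
      ∃ t : ℝ, 0 ≤ t ∧ p + t • w ∈ D.relBd σ := by
    intro w hw0 hw
    by_contra! hcon
    have hsub : (fun t : ℝ => p + t • w) '' Set.Ici 0 ⊆ D.face σ := by
      refine D.subset_face_of_isPreconnected
        (isPreconnected_Ici.image _ (by fun_prop : Continuous fun t : ℝ => p + t • w).continuousOn)
        ?_ ?_ ⟨p, ⟨0, by simp, by simp⟩, hp⟩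
      · rintro _ ⟨t, _, rfl⟩
        simp [inner_add_right, inner_smul_right, hw, D.inner_normal hp]
      · rintro _ ⟨t, ht, rfl⟩
        exact hcon t ht
    have hb := (D.isBounded_face σ).subset hsub
    obtain ⟨R, hR⟩ := hb.subset_ball p
    have hmem := hR ⟨|R| / ‖w‖, by simp only [Set.mem_Ici]; positivity, rfl⟩
    simp only [Metric.mem_ball, dist_self_add_left, norm_smul, norm_div, Real.norm_eq_abs, abs_abs,
      abs_norm] at hmem
    rw [div_mul_cancel₀ _ (norm_ne_zero_iff.2 hw0)] at hmem
    exact absurd (le_abs_self R) (not_le.2 hmem)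
  obtain ⟨w, hw0, hw⟩ : ∃ w : Euc d, w ≠ 0 ∧ inner ℝ (D.normal σ) w = (0 : ℝ) := by
    have hfr := finrank_perp (D.normal_unit σ)
    have : 0 < Module.finrank ℝ (perp (D.normal σ)) := by omega
    have := Module.finrank_pos_iff.1 this
    obtain ⟨w, hw⟩ := exists_ne (0 : perp (D.normal σ))
    exact ⟨w, by simpa using hw, inner_perp _ w⟩
  obtain ⟨t, ht, h1⟩ := hexit w hw0 hw
  obtain ⟨t', ht', h2⟩ := hexit (-w) (neg_ne_zero.2 hw0) (by simp [hw])
  have ht0 : 0 < t := by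
    rcases ht.lt_or_eq with h | h
    · exact h
    · rw [← h, zero_smul, add_zero] at h1
      exact absurd hp h1.2
  refine (convex_convexHull ℝ _).segment_subset (hbd _ h1) (hbd _ h2) ?_
  rw [mem_segment_iff_div]
  refine ⟨t', t, ht', ht, by linarith, ?_⟩
  have : t' + t ≠ 0 := by linarith
  simp only [smul_add, smul_neg, smul_smul]
  rw [show t / (t' + t) * t' = t' / (t' + t) * t by ring]
  have h3 : (t' / (t' + t)) • p + (t / (t' + t)) • p = p := by
    rw [← add_smul, ← add_div, div_self this, one_smul]
  calc _ = (t' / (t' + t)) • p + (t / (t' + t)) • p := by abel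
    _ = p := h3

/-- Every point of the skeleton of the mesh is a convex combination of nodes that belong to all the
cells at that point, and to the boundary if the point does. -/
theorem exists_carrier (hd : d = 2 ∨ d = 3) (hΩ : IsPolytope Ω) {p : Euc d} (hp : p ∈ closure Ω)
    (hpK : ∀ K, p ∉ D.cell K) : ∃ V : Finset (Fin D.nV),
      p ∈ convexHull ℝ (D.node '' (V : Set (Fin D.nV))) ∧
      (∀ K, p ∈ closure (D.cell K) → V ⊆ D.nodesC K) ∧
      (p ∈ frontier Ω → ∀ s ∈ V, D.node s ∈ frontier Ω) := by
  -- There are three cases: p is a node, is inside an edge (in dimension 3 only), or belongs to a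
  -- face. The carrier is made of the node, of the two ends of the edge, or of the nodes of the
  -- face.
  by_cases hn : ∃ s, D.node s = p
  · obtain ⟨s, rfl⟩ := hn
    refine ⟨{s}, by simp, ?_, ?_⟩
    · intro K hK
      simpa [mem_nodesC] using hK
    · intro h
      simpa using h
  push Not at hn
  have hface : ∀ K, p ∈ closure (D.cell K) → ∃ τ ∈ D.facesC K, p ∈ closure (D.face τ) :=
    fun K hK => D.exists_mem_closure_face hK (hpK K)
  by_cases hbd : ∃ τ, p ∈ D.relBd τ
  · obtain ⟨τ, hτ⟩ := hbd
    have hd3 : d = 3 := by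
      rcases hd with hd | hd
      · obtain ⟨e, -, -, he⟩ := D.relBd_two hd τ
        rcases he hτ with h | h
        · exact absurd h.symm (hn _)
        · exact absurd h.symm (hn _)
      · exact hd
    obtain ⟨e, -, hpe⟩ := D.relBd_three hd3 hτ
    have hpe' := D.mem_closedEdge_cases e hpe hn
    have hl : D.node (D.edge e).1 ∈ D.closedEdge e := left_mem_segment ℝ _ _
    have hr : D.node (D.edge e).2 ∈ D.closedEdge e := right_mem_segment ℝ _ _
    refine ⟨{(D.edge e).1, (D.edge e).2}, ?_, ?_, ?_⟩
    · rw [Finset.coe_insert, Finset.coe_singleton, Set.image_pair, convexHull_pair]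
      exact hpe
    · intro K hK s hs
      obtain ⟨σ, hσ, hpσ⟩ := hface K hK
      have hsub := (D.closedEdge_subset hd3 hpe' hpσ).trans
        ((D.closure_face_subset hσ).trans frontier_subset_closure)
      rw [Finset.mem_insert, Finset.mem_singleton] at hs
      rcases hs with rfl | rfl
      · exact D.mem_nodesC.2 (hsub hl)
      · exact D.mem_nodesC.2 (hsub hr)
    · intro hpΩ s hs
      obtain ⟨σ, hσ, hpσ⟩ := D.exists_boundary_face hd hΩ hpΩ
      have hsub := (D.closedEdge_subset hd3 hpe' hpσ).trans
        (closure_minimal hσ isClosed_frontier)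
      rw [Finset.mem_insert, Finset.mem_singleton] at hs
      rcases hs with rfl | rfl
      · exact hsub hl
      · exact hsub hr
  · push Not at hbd
    have hin : ∀ τ, p ∈ closure (D.face τ) → p ∈ D.face τ := fun τ h => by
      by_contra h'
      exact hbd τ ⟨h, h'⟩
    obtain ⟨K, hK⟩ := D.exists_mem_closure_cell hp
    obtain ⟨σ, hσ, hpσ⟩ := hface K hK
    -- Off the relative boundaries p lies in a single face, which is therefore common to all the
    -- cells at p.
    refine ⟨D.nodesF σ, D.face_subset_convexHull hd σ (hin σ hpσ), ?_, ?_⟩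
    · intro L hL s hs
      obtain ⟨τ, hτ, hpτ⟩ := hface L hL
      have : τ = σ := by
        by_contra h
        exact Set.disjoint_left.1 (D.face_disjoint τ σ h) (hin τ hpτ) (hin σ hpσ)
      subst this
      exact D.mem_nodesC.2 (frontier_subset_closure (D.closure_face_subset hτ (D.mem_nodesF.1 hs)))
    · intro hpΩ s hs
      exact closure_minimal (D.face_cases hΩ (hin σ hpσ) hpΩ) isClosed_frontier (D.mem_nodesF.1 hs)

end PolyMesh

/-! ## Lipschitz functions -/

/-- A function that is `L`-Lipschitz on each of finitely many closed sets covering the space is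
`L`-Lipschitz. -/
lemma norm_sub_le_of_finite_closed_cover {E F ι : Type*} [NormedAddCommGroup E] [NormedSpace ℝ E]
    [NormedAddCommGroup F] [Finite ι] {A : ι → Set E} (hA : ∀ i, IsClosed (A i))
    (hcov : ∀ x, ∃ i, x ∈ A i) {f : E → F} {L : ℝ}
    (hf : ∀ i, ∀ x ∈ A i, ∀ y ∈ A i, ‖f x - f y‖ ≤ L * ‖x - y‖) (hL : 0 ≤ L) (x y : E) :
    ‖f y - f x‖ ≤ L * ‖y - x‖ := by
  have hcont : Continuous f := by
    refine (locallyFinite_of_finite A).continuous (Set.eq_univ_of_forall fun x =>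
      Set.mem_iUnion.2 (hcov x)) hA fun i => ?_
    refine LipschitzOnWith.continuousOn (K := ⟨L, hL⟩) (LipschitzOnWith.of_dist_le_mul ?_)
    intro x hx y hy
    rw [dist_eq_norm, dist_eq_norm]
    exact hf i x hx y hy
  have hline : Continuous fun t : ℝ => x + t • (y - x) := by fun_prop
  -- The margin ε makes the growth comparison along the segment strict.
  have key : ∀ ε : ℝ, 0 < ε → ‖f y - f x‖ ≤ L * ‖y - x‖ + ε := by
    intro ε hε
    have := image_norm_le_of_liminf_right_slope_norm_lt_deriv_boundary (a := 0) (b := 1)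
      (f := fun t : ℝ => f (x + t • (y - x)) - f x) (f' := fun _ => L * ‖y - x‖)
      (B := fun t => (L * ‖y - x‖ + ε) * t) (B' := fun _ => L * ‖y - x‖ + ε)
      ((hcont.comp hline).sub continuous_const).continuousOn ?_ (by simp)
      (by fun_prop) (fun t _ => by simpa using ((hasDerivAt_id t).const_mul _).hasDerivWithinAt)
      (fun t _ _ => by linarith) (x := 1) (by simp)
    · simpa using this
    intro t _ r hr
    -- One of the finitely many sets contains points of the segment arbitrarily close to the
    -- parameter t on its right and, being closed, the point at t too. This bounds the lower right
    -- slope.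
    obtain ⟨i, hi⟩ : ∃ i, ∃ᶠ z in 𝓝[>] t, x + z • (y - x) ∈ A i := by
      by_contra h
      simp only [not_exists, not_frequently] at h
      rw [← eventually_all] at h
      obtain ⟨z, hz⟩ := h.exists
      obtain ⟨i, hi⟩ := hcov (x + z • (y - x))
      exact hz i hi
    have hti : x + t • (y - x) ∈ A i := by
      have := hi.filter_mono (nhdsWithin_le_nhds (a := t) (s := Set.Ioi t))
      exact ((hA i).preimage hline).closure_subset (mem_closure_iff_frequently.2 this)
    refine (hi.and_eventually self_mem_nhdsWithin).mono fun z hz => ?_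
    obtain ⟨hz, hzt⟩ := hz
    have hzt' : 0 < z - t := sub_pos.2 hzt
    rw [slope_def_field, div_lt_iff₀ hzt']
    have h1 := norm_sub_norm_le (f (x + z • (y - x)) - f x) (f (x + t • (y - x)) - f x)
    have h2 := hf i _ hz _ hti
    rw [sub_sub_sub_cancel_right] at h1
    rw [add_sub_add_left_eq_sub, ← sub_smul, norm_smul, Real.norm_of_nonneg hzt'.le] at h2
    simp only [Function.comp_apply]
    nlinarith
  exact le_of_forall_pos_le_add key

/-! ### Exchange of derivatives for compactly supported Lipschitz functions -/

section LipschitzKorn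

variable {E : Type*} [NormedAddCommGroup E] [NormedSpace ℝ E]
  [MeasurableSpace E] [BorelSpace E] {μ : Measure E}
  {C C' : NNReal} {f g : E → ℝ}

lemma LipschitzWith.memLp_lineDeriv_of_hasCompactSupport (hf : LipschitzWith C f)
    (hc : HasCompactSupport f) (v : E) (p : ENNReal) [IsFiniteMeasureOnCompacts μ] : MemLp (fun x => lineDeriv ℝ f x v) p μ := by
  have hsupp : HasCompactSupport (fun x => lineDeriv ℝ f x v) := by
    refine HasCompactSupport.intro hc fun x hx => ?_
    rw [lineDeriv]
    have h1 : f =ᶠ[𝓝 x] 0 := notMem_tsupport_iff_eventuallyEq.1 hx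
    have h2 : ContinuousAt (fun t : ℝ => x + t • v) 0 := by fun_prop
    have h3 : (fun t : ℝ => f (x + t • v)) =ᶠ[𝓝 0] fun _ => 0 := by
      have : Tendsto (fun t : ℝ => x + t • v) (𝓝 0) (𝓝 x) := by simpa [ContinuousAt] using h2
      exact this.eventually h1
    rw [h3.deriv_eq, deriv_const]
  exact hsupp.memLp_of_bound (aestronglyMeasurable_lineDeriv hf.continuous μ) (C * ‖v‖)
    (Eventually.of_forall fun x => norm_lineDeriv_le_of_lipschitz ℝ hf)

variable [FiniteDimensional ℝ E] [μ.IsAddHaarMeasure]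

/-- Integration by parts twice. -/
lemma LipschitzWith.integral_lineDeriv_mul_lineDeriv_comm (hf : LipschitzWith C f)
    (hg : LipschitzWith C' g) (hfc : HasCompactSupport f) (hgc : HasCompactSupport g) (v v' : E) :
    ∫ x, lineDeriv ℝ f x v * lineDeriv ℝ g x v' ∂μ =
      ∫ x, lineDeriv ℝ f x v' * lineDeriv ℝ g x v ∂μ := by
  have hfi : ∀ v, Integrable (fun x => lineDeriv ℝ f x v) μ := fun v =>
    memLp_one_iff_integrable.1 (hf.memLp_lineDeriv_of_hasCompactSupport hfc v 1)
  have hgi : ∀ v, Integrable (fun x => lineDeriv ℝ g x v) μ := fun v =>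
    memLp_one_iff_integrable.1 (hg.memLp_lineDeriv_of_hasCompactSupport hgc v 1)
  have T1 := hg.integral_inv_smul_sub_mul_tendsto_integral_lineDeriv_mul (hfi v) v' (μ := μ)
  have T2 := hf.integral_inv_smul_sub_mul_tendsto_integral_lineDeriv_mul (hgi (-v)) (-v') (μ := μ)
  -- Second derivatives need not exist. One derivative is therefore replaced by a difference
  -- quotient, for which an integration by parts and a translation are legitimate; h tends to 0 on
  -- both sides afterwards.
  have heq : ∀ h : ℝ, ∫ x, (h⁻¹ • (g (x + h • v') - g x)) * lineDeriv ℝ f x v ∂μ =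
      ∫ x, (h⁻¹ • (f (x + h • -v') - f x)) * lineDeriv ℝ g x (-v) ∂μ := by
    intro h
    have hshift : LipschitzWith C' (fun x => g (x + h • v')) := by
      have := hg.comp (isometry_add_right (h • v')).lipschitz
      rwa [mul_one] at this
    have hshiftc : HasCompactSupport (fun x => g (x + h • v')) :=
      hgc.comp_homeomorph (Homeomorph.addRight (h • v'))
    have hL : LipschitzWith (‖h⁻¹‖₊ * (C' + C')) (fun x => h⁻¹ • (g (x + h • v') - g x)) :=
      (lipschitzWith_smul (h⁻¹)).comp (hshift.sub hg)
    have hLc : HasCompactSupport (fun x => h⁻¹ • (g (x + h • v') - g x)) :=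
      (hshiftc.sub hgc).smul_left (f := fun _ => h⁻¹)
    have h1 := hf.integral_lineDeriv_mul_eq hL hLc v (μ := μ)
    have h2 : ∀ᵐ x ∂μ, lineDeriv ℝ (fun x => h⁻¹ • (g (x + h • v') - g x)) x (-v) =
        h⁻¹ * (lineDeriv ℝ g (x + h • v') (-v) - lineDeriv ℝ g x (-v)) := by
      have hae := hg.ae_lineDifferentiableAt (-v) (μ := μ)
      have hae' := (measurePreserving_add_right μ (h • v')).quasiMeasurePreserving.ae hae
      filter_upwards [hae, hae'] with x hx hx'
      have hs : HasLineDerivAt ℝ (fun x => g (x + h • v')) (lineDeriv ℝ g (x + h • v') (-v)) x (-v) := by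
        have := hx'.hasLineDerivAt
        rw [HasLineDerivAt] at this ⊢
        refine this.congr_of_eventuallyEq (Eventually.of_forall fun t => ?_)
        change g _ = g _
        congr 1
        abel
      have : HasLineDerivAt ℝ (fun x => h⁻¹ • (g (x + h • v') - g x))
          (h⁻¹ • (lineDeriv ℝ g (x + h • v') (-v) - lineDeriv ℝ g x (-v))) x (-v) :=
        HasDerivAt.fun_const_smul h⁻¹ (HasDerivAt.fun_sub hs hx.hasLineDerivAt)
      exact this.lineDeriv
    calc _ = ∫ x, lineDeriv ℝ f x v * (h⁻¹ • (g (x + h • v') - g x)) ∂μ := by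
          simp only [mul_comm]
      _ = ∫ x, lineDeriv ℝ (fun x => h⁻¹ • (g (x + h • v') - g x)) x (-v) * f x ∂μ := h1
      _ = ∫ x, h⁻¹ * (lineDeriv ℝ g (x + h • v') (-v) - lineDeriv ℝ g x (-v)) * f x ∂μ := by
          refine integral_congr_ae ?_
          filter_upwards [h2] with x hx
          rw [hx]
      _ = h⁻¹ * ∫ x, lineDeriv ℝ g (x + h • v') (-v) * f x ∂μ -
          h⁻¹ * ∫ x, lineDeriv ℝ g x (-v) * f x ∂μ := by
          have hbd : ∃ M, ∀ x, ‖f x‖ ≤ M := hf.continuous.bounded_above_of_compact_support hfc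
          obtain ⟨M, hM⟩ := hbd
          have i1 : Integrable (fun x => lineDeriv ℝ g x (-v) * f x) μ :=
            (hgi (-v)).mul_bdd hf.continuous.aestronglyMeasurable (Eventually.of_forall hM)
          have i2 : Integrable (fun x => lineDeriv ℝ g (x + h • v') (-v) * f x) μ :=
            ((hgi (-v)).comp_add_right (h • v')).mul_bdd hf.continuous.aestronglyMeasurable
              (Eventually.of_forall hM)
          rw [← integral_const_mul, ← integral_const_mul, ← integral_sub (i2.const_mul _)
            (i1.const_mul _)]
          exact integral_congr_ae (Eventually.of_forall fun x => by ring)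
      _ = h⁻¹ * ∫ x, lineDeriv ℝ g x (-v) * f (x + h • -v') ∂μ -
          h⁻¹ * ∫ x, lineDeriv ℝ g x (-v) * f x ∂μ := by
          rw [← integral_add_right_eq_self (fun x => lineDeriv ℝ g x (-v) * f (x + h • -v'))
            (h • v')]
          simp
      _ = _ := by
          have hbd : ∃ M, ∀ x, ‖f x‖ ≤ M := hf.continuous.bounded_above_of_compact_support hfc
          obtain ⟨M, hM⟩ := hbd
          have i1 : Integrable (fun x => lineDeriv ℝ g x (-v) * f x) μ :=
            (hgi (-v)).mul_bdd hf.continuous.aestronglyMeasurable (Eventually.of_forall hM)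
          have i2 : Integrable (fun x => lineDeriv ℝ g x (-v) * f (x + h • -v')) μ :=
            (hgi (-v)).mul_bdd (hf.continuous.comp (continuous_add_const _)).aestronglyMeasurable
              (Eventually.of_forall fun x => hM _)
          rw [← integral_const_mul, ← integral_const_mul, ← integral_sub (i2.const_mul _)
            (i1.const_mul _)]
          exact integral_congr_ae (Eventually.of_forall fun x => by simp only [smul_eq_mul]; ring)
  have := tendsto_nhds_unique (T1.congr heq) T2
  calc _ = ∫ x, lineDeriv ℝ g x v' * lineDeriv ℝ f x v ∂μ := by simp only [mul_comm]
    _ = ∫ x, lineDeriv ℝ f x (-v') * lineDeriv ℝ g x (-v) ∂μ := this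
    _ = _ := by simp only [lineDeriv_neg, neg_mul_neg]

end LipschitzKorn

lemma ddot_self_nonneg {d : ℕ} (A : Mat d) : 0 ≤ ddot A A :=
  Finset.sum_nonneg fun _ _ => Finset.sum_nonneg fun _ _ => mul_self_nonneg _

/-- The identity reduces Korn's inequality to the sign of the integral of A : ᵗA. -/
lemma two_mul_ddot_symPart {d : ℕ} (A : Mat d) :
    2 * ddot (symPart A) (symPart A) = ddot A A + ∑ i, ∑ j, A i j * A j i := by
  have h : ∑ i, ∑ j, A j i * A j i = ddot A A := Finset.sum_comm
  have h2 : 2 * ddot (symPart A) (symPart A) = (1 / 2) * (ddot A A + ∑ i, ∑ j, A j i * A j i) +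
      ∑ i, ∑ j, A i j * A j i := by
    simp only [ddot, symPart, Finset.mul_sum, ← Finset.sum_add_distrib]
    refine Finset.sum_congr rfl fun i _ => Finset.sum_congr rfl fun j _ => ?_
    simp only [Matrix.smul_apply, Matrix.add_apply, Matrix.transpose_apply, smul_eq_mul]
    ring
  rw [h2, h]; ring

/-- The matrix of the directional derivatives of a vector field. -/
def lineGrad {d : ℕ} (w : Euc d → Euc d) (x : Euc d) : Mat d :=
  Matrix.of fun i j => lineDeriv ℝ (fun y => w y i) x (EuclideanSpace.single j 1)

section Korn

variable {d : ℕ} {w : Euc d → Euc d} {C : NNReal}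

lemma lipschitzWith_component (hw : LipschitzWith C w) (i : Fin d) :
    LipschitzWith C (fun y => w y i) :=
  LipschitzWith.of_dist_le_mul fun x y => by
    refine le_trans ?_ (hw.dist_le_mul x y)
    rw [dist_eq_norm, dist_eq_norm, ← PiLp.sub_apply]
    exact PiLp.norm_apply_le _ i

lemma hasCompactSupport_component (hc : HasCompactSupport w) (i : Fin d) :
    HasCompactSupport (fun y => w y i) :=
  hc.comp_left (g := fun v : Euc d => v i) (by simp)

lemma memLp_lineGrad (hw : LipschitzWith C w) (hc : HasCompactSupport w) (i j : Fin d) :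
    MemLp (fun x => lineGrad w x i j) 2 volume :=
  (lipschitzWith_component hw i).memLp_lineDeriv_of_hasCompactSupport
    (hasCompactSupport_component hc i) _ 2

/-- Korn's inequality for Lipschitz functions with compact support. -/
lemma integral_lineGrad_le (hw : LipschitzWith C w) (hc : HasCompactSupport w) :
    ∫ x, ddot (lineGrad w x) (lineGrad w x) ≤
      2 * ∫ x, ddot (symPart (lineGrad w x)) (symPart (lineGrad w x)) := by
  have hI : ∀ i j k l, Integrable (fun x => lineGrad w x i j * lineGrad w x k l) := fun i j k l =>
    (memLp_lineGrad hw hc i j).integrable_mul (memLp_lineGrad hw hc k l)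
  -- Exchanging the two directions turns ∂ⱼwᵢ ∂ᵢwⱼ into ∂ᵢwᵢ ∂ⱼwⱼ, so the cross term integrates to
  -- that of (div w)².
  have h1 : ∫ x, ∑ i, ∑ j, lineGrad w x i j * lineGrad w x j i =
      ∫ x, (∑ i, lineGrad w x i i) ^ 2 := by
    simp only [sq, Finset.sum_mul_sum]
    rw [integral_finsetSum _ fun i _ => integrable_finsetSum _ fun j _ => hI i j j i,
      integral_finsetSum _ fun i _ => integrable_finsetSum _ fun j _ => hI i i j j]
    refine Finset.sum_congr rfl fun i _ => ?_
    rw [integral_finsetSum _ fun j _ => hI i j j i, integral_finsetSum _ fun j _ => hI i i j j]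
    refine Finset.sum_congr rfl fun j _ => ?_
    exact (lipschitzWith_component hw i).integral_lineDeriv_mul_lineDeriv_comm
      (lipschitzWith_component hw j) (hasCompactSupport_component hc i)
      (hasCompactSupport_component hc j) _ _
  have h2 : 0 ≤ ∫ x, ∑ i, ∑ j, lineGrad w x i j * lineGrad w x j i := by
    rw [h1]
    exact integral_nonneg fun x => sq_nonneg _
  rw [← integral_const_mul]
  simp only [two_mul_ddot_symPart]
  rw [integral_add]
  · linarith
  · exact integrable_finsetSum _ fun i _ => integrable_finsetSum _ fun j _ => hI i j i j
  · exact integrable_finsetSum _ fun i _ => integrable_finsetSum _ fun j _ => hI i j j i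

end Korn

/-! ## Affine maps on simplices -/

section Simplex

variable {E F : Type*} [NormedAddCommGroup E] [NormedSpace ℝ E] [NormedAddCommGroup F]
  [NormedSpace ℝ F]

/-- The vertices of a full-dimensional simplex form an affine basis; the map is a combination of
barycentric coordinates. -/
lemma exists_affineMap_of_simplex [FiniteDimensional ℝ E] {t : Finset E}
    (ht : AffineIndependent ℝ ((↑) : t → E)) (hcard : t.card = Module.finrank ℝ E + 1) (val : E → F) :
    ∃ A : E →ᵃ[ℝ] F, ∀ p ∈ t, A p = val p := by
  classical
  have htop : affineSpan ℝ (Set.range ((↑) : t → E)) = ⊤ :=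
    ht.affineSpan_eq_top_iff_card_eq_finrank_add_one.2 (by simpa using hcard)
  let b : AffineBasis t ℝ E := ⟨(↑), ht, htop⟩
  refine ⟨∑ i : t, (LinearMap.toSpanSingleton ℝ F (val i)).toAffineMap.comp (b.coord i), ?_⟩
  intro p hp
  have h1 : ∀ x : E, (∑ i : t, (LinearMap.toSpanSingleton ℝ F (val i)).toAffineMap.comp
      (b.coord i)) x = ∑ i : t, b.coord i x • val i := by
    intro x
    have : ∀ s : Finset t, (∑ i ∈ s, (LinearMap.toSpanSingleton ℝ F (val i)).toAffineMap.comp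
      (b.coord i)) x = ∑ i ∈ s, b.coord i x • val i := by
      intro s
      induction s using Finset.induction_on with
      | empty => simp
      | insert a s ha ih => rw [Finset.sum_insert ha, Finset.sum_insert ha, AffineMap.coe_add, Pi.add_apply, ih]; simp
    exact this _
  rw [h1]
  have hb : b ⟨p, hp⟩ = p := rfl
  have h2 : ∀ i : t, b.coord i p = if i = ⟨p, hp⟩ then 1 else 0 := by
    intro i
    have := b.coord_apply i ⟨p, hp⟩
    rwa [hb] at this
  simp [h2]

lemma AffineMap.eqOn_convexHull {A B : E →ᵃ[ℝ] F} {s : Set E} (h : ∀ x ∈ s, A x = B x) :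
    ∀ x ∈ convexHull ℝ s, A x = B x := by
  refine convexHull_min (t := {x | A x = B x}) h ?_
  intro x hx y hy a b ha hb hab
  simp only [Set.mem_ofPred_eq] at hx hy ⊢
  rw [Convex.combo_affine_apply hab, Convex.combo_affine_apply hab, hx, hy]

lemma AffineMap.norm_le_on_convexHull {A : E →ᵃ[ℝ] F} {s : Set E} {M : ℝ}
    (h : ∀ x ∈ s, ‖A x‖ ≤ M) : ∀ x ∈ convexHull ℝ s, ‖A x‖ ≤ M := by
  have hconv : Convex ℝ (A ⁻¹' Metric.closedBall 0 M) := (convex_closedBall (0 : F) M).affine_preimage A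
  intro x hx
  have := convexHull_min (t := A ⁻¹' Metric.closedBall 0 M) (fun y hy => by simpa using h y hy) hconv hx
  simpa using this

/-- The gradient of an affine map that is bounded on the vertices of a simplex. -/
lemma AffineMap.norm_linear_le {A : E →ᵃ[ℝ] F} {s : Set E} {M r : ℝ} {x : E} (hr : 0 < r)
    (hball : Metric.ball x r ⊆ convexHull ℝ s) (h : ∀ y ∈ s, ‖A y‖ ≤ M) (z : E) :
    ‖A.linear z‖ ≤ 4 * M / r * ‖z‖ := by
  have hle := AffineMap.norm_le_on_convexHull h
  by_cases hz : z = 0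
  · simp [hz]
  have hz' : 0 < ‖z‖ := norm_pos_iff.2 hz
  -- The points x and x + cz are r/2 apart, within the open ball, and the values of A there differ
  -- by at most 2M. Hence the factor 2M / (r/2) = 4M/r.
  set c := r / 2 / ‖z‖ with hc
  have hcpos : 0 < c := by positivity
  have h1 := hle x (hball (Metric.mem_ball_self hr))
  have h2 := hle (x + c • z) (hball (by
    rw [Metric.mem_ball, dist_self_add_left, norm_smul, Real.norm_of_nonneg hcpos.le, hc,
      div_mul_cancel₀ _ hz'.ne']
    linarith))
  have h3 : A (x + c • z) - A x = c • A.linear z := by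
    rw [← vsub_eq_sub, ← AffineMap.linearMap_vsub, vsub_eq_sub, add_sub_cancel_left, map_smul]
  have h4 : c * ‖A.linear z‖ ≤ 2 * M := by
    rw [← Real.norm_of_nonneg hcpos.le, ← norm_smul, ← h3]
    linarith [norm_sub_le (A (x + c • z)) (A x)]
  have h5 : ‖A.linear z‖ ≤ 2 * M / c := by rw [le_div_iff₀ hcpos]; linarith
  refine h5.trans (le_of_eq ?_)
  rw [hc]
  field_simp
  ring

end Simplex

/-! ## Simplicial complexes -/

namespace Geometry.SimplicialComplex

variable {E F : Type*} [NormedAddCommGroup E] [NormedSpace ℝ E] [NormedAddCommGroup F]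
  [NormedSpace ℝ F] {S : Geometry.SimplicialComplex ℝ E}

open Classical in
/-- A face that contains a point of the open simplex of `s` contains `s`. -/
lemma subset_of_pos {s t : Finset E} (hs : s ∈ S.faces) (ht : t ∈ S.faces) {l : E → ℝ}
    (hpos : ∀ p ∈ s, 0 < l p) (hsum : ∑ p ∈ s, l p = 1) (hx : ∑ p ∈ s, l p • p ∈ convexHull ℝ (t : Set E)) :
    s ⊆ t := by
  have hxs : ∑ p ∈ s, l p • p ∈ convexHull ℝ (s : Set E) :=
    (convex_convexHull ℝ _).sum_mem (fun p hp => (hpos p hp).le) hsum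
      (fun p hp => subset_convexHull ℝ _ hp)
  -- The point is also a combination of the vertices common to s and t. Affine independence
  -- identifies the two families of weights, so no vertex of positive weight can be missing from t.
  have hmem := S.inter_subset_convexHull hs ht ⟨hxs, hx⟩
  rw [← Finset.coe_inter, Finset.mem_convexHull'] at hmem
  obtain ⟨k, hk0, hk1, hkx⟩ := hmem
  let k' : E → ℝ := fun p => if p ∈ t then k p else 0
  have e1 : ∑ p ∈ s, k' p = 1 := by
    rw [← hk1, ← Finset.sum_filter, Finset.filter_mem_eq_inter]
  have e2 : ∑ p ∈ s, k' p • p = ∑ p ∈ s, l p • p := by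
    rw [← hkx, ← Finset.filter_mem_eq_inter, Finset.sum_filter]
    exact Finset.sum_congr rfl fun p _ => by simp only [k']; split_ifs <;> simp
  have hind := (affineIndependent_iff.1 (S.indep hs)) Finset.univ (fun p => l p - k' p)
    (by rw [Finset.sum_coe_sort s (fun p => l p - k' p), Finset.sum_sub_distrib, hsum, e1, sub_self])
    (by
      rw [Finset.sum_coe_sort s (fun p => (l p - k' p) • p)]
      simp only [sub_smul, Finset.sum_sub_distrib, e2, sub_self])
  intro p hp
  by_contra hpt
  have := hind ⟨p, hp⟩ (Finset.mem_univ _)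
  simp only [k', hpt, if_false, sub_zero] at this
  exact (hpos p hp).ne' this

open Classical in
/-- If one vertex of a simplex lies in the interior of the complex, so does the open simplex. -/
lemma mem_interior_space_of_pos (hfin : S.faces.Finite) {s : Finset E} (hs : s ∈ S.faces) {l : E → ℝ}
    (hpos : ∀ p ∈ s, 0 < l p) (hsum : ∑ p ∈ s, l p = 1) {p₀ : E} (hp₀ : p₀ ∈ s)
    (hint : p₀ ∈ interior S.space) : ∑ p ∈ s, l p • p ∈ interior S.space := by
  set x := ∑ p ∈ s, l p • p with hx
  have hl1 : l p₀ ≤ 1 := by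
    rw [← hsum]
    exact Finset.single_le_sum (f := l) (fun p hp => (hpos p hp).le) hp₀
  have hev : ∀ᶠ δ in 𝓝[>] (0 : ℝ), p₀ + δ • (x - p₀) ∈ interior S.space := by
    have hc : ContinuousAt (fun δ : ℝ => p₀ + δ • (x - p₀)) 0 := by fun_prop
    refine (hc.eventually (isOpen_interior.mem_nhds ?_)).filter_mono nhdsWithin_le_nhds
    simpa using hint
  have hsmall : ∀ᶠ δ in 𝓝[>] (0 : ℝ), δ < 1 ∧ 0 < δ :=
    ((gt_mem_nhds one_pos).filter_mono nhdsWithin_le_nhds).and self_mem_nhdsWithin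
  obtain ⟨δ, hδint, hδ1, hδ0⟩ := (hev.and hsmall).exists
  -- This point of the open simplex is close enough to p₀ to be interior to the complex; its weights
  -- are m.
  set q := p₀ + δ • (x - p₀) with hq
  let m : E → ℝ := fun p => (1 - δ) * (if p = p₀ then 1 else 0) + δ * l p
  have hm0 : ∀ p ∈ s, 0 < m p := fun p hp => by
    have := hpos p hp
    simp only [m]
    split_ifs
    · nlinarith
    · nlinarith
  have hm1 : ∑ p ∈ s, m p = 1 := by
    simp only [m, Finset.sum_add_distrib, ← Finset.mul_sum, hsum, Finset.sum_ite_eq', hp₀, if_true]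
    ring
  have hmq : ∑ p ∈ s, m p • p = q := by
    have hmp : ∀ p, m p • p = (1 - δ) • (if p = p₀ then p else 0) + δ • l p • p := fun p => by
      simp only [m, add_smul, mul_smul, ite_smul, one_smul, zero_smul]
    rw [Finset.sum_congr rfl fun p _ => hmp p, Finset.sum_add_distrib, ← Finset.smul_sum,
      ← Finset.smul_sum, ← hx, Finset.sum_ite_eq', if_pos hp₀, hq, sub_smul, smul_sub, one_smul]
    abel
  have hloc : ∀ᶠ y in 𝓝 q, ∀ t ∈ S.faces, q ∉ convexHull ℝ (t : Set E) → y ∉ convexHull ℝ (t : Set E) := by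
    rw [hfin.eventually_all]
    intro t _
    by_cases h : q ∈ convexHull ℝ (t : Set E)
    · exact Eventually.of_forall fun y h' => absurd h h'
    · have hcl : IsClosed (convexHull ℝ (t : Set E)) := (t.finite_toSet.isCompact_convexHull ℝ).isClosed
      filter_upwards [hcl.isOpen_compl.mem_nhds h] with y hy _ using hy
  have hspace : ∀ᶠ y in 𝓝 q, y ∈ S.space := mem_interior_iff_mem_nhds.1 hδint
  have hl0 := hpos p₀ hp₀
  -- Points y near x are sent near q by a homothety of ratio 1 / l p₀. The image lies in a simplex
  -- t, which contains q and therefore all of s. Then y is the image with weight l p₀ plus vertices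
  -- of s with the weights l − l p₀ · m, so it is in the hull of t.
  have hcont : ContinuousAt (fun y : E => q + (l p₀)⁻¹ • (y - x)) x := by fun_prop
  have hcx : q + (l p₀)⁻¹ • (x - x) = q := by simp
  rw [ContinuousAt, hcx] at hcont
  have hall := hcont.eventually (hloc.and hspace)
  rw [mem_interior_iff_mem_nhds]
  filter_upwards [hall] with y hy
  obtain ⟨hy1, hy2⟩ := hy
  rw [mem_space_iff] at hy2
  obtain ⟨t, ht, hyt⟩ := hy2
  have hqt : q ∈ convexHull ℝ (t : Set E) := by
    by_contra h
    exact hy1 t ht h hyt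
  have hst : s ⊆ t := subset_of_pos hs ht hm0 hm1 (by rw [hmq]; exact hqt)
  refine S.convexHull_subset_space ht ?_
  have hcoef : ∀ p ∈ s, 0 ≤ l p - l p₀ * m p := by
    intro p hp
    have hp' := hpos p hp
    simp only [m]
    split_ifs with h
    · subst h
      have : 0 ≤ l p * δ * (1 - l p) := by
        have := sub_nonneg.2 hl1
        positivity
      nlinarith
    · have : 0 ≤ l p * (1 - δ * l p₀) := by
        have : δ * l p₀ ≤ 1 := by nlinarith
        have := sub_nonneg.2 this
        positivity
      nlinarith
  have hy_eq : y = l p₀ • (q + (l p₀)⁻¹ • (y - x)) + ∑ p ∈ s, (l p - l p₀ * m p) • p := by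
    simp only [sub_smul, mul_smul, Finset.sum_sub_distrib, ← Finset.smul_sum, hmq, ← hx, smul_add]
    rw [smul_smul, mul_inv_cancel₀ hl0.ne', one_smul]
    abel
  have hsum2 : ∑ p ∈ s, (l p - l p₀ * m p) = 1 - l p₀ := by
    rw [Finset.sum_sub_distrib, ← Finset.mul_sum, hsum, hm1, mul_one]
  rw [hy_eq]
  -- If l p₀ = 1, the remaining weights are all zero and cannot be normalised.
  rcases hl1.lt_or_eq with hlt | heq
  · have hpos' : 0 < 1 - l p₀ := by linarith
    have hz : ∑ p ∈ s, ((1 - l p₀)⁻¹ * (l p - l p₀ * m p)) • p ∈ convexHull ℝ (t : Set E) :=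
      (convex_convexHull ℝ _).sum_mem
        (fun p hp => mul_nonneg (inv_nonneg.2 hpos'.le) (hcoef p hp))
        (by rw [← Finset.mul_sum, hsum2, inv_mul_cancel₀ hpos'.ne'])
        (fun p hp => subset_convexHull ℝ _ (hst hp))
    have := (convex_convexHull ℝ (t : Set E)) hyt hz hl0.le hpos'.le (by ring)
    simpa only [mul_smul, ← Finset.smul_sum, smul_smul (1 - l p₀), mul_inv_cancel₀ hpos'.ne',
      one_smul] using this
  · have hz : ∀ p ∈ s, l p - l p₀ * m p = 0 := by
      rw [sub_eq_zero.2 heq.symm] at hsum2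
      exact (Finset.sum_eq_zero_iff_of_nonneg hcoef).1 (by rw [hsum2])
    rw [Finset.sum_congr rfl fun p hp => by rw [hz p hp, zero_smul], heq]
    simpa [heq] using hyt

/-- The piecewise affine interpolant of vertex values on a simplicial complex. -/
theorem exists_interpolant [FiniteDimensional ℝ E] (S : Geometry.SimplicialComplex ℝ E)
    (val : E → F) : ∃ (w : E → F) (A : Finset E → E →ᵃ[ℝ] F),
      (∀ t ∈ S.faces, t.card = Module.finrank ℝ E + 1 →
        (∀ p ∈ t, A t p = val p) ∧ ∀ x ∈ convexHull ℝ (t : Set E), w x = A t x) ∧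
      ∀ x ∉ S.space, w x = 0 := by
  classical
  have hA : ∀ t : Finset E, ∃ A : E →ᵃ[ℝ] F, t ∈ S.faces → t.card = Module.finrank ℝ E + 1 →
      ∀ p ∈ t, A p = val p := by
    intro t
    by_cases h : t ∈ S.faces ∧ t.card = Module.finrank ℝ E + 1
    · obtain ⟨A, hA⟩ := exists_affineMap_of_simplex (S.indep h.1) h.2 val
      exact ⟨A, fun _ _ => hA⟩
    · exact ⟨0, fun h1 h2 => absurd ⟨h1, h2⟩ h⟩
  choose A hA using hA
  refine ⟨fun x => if h : ∃ t ∈ S.faces, t.card = Module.finrank ℝ E + 1 ∧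
    x ∈ convexHull ℝ (t : Set E) then A h.choose x else 0, A, ?_, ?_⟩
  · intro t ht hc
    refine ⟨hA t ht hc, fun x hx => ?_⟩
    have h : ∃ t ∈ S.faces, t.card = Module.finrank ℝ E + 1 ∧ x ∈ convexHull ℝ (t : Set E) :=
      ⟨t, ht, hc, hx⟩
    simp only [dif_pos h]
    obtain ⟨hs1, hs2, hs3⟩ := h.choose_spec
    -- Two simplices meet in the hull of their common vertices, where their affine maps agree; so
    -- the choice of the simplex is immaterial.
    refine AffineMap.eqOn_convexHull (fun p hp => ?_) x (S.inter_subset_convexHull hs1 ht ⟨hs3, hx⟩)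
    rw [hA _ hs1 hs2 p hp.1, hA t ht hc p hp.2]
  · intro x hx
    refine dif_neg ?_
    rintro ⟨t, ht, _, hxt⟩
    exact hx (S.convexHull_subset_space ht hxt)

end Geometry.SimplicialComplex

/-! ## The reconstructions as affine maps -/

/-- The linear map attached to a matrix. -/
def matVecLin {d : ℕ} (A : Mat d) : Euc d →ₗ[ℝ] Euc d where
  toFun := matVec A
  map_add' x y := by
    ext i
    simp [matVec, mul_add, Finset.sum_add_distrib]
  map_smul' c x := by
    ext i
    simp only [matVec, PiLp.smul_apply, smul_eq_mul, RingHom.id_apply, Finset.mul_sum]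
    exact Finset.sum_congr rfl fun j _ => by ring

lemma matVecLin_single {d : ℕ} (A : Mat d) (i j : Fin d) :
    matVecLin A (EuclideanSpace.single j 1) i = A i j := by
  simp [matVecLin, matVec]

lemma ddot_eq_sum_norm_sq {d : ℕ} (A : Mat d) :
    ddot A A = ∑ j, ‖matVecLin A (EuclideanSpace.single j 1)‖ ^ 2 := by
  simp only [EuclideanSpace.norm_sq_eq, matVecLin_single, Real.norm_eq_abs, sq_abs, ddot, ← sq]
  exact Finset.sum_comm

namespace PolyMesh

variable {d : ℕ} {Ω : Set (Euc d)} (D : PolyMesh d Ω)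

lemma diamC_pos (hd : d = 2 ∨ d = 3) (K : Fin D.nC) : 0 < D.diamC K := by
  have : Nonempty (Fin d) := ⟨⟨0, by omega⟩⟩
  obtain ⟨x, hx⟩ := (D.cell_polytope K).nonempty
  obtain ⟨r, hr, hball⟩ := Metric.isOpen_iff.1 (D.cell_polytope K).isOpen x hx
  obtain ⟨e, he⟩ := exists_ne (0 : Euc d)
  have he' : 0 < ‖e‖ := norm_pos_iff.2 he
  have hy : x + (r / 2 / ‖e‖) • e ∈ D.cell K := hball (by
    rw [Metric.mem_ball, dist_self_add_left, norm_smul, Real.norm_of_nonneg (by positivity),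
      div_mul_cancel₀ _ he'.ne']
    linarith)
  refine Metric.diam_pos ⟨x, hx, _, hy, ?_⟩ (D.cell_polytope K).isBounded
  intro h
  have := left_eq_add.1 h
  rcases smul_eq_zero.1 this with h' | h'
  · have : r / 2 / ‖e‖ ≠ 0 := by positivity
    exact this h'
  · exact he h'

lemma measC_pos (K : Fin D.nC) : 0 < D.measC K :=
  ENNReal.toReal_pos ((D.cell_polytope K).isOpen.measure_pos volume (D.cell_polytope K).nonempty).ne'
    (D.cell_polytope K).volume_ne_top

lemma measC_le (K : Fin D.nC) :
    D.measC K ≤ D.diamC K ^ d * volume.real (Metric.ball (0 : Euc d) 1) := by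
  obtain ⟨x, hx⟩ := (D.cell_polytope K).nonempty
  have hsub : D.cell K ⊆ Metric.closedBall x (D.diamC K) := fun y hy =>
    Metric.dist_le_diam_of_mem (D.cell_polytope K).isBounded hy hx
  have h := measureReal_mono (μ := volume) hsub (isCompact_closedBall x _).measure_ne_top
  refine h.trans (le_of_eq ?_)
  have h0 : 0 ≤ D.diamC K := Metric.diam_nonneg
  rw [Measure.real, Measure.addHaar_closedBall volume x h0,
    ENNReal.toReal_mul, ENNReal.toReal_ofReal (pow_nonneg h0 _),
    finrank_euclideanSpace, Fintype.card_fin]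
  rfl

lemma exists_node_mem_closure (hd : d = 2 ∨ d = 3) (s : Fin D.nV) : ∃ K, s ∈ D.nodesC K := by
  obtain ⟨e, he⟩ := D.node_edge s
  have hs : D.node s ∈ D.closedEdge e := by
    rcases he with rfl | rfl
    · exact left_mem_segment ℝ _ _
    · exact right_mem_segment ℝ _ _
  obtain ⟨σ, hσ⟩ : ∃ σ, D.closedEdge e ⊆ closure (D.face σ) := by
    rcases hd with hd | hd
    · obtain ⟨σ, hσ⟩ := (D.face_edge_two hd).2 e
      exact ⟨σ, by rw [← closure_openEdge, hσ]; rfl⟩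
    · obtain ⟨σ, hσ⟩ := (D.face_edge_three hd).2 e
      refine ⟨σ, ?_⟩
      rw [← closure_openEdge]
      exact (closure_mono (hσ.trans Set.sdiff_subset)).trans closure_closure.subset
  obtain ⟨K, hK⟩ := D.exists_mem_facesC σ
  exact ⟨K, D.mem_nodesC.2 (frontier_subset_closure (D.closure_face_subset hK (hσ hs)))⟩

lemma cell_unique {K L : Fin D.nC} {x : Euc d} (hK : x ∈ D.cell K) (hL : x ∈ closure (D.cell L)) :
    L = K := by
  by_contra h
  have := (D.cell_disjoint L K h).closure_left (D.cell_polytope K).isOpen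
  exact Set.disjoint_left.1 this hL hK

lemma notMem_cell_of_frontier (hΩ : IsPolytope Ω) {x : Euc d} (hx : x ∈ frontier Ω) (K : Fin D.nC) :
    x ∉ D.cell K := fun h => by
  rw [hΩ.isOpen.frontier_eq] at hx
  exact hx.2 (D.cell_subset hΩ K h)

/-- Almost every point of the space lies in a cell or out of the closure of the domain. -/
lemma ae_mem_cell_or : ∀ᵐ x : Euc d, (∃ K, x ∈ D.cell K) ∨ x ∉ closure Ω := by
  filter_upwards [D.ae_notMem_closure_face] with x hx
  by_cases h : x ∈ closure Ω
  · left
    obtain ⟨K, hK⟩ := D.exists_mem_closure_cell h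
    by_contra hn
    push Not at hn
    obtain ⟨σ, _, hσ⟩ := D.exists_mem_closure_face hK (hn K)
    exact hx σ hσ
  · exact Or.inr h

end PolyMesh

/-! ### Conforming interpolation of a discrete field -/

namespace Discretization

variable {d : ℕ} {Ω : Set (Euc d)} (D : Discretization d Ω)

/-- The displacement reconstruction in a cell, as an affine map. -/
def dispAff (v : D.DOF) (K : Fin D.nC) : Euc d →ᵃ[ℝ] Euc d where
  toFun := D.dispC v K
  linear := matVecLin (D.gradC v K)
  map_vadd' p w := by
    change matVecLin (D.gradC v K) (w + p - _) + _ = matVecLin (D.gradC v K) w +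
      (matVecLin (D.gradC v K) (p - _) + _)
    rw [add_sub_assoc, map_add, add_assoc]

lemma stabC_self_eq (v : D.DOF) (K : Fin D.nC) : D.stabC K v v = D.diamC K ^ (d - 2) *
    ∑ s ∈ D.nodesC K, ‖v.1 s - D.dispC v K (D.node s)‖ ^ 2 +
    D.diamC K ^ (d - 2) * ∑ σ ∈ D.facesC K, v.2 σ ^ 2 := by
  simp only [stabC, real_inner_self_eq_norm_sq, ← sq]

lemma stabC_self_nonneg (v : D.DOF) (K : Fin D.nC) : 0 ≤ D.stabC K v v := by
  rw [stabC_self_eq]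
  have : 0 ≤ D.diamC K := Metric.diam_nonneg
  positivity

lemma le_stabC {v : D.DOF} {K : Fin D.nC} {s : Fin D.nV} (hs : s ∈ D.nodesC K) :
    D.diamC K ^ (d - 2) * ‖v.1 s - D.dispC v K (D.node s)‖ ^ 2 ≤ D.stabC K v v := by
  have h0 : 0 ≤ D.diamC K ^ (d - 2) := pow_nonneg Metric.diam_nonneg _
  rw [stabC_self_eq]
  have h1 := Finset.single_le_sum (f := fun s => ‖v.1 s - D.dispC v K (D.node s)‖ ^ 2)
    (fun _ _ => sq_nonneg _) hs
  have h2 : 0 ≤ ∑ σ ∈ D.facesC K, v.2 σ ^ 2 := Finset.sum_nonneg fun _ _ => sq_nonneg _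
  have := mul_le_mul_of_nonneg_left h1 h0
  have := mul_nonneg h0 h2
  linarith

lemma le_stabC_face {v : D.DOF} {K : Fin D.nC} {σ : Fin D.nF} (hs : σ ∈ D.facesC K) :
    D.diamC K ^ (d - 2) * v.2 σ ^ 2 ≤ D.stabC K v v := by
  have h0 : 0 ≤ D.diamC K ^ (d - 2) := pow_nonneg Metric.diam_nonneg _
  rw [stabC_self_eq]
  have h1 := Finset.single_le_sum (f := fun σ => v.2 σ ^ 2) (fun _ _ => sq_nonneg _) hs
  have h2 : 0 ≤ ∑ s ∈ D.nodesC K, ‖v.1 s - D.dispC v K (D.node s)‖ ^ 2 :=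
    Finset.sum_nonneg fun _ _ => sq_nonneg _
  have := mul_le_mul_of_nonneg_left h1 h0
  have := mul_nonneg h0 h2
  linarith

/-- The bound of the nodal residuals in a cell. -/
def residual (v : D.DOF) (K : Fin D.nC) : ℝ := Real.sqrt (D.stabC K v v / D.diamC K ^ (d - 2))

lemma norm_residual_le (hd : d = 2 ∨ d = 3) {v : D.DOF} {K : Fin D.nC} {s : Fin D.nV}
    (hs : s ∈ D.nodesC K) : ‖v.1 s - D.dispC v K (D.node s)‖ ≤ D.residual v K := by
  have hpos : 0 < D.diamC K ^ (d - 2) := pow_pos (D.diamC_pos hd K) _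
  refine Real.le_sqrt_of_sq_le ?_
  rw [le_div_iff₀ hpos, mul_comm]
  exact D.le_stabC hs

/-- A value at a point of the mesh that is close to all the reconstructions at that point. -/
lemma exists_nodal_value (hd : d = 2 ∨ d = 3) (hΩ : IsPolytope Ω) {v : D.DOF} (hv : v ∈ D.U0)
    {p : Euc d} (hp : p ∈ closure Ω) : ∃ y : Euc d,
      (∀ K, p ∈ closure (D.cell K) → ‖y - D.dispC v K p‖ ≤ D.residual v K) ∧
      (p ∈ frontier Ω → y = 0) := by
  by_cases hK : ∃ K, p ∈ D.cell K
  · obtain ⟨K, hK⟩ := hK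
    refine ⟨D.dispC v K p, fun L hL => ?_, fun h =>
      absurd hK (D.notMem_cell_of_frontier hΩ h K)⟩
    rw [D.cell_unique hK hL, sub_self, norm_zero]
    exact Real.sqrt_nonneg _
  · push Not at hK
    obtain ⟨V, hpV, hVK, hV0⟩ := D.exists_carrier hd hΩ hp hK
    -- The convex combination is lifted to the pairs (x_s, v_s), so that a single y serves all the
    -- cells. In each of them y − Π^K v(p) is the same combination of nodal residuals, because Π^K v
    -- is affine.
    have himg : p ∈ (LinearMap.fst ℝ (Euc d) (Euc d)) ''
        convexHull ℝ ((fun s => (D.node s, v.1 s)) '' (V : Set (Fin D.nV))) := by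
      rw [LinearMap.image_convexHull, Set.image_image]
      exact hpV
    obtain ⟨⟨p', y⟩, hmem, hpp⟩ := himg
    have hpp' : p' = p := hpp
    subst hpp'
    refine ⟨y, fun K hK => ?_, fun hfr => ?_⟩
    · obtain ⟨B, hB⟩ : ∃ B : (Euc d × Euc d) →ᵃ[ℝ] Euc d, ∀ a b, B (a, b) = b - D.dispC v K a :=
        ⟨(LinearMap.snd ℝ (Euc d) (Euc d)).toAffineMap -
          (D.dispAff v K).comp (LinearMap.fst ℝ (Euc d) (Euc d)).toAffineMap, fun _ _ => rfl⟩
      have h1 : ∀ z ∈ (fun s => (D.node s, v.1 s)) '' (V : Set (Fin D.nV)),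
          ‖B z‖ ≤ D.residual v K := by
        rintro _ ⟨s, hs, rfl⟩
        rw [hB]
        exact D.norm_residual_le hd (hVK K hK hs)
      rw [← hB]
      exact AffineMap.norm_le_on_convexHull h1 _ hmem
    · obtain ⟨B, hB⟩ : ∃ B : (Euc d × Euc d) →ᵃ[ℝ] Euc d, ∀ a b, B (a, b) = b :=
        ⟨(LinearMap.snd ℝ (Euc d) (Euc d)).toAffineMap, fun _ _ => rfl⟩
      have h1 : ∀ z ∈ (fun s => (D.node s, v.1 s)) '' (V : Set (Fin D.nV)), ‖B z‖ ≤ 0 := by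
        rintro _ ⟨s, hs, rfl⟩
        rw [hB, hv.1 s (hV0 hfr s hs), norm_zero]
      have := AffineMap.norm_le_on_convexHull h1 _ hmem
      rw [hB] at this
      exact norm_le_zero_iff.1 this

/-- The conforming interpolation on the simplicial submesh. -/
theorem exists_conforming (hd : d = 2 ∨ d = 3) (hΩ : IsPolytope Ω) {ρ : ℝ} (hρ : 0 < ρ)
    (hreg : D.IsRegular ρ) {v : D.DOF} (hv : v ∈ D.U0) : ∃ w : Euc d → Euc d,
      (∃ C, LipschitzWith C w) ∧ HasCompactSupport w ∧
      (∀ x, x ∉ closure Ω → lineGrad w x = 0) ∧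
      (∀ᵐ x, x ∈ Ω → ∃ K, x ∈ D.cell K ∧
        D.diamC K ^ d * ddot (lineGrad w x - D.gradC v K) (lineGrad w x - D.gradC v K) ≤
          16 * d / ρ ^ 4 * D.stabC K v v) ∧
      ((∀ K, D.gradC v K = 0 ∧ D.stabC K v v = 0) → ∀ s, v.1 s = 0) := by
  classical
  obtain ⟨S, hfin, hspace, hpure, htop, -⟩ := hreg
  have hval : ∀ p : Euc d, ∃ y : Euc d, p ∈ closure Ω →
      (∀ K, p ∈ closure (D.cell K) → ‖y - D.dispC v K p‖ ≤ D.residual v K) ∧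
      (p ∈ frontier Ω → y = 0) := by
    intro p
    by_cases hp : p ∈ closure Ω
    · obtain ⟨y, hy⟩ := D.exists_nodal_value hd hΩ hv hp
      exact ⟨y, fun _ => hy⟩
    · exact ⟨0, fun h => absurd h hp⟩
  choose val hval using hval
  obtain ⟨w, A, hA, hw0⟩ := S.exists_interpolant val
  have hfr : Module.finrank ℝ (Euc d) = d := by simp
  rw [hfr] at hA
  have hvert : ∀ t ∈ S.faces, ∀ p ∈ t, p ∈ closure Ω := fun t ht p hp => by
    rw [← hspace]; exact S.subset_space ht hp
  -- vanishing out of the domain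
  have hout : ∀ x ∉ Ω, w x = 0 := by
    intro x hx
    by_cases hxs : x ∈ S.space
    swap
    · exact hw0 x hxs
    rw [Geometry.SimplicialComplex.mem_space_iff] at hxs
    obtain ⟨t₀, ht₀, hxt₀⟩ := hxs
    obtain ⟨t, ht, htt, hcard⟩ := hpure t₀ ht₀
    have hxt : x ∈ convexHull ℝ (t : Set (Euc d)) := convexHull_mono (by exact_mod_cast htt) hxt₀
    rw [(hA t ht hcard).2 x hxt]
    rw [Finset.mem_convexHull'] at hxt
    obtain ⟨l, hl0, hl1, hlx⟩ := hxt
    -- The vertices of t with positive weight span the smallest face that contains x. If one of them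
    -- were in Ω, x would be interior to the complex, that is, in Ω. So they all lie on ∂Ω, where
    -- the prescribed values are zero.
    set s := t.filter (fun p => 0 < l p) with hs
    have hzero : ∀ p ∈ t, p ∉ s → l p = 0 := fun p hp hps => by
      have h1 := hl0 p hp
      by_contra hne
      exact hps (Finset.mem_filter.2 ⟨hp, lt_of_le_of_ne h1 (Ne.symm hne)⟩)
    have hs1 : ∑ p ∈ s, l p = 1 := by
      rw [← hl1]
      exact Finset.sum_subset (Finset.filter_subset _ _) hzero
    have hsx : ∑ p ∈ s, l p • p = x := by
      rw [← hlx]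
      exact Finset.sum_subset (Finset.filter_subset _ _) fun p hp hps => by
        rw [hzero p hp hps, zero_smul]
    have hpos : ∀ p ∈ s, 0 < l p := fun p hp => (Finset.mem_filter.1 hp).2
    have hsne : s.Nonempty := by
      rw [Finset.nonempty_iff_ne_empty]
      intro h
      rw [h] at hs1
      simp at hs1
    have hsS : s ∈ S.faces := S.down_closed ht (Finset.filter_subset _ _) hsne
    have hintΩ : interior S.space = Ω := by rw [hspace, hΩ.interior_closure]
    have hsfr : ∀ p ∈ s, A t p = (0 : Euc d →ᵃ[ℝ] Euc d) p := by
      intro p hp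
      have hpt := (Finset.filter_subset _ _ : s ⊆ t) hp
      have hpcl := hvert t ht p hpt
      rw [(hA t ht hcard).1 p hpt]
      refine (hval p hpcl).2 ?_
      rw [hΩ.isOpen.frontier_eq]
      refine ⟨hpcl, fun hpΩ => hx ?_⟩
      have := Geometry.SimplicialComplex.mem_interior_space_of_pos hfin hsS hpos hs1 hp
        (by rw [hintΩ]; exact hpΩ)
      rwa [hsx, hintΩ] at this
    have hxs : x ∈ convexHull ℝ (s : Set (Euc d)) := by
      rw [Finset.mem_convexHull']
      exact ⟨l, fun p hp => (hpos p hp).le, hs1, hsx⟩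
    exact AffineMap.eqOn_convexHull hsfr x hxs
  -- Lipschitz bounds
  have hlip : ∀ L : ℝ, 0 ≤ L → (∀ t ∈ S.faces, t.card = d + 1 → ∀ z, ‖(A t).linear z‖ ≤ L * ‖z‖) →
      ∀ x y, ‖w y - w x‖ ≤ L * ‖y - x‖ := by
    intro L hL hbound x y
    have : Finite {t // t ∈ S.faces} := hfin
    -- The closed cover consists of the complement of Ω, where w vanishes, and of the
    -- full-dimensional simplices.
    refine norm_sub_le_of_finite_closed_cover
      (ι := Option {t : {t // t ∈ S.faces} // t.1.card = d + 1})
      (A := fun o => o.elim Ωᶜ (fun t => convexHull ℝ (t.1.1 : Set (Euc d)))) ?_ ?_ ?_ hL x y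
    · rintro (_ | t)
      · exact hΩ.isOpen.isClosed_compl
      · exact (t.1.1.finite_toSet.isCompact_convexHull ℝ).isClosed
    · intro x
      by_cases hx : x ∈ Ω
      · have hxs : x ∈ S.space := by rw [hspace]; exact subset_closure hx
        rw [Geometry.SimplicialComplex.mem_space_iff] at hxs
        obtain ⟨t₀, ht₀, hxt₀⟩ := hxs
        obtain ⟨t, ht, htt, hcard⟩ := hpure t₀ ht₀
        exact ⟨some ⟨⟨t, ht⟩, hcard⟩, convexHull_mono (by exact_mod_cast htt) hxt₀⟩
      · exact ⟨none, hx⟩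
    · rintro (_ | t) x hx y hy
      · rw [hout x hx, hout y hy, sub_self, norm_zero]
        positivity
      · rw [(hA _ t.1.2 t.2).2 x hx, (hA _ t.1.2 t.2).2 y hy, ← vsub_eq_sub,
          ← AffineMap.linearMap_vsub, vsub_eq_sub]
        exact hbound _ t.1.2 t.2 _
  -- the gradient in the simplices
  have hgrad : ∀ t ∈ S.faces, t.card = d + 1 → ∀ x ∈ interior (convexHull ℝ (t : Set (Euc d))),
      ∀ i j, lineGrad w x i j = (A t).linear (EuclideanSpace.single j 1) i := by
    intro t ht hcard x hx i j
    have hev : (fun τ : ℝ => w (x + τ • (EuclideanSpace.single j (1 : ℝ) : Euc d)) i) =ᶠ[𝓝 0]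
        fun τ => (A t x) i + τ * (A t).linear (EuclideanSpace.single j 1) i := by
      have hc : Tendsto (fun τ : ℝ => x + τ • (EuclideanSpace.single j (1 : ℝ) : Euc d)) (𝓝 0)
          (𝓝 x) := by
        have : ContinuousAt (fun τ : ℝ => x + τ • (EuclideanSpace.single j (1 : ℝ) : Euc d)) 0 := by
          fun_prop
        simpa [ContinuousAt] using this
      filter_upwards [hc.eventually (isOpen_interior.mem_nhds hx)] with τ hτ
      rw [(hA t ht hcard).2 _ (interior_subset hτ)]
      have : A t (x + τ • EuclideanSpace.single j (1 : ℝ)) =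
          A t x + τ • (A t).linear (EuclideanSpace.single j 1) := by
        rw [← map_smul, add_comm, ← vadd_eq_add, AffineMap.map_vadd, vadd_eq_add, add_comm]
      rw [this]
      simp
    simp only [lineGrad, Matrix.of_apply, lineDeriv]
    rw [hev.deriv_eq]
    simp
  -- comparison with the reconstruction in a cell
  have hcell : ∀ t ∈ S.faces, t.card = d + 1 → ∃ K,
      interior (convexHull ℝ (t : Set (Euc d))) ⊆ D.cell K ∧
      (∀ z, ‖(A t - D.dispAff v K).linear z‖ ≤
        4 * D.residual v K / (ρ ^ 2 * D.diamC K) * ‖z‖) ∧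
      ∀ x ∈ convexHull ℝ (t : Set (Euc d)), ‖(A t - D.dispAff v K) x‖ ≤ D.residual v K := by
    intro t ht hcard
    obtain ⟨⟨x₀, hball⟩, K, hK, hdiam⟩ := htop t ht hcard
    have hKpos := D.diamC_pos hd K
    have hr : 0 < ρ ^ 2 * D.diamC K := by positivity
    -- The simplex contains a ball of radius ρ h_τ ≥ ρ² h_K; squaring the inverse estimate turns ρ²
    -- into the ρ⁴ of the statement.
    have hle : ρ ^ 2 * D.diamC K ≤ ρ * Metric.diam (convexHull ℝ (t : Set (Euc d))) := by
      nlinarith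
    have hball' := (Metric.ball_subset_ball hle).trans hball
    have hne : (interior (convexHull ℝ (t : Set (Euc d)))).Nonempty :=
      ⟨x₀, interior_maximal hball' Metric.isOpen_ball (Metric.mem_ball_self hr)⟩
    have hcl : convexHull ℝ (t : Set (Euc d)) ⊆ closure (D.cell K) :=
      subset_closure.trans (((convex_convexHull ℝ _).closure_interior_eq_closure_of_nonempty_interior
        hne).symm.subset.trans (closure_mono hK))
    have hM : ∀ p ∈ (t : Set (Euc d)), ‖(A t - D.dispAff v K) p‖ ≤ D.residual v K := by
      intro p hp
      change ‖A t p - D.dispC v K p‖ ≤ _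
      rw [(hA t ht hcard).1 p hp]
      exact (hval p (hvert t ht p hp)).1 K (hcl (subset_convexHull ℝ _ hp))
    exact ⟨K, hK, AffineMap.norm_linear_le hr hball' hM, AffineMap.norm_le_on_convexHull hM⟩
  have hae : ∀ᵐ x : Euc d, x ∈ Ω → ∃ t ∈ S.faces, t.card = d + 1 ∧
      x ∈ interior (convexHull ℝ (t : Set (Euc d))) := by
    have : ∀ᵐ x : Euc d, ∀ t ∈ S.faces, x ∉ frontier (convexHull ℝ (t : Set (Euc d))) :=
      (ae_ball_iff hfin.countable).2 fun t _ =>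
        measure_eq_zero_iff_ae_notMem.1 ((convex_convexHull ℝ _).addHaar_frontier volume)
    filter_upwards [this] with x hx hxΩ
    have hxs : x ∈ S.space := by rw [hspace]; exact subset_closure hxΩ
    rw [Geometry.SimplicialComplex.mem_space_iff] at hxs
    obtain ⟨t₀, ht₀, hxt₀⟩ := hxs
    obtain ⟨t, ht, htt, hcard⟩ := hpure t₀ ht₀
    refine ⟨t, ht, hcard, ?_⟩
    by_contra h
    exact hx t ht ⟨subset_closure (convexHull_mono (by exact_mod_cast htt) hxt₀), h⟩
  refine ⟨w, ?_, ?_, ?_, ?_, ?_⟩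
  -- This Lipschitz constant depends on the mesh and on v, but it is only used qualitatively.
  · obtain ⟨L, hL⟩ := (hfin.image fun t => ‖LinearMap.toContinuousLinearMap (A t).linear‖).bddAbove
    have hL' : ∀ t ∈ S.faces, t.card = d + 1 → ∀ z, ‖(A t).linear z‖ ≤ max L 0 * ‖z‖ := by
      intro t ht _ z
      refine ((LinearMap.toContinuousLinearMap (A t).linear).le_opNorm z).trans ?_
      gcongr
      exact (hL ⟨t, ht, rfl⟩).trans (le_max_left _ _)
    refine ⟨⟨max L 0, le_max_right _ _⟩, LipschitzWith.of_dist_le_mul fun x y => ?_⟩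
    rw [dist_eq_norm, dist_eq_norm]
    exact hlip _ (le_max_right _ _) hL' y x
  · exact HasCompactSupport.intro hΩ.isCompact_closure fun x hx => hout x fun h =>
      hx (subset_closure h)
  · intro x hx
    ext i j
    have hev : (fun τ : ℝ => w (x + τ • (EuclideanSpace.single j (1 : ℝ) : Euc d)) i) =ᶠ[𝓝 0]
        fun _ => 0 := by
      have hc : Tendsto (fun τ : ℝ => x + τ • (EuclideanSpace.single j (1 : ℝ) : Euc d)) (𝓝 0)
          (𝓝 x) := by
        have : ContinuousAt (fun τ : ℝ => x + τ • (EuclideanSpace.single j (1 : ℝ) : Euc d)) 0 := by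
          fun_prop
        simpa [ContinuousAt] using this
      filter_upwards [hc.eventually (isClosed_closure.isOpen_compl.mem_nhds hx)] with τ hτ
      rw [hout _ fun h => hτ (subset_closure h)]
      rfl
    simp only [lineGrad, Matrix.of_apply, lineDeriv, Matrix.zero_apply]
    rw [hev.deriv_eq, deriv_const]
  · filter_upwards [hae] with x hx hxΩ
    obtain ⟨t, ht, hcard, hxt⟩ := hx hxΩ
    obtain ⟨K, hK, hlin, -⟩ := hcell t ht hcard
    refine ⟨K, hK hxt, ?_⟩
    have hKpos := D.diamC_pos hd K
    have hcol : ∀ j, ‖matVecLin (lineGrad w x - D.gradC v K) (EuclideanSpace.single j 1)‖ ^ 2 ≤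
        (4 * D.residual v K / (ρ ^ 2 * D.diamC K)) ^ 2 := by
      intro j
      have heq : matVecLin (lineGrad w x - D.gradC v K) (EuclideanSpace.single j 1) =
          (A t - D.dispAff v K).linear (EuclideanSpace.single j 1) := by
        ext i
        rw [matVecLin_single, Matrix.sub_apply, hgrad t ht hcard x hxt i j,
          ← matVecLin_single (D.gradC v K) i j]
        rfl
      rw [heq]
      have := hlin (EuclideanSpace.single j 1)
      rw [PiLp.norm_single, norm_one, mul_one] at this
      exact pow_le_pow_left₀ (norm_nonneg _) this 2
    have hsum : ddot (lineGrad w x - D.gradC v K) (lineGrad w x - D.gradC v K) ≤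
        d * (4 * D.residual v K / (ρ ^ 2 * D.diamC K)) ^ 2 := by
      rw [ddot_eq_sum_norm_sq]
      refine (Finset.sum_le_sum fun j _ => hcol j).trans (le_of_eq ?_)
      simp
    have hres : D.residual v K ^ 2 = D.stabC K v v / D.diamC K ^ (d - 2) :=
      Real.sq_sqrt (div_nonneg (D.stabC_self_nonneg v K) (pow_nonneg hKpos.le _))
    refine (mul_le_mul_of_nonneg_left hsum (pow_nonneg hKpos.le d)).trans (le_of_eq ?_)
    rw [div_pow, mul_pow, hres]
    -- The weight h_K^(d−2) of S_K and the h_K² of the inverse estimate make up h_K^d, so no power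
    -- of h_K remains.
    have hpow : D.diamC K ^ d = D.diamC K ^ (d - 2) * D.diamC K ^ 2 := by
      rw [← pow_add]; congr 1; omega
    rw [hpow]
    field_simp
    ring
  · intro hz
    have hres : ∀ K, D.residual v K = 0 := fun K => by simp [residual, (hz K).2]
    have hdisp : ∀ K z, (D.dispAff v K).linear z = 0 := fun K z => by
      change matVecLin (D.gradC v K) z = 0
      rw [(hz K).1]
      ext i
      simp [matVecLin, matVec]
    -- Without gradients and residuals, w is 0-Lipschitz and vanishes outside Ω, so it is zero. It
    -- then coincides with the reconstructions, which are constant in each cell; these vanish, and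
    -- the nodal values with them.
    have hconst := hlip 0 le_rfl (fun t ht hcard z => by
      obtain ⟨K, _, hlin, _⟩ := hcell t ht hcard
      have := hlin z
      rw [hres, AffineMap.sub_linear, LinearMap.sub_apply, hdisp, sub_zero] at this
      simpa using this)
    have : Nonempty (Fin d) := ⟨⟨0, by omega⟩⟩
    obtain ⟨y, hy⟩ : ∃ y, y ∉ closure Ω := by
      by_contra! h
      exact hΩ.isCompact_closure.ne_univ (Set.eq_univ_of_forall h)
    have hw : ∀ x, w x = 0 := fun x => by
      have := hconst y x
      rw [hout y fun h => hy (subset_closure h), sub_zero, zero_mul] at this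
      exact norm_le_zero_iff.1 this
    intro s
    obtain ⟨K, hsK⟩ := D.exists_node_mem_closure hd s
    have h1 := D.norm_residual_le hd (v := v) hsK
    rw [hres, norm_le_zero_iff, sub_eq_zero] at h1
    obtain ⟨x, hxK, hx⟩ : ∃ x ∈ D.cell K, x ∈ Ω → ∃ t ∈ S.faces, t.card = d + 1 ∧
        x ∈ interior (convexHull ℝ (t : Set (Euc d))) := by
      by_contra! h
      have : volume (D.cell K) = 0 := by
        refine measure_mono_null (fun x hx => ?_) (ae_iff.1 hae)
        intro hcon
        obtain ⟨h1, h2⟩ := h x hx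
        obtain ⟨t, a, b, c⟩ := hcon h1
        exact h2 t a b c
      exact ((D.cell_polytope K).isOpen.measure_pos volume (D.cell_polytope K).nonempty).ne' this
    obtain ⟨t, ht, hcard, hxt⟩ := hx (D.cell_subset hΩ K hxK)
    obtain ⟨L, hL, _, hval'⟩ := hcell t ht hcard
    have hLK : L = K := D.cell_unique hxK (subset_closure (hL hxt))
    subst hLK
    have h2 := hval' x (interior_subset hxt)
    rw [hres, norm_le_zero_iff, AffineMap.coe_sub, Pi.sub_apply,
      ← (hA t ht hcard).2 x (interior_subset hxt), hw, zero_sub, neg_eq_zero] at h2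
    have h3 : D.dispAff v L (D.node s) - D.dispAff v L x = 0 := by
      rw [← vsub_eq_sub, ← AffineMap.linearMap_vsub, hdisp]
    rw [h2, sub_zero] at h3
    rw [h1]
    exact h3

end Discretization

/-! ## Algebra of the Frobenius product -/

section Frobenius

variable {d : ℕ}

lemma ddot_comm (A B : Mat d) : ddot A B = ddot B A := by
  simp only [ddot, mul_comm]

lemma ddot_add_left (A B C : Mat d) : ddot (A + B) C = ddot A C + ddot B C := by
  simp only [ddot, Matrix.add_apply, add_mul, Finset.sum_add_distrib]

lemma ddot_smul_left (c : ℝ) (A B : Mat d) : ddot (c • A) B = c * ddot A B := by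
  simp only [ddot, Matrix.smul_apply, smul_eq_mul, Finset.mul_sum, mul_assoc]

lemma ddot_add_right (A B C : Mat d) : ddot A (B + C) = ddot A B + ddot A C := by
  rw [ddot_comm, ddot_add_left, ddot_comm B, ddot_comm C]

lemma ddot_smul_right (c : ℝ) (A B : Mat d) : ddot A (c • B) = c * ddot A B := by
  rw [ddot_comm, ddot_smul_left, ddot_comm]

lemma ddot_self_eq_zero {A : Mat d} (h : ddot A A = 0) : A = 0 := by
  have h1 := (Finset.sum_eq_zero_iff_of_nonneg fun i _ =>
    Finset.sum_nonneg fun j _ => mul_self_nonneg (A i j)).1 h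
  ext i j
  have h2 := (Finset.sum_eq_zero_iff_of_nonneg fun j _ => mul_self_nonneg (A i j)).1
    (h1 i (Finset.mem_univ i)) j (Finset.mem_univ j)
  simpa using h2

lemma ddot_one_left (A : Mat d) : ddot 1 A = A.trace := by
  simp [ddot, Matrix.one_apply, Matrix.trace]

lemma ddot_add_self_le (A B : Mat d) : ddot (A + B) (A + B) ≤ 2 * ddot A A + 2 * ddot B B := by
  simp only [ddot, Finset.mul_sum, ← Finset.sum_add_distrib, Matrix.add_apply]
  refine Finset.sum_le_sum fun i _ => Finset.sum_le_sum fun j _ => ?_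
  nlinarith [sq_nonneg (A i j - B i j)]

lemma symPart_add (A B : Mat d) : symPart (A + B) = symPart A + symPart B := by
  simp only [symPart, Matrix.transpose_add, ← smul_add]
  congr 1
  abel

lemma symPart_smul (c : ℝ) (A : Mat d) : symPart (c • A) = c • symPart A := by
  simp only [symPart, Matrix.transpose_smul, ← smul_add]
  rw [smul_comm]

lemma trace_symPart (A : Mat d) : (symPart A).trace = A.trace := by
  simp only [symPart, Matrix.trace_smul, Matrix.trace_add, Matrix.trace_transpose, smul_eq_mul]
  ring

lemma ddot_symPart_symPart (A B : Mat d) : ddot (symPart A) (symPart B) = ddot (symPart A) B := by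
  have h : ddot (symPart A) B.transpose = ddot (symPart A) B := by
    rw [ddot, Finset.sum_comm]
    refine Finset.sum_congr rfl fun i _ => Finset.sum_congr rfl fun j _ => ?_
    simp only [symPart, Matrix.smul_apply, Matrix.add_apply, Matrix.transpose_apply]
    rw [add_comm]
  conv_lhs => rw [symPart.eq_def B]
  rw [ddot_smul_right, ddot_add_right, h]
  ring

lemma ddot_symPart_le (A : Mat d) : ddot (symPart A) (symPart A) ≤ ddot A A := by
  have h1 := two_mul_ddot_symPart A
  have h2 : ∑ i, ∑ j, A i j * A j i ≤ ddot A A := by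
    have h3 : ddot A A.transpose + ddot A A.transpose ≤ ddot A A + ddot A.transpose A.transpose := by
      simp only [ddot, ← Finset.sum_add_distrib]
      refine Finset.sum_le_sum fun i _ => Finset.sum_le_sum fun j _ => ?_
      nlinarith [sq_nonneg (A i j - A.transpose i j)]
    have h4 : ddot A.transpose A.transpose = ddot A A := Finset.sum_comm
    have h5 : ddot A A.transpose = ∑ i, ∑ j, A i j * A j i := rfl
    linarith
  linarith

lemma stress_add (μ lam : ℝ) (A B : Mat d) :
    stress μ lam (A + B) = stress μ lam A + stress μ lam B := by
  simp only [stress, symPart_add, Matrix.trace_add, mul_add, add_smul, smul_add]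
  abel

lemma stress_smul (μ lam c : ℝ) (A : Mat d) : stress μ lam (c • A) = c • stress μ lam A := by
  simp only [stress, symPart_smul, Matrix.trace_smul, smul_add, smul_smul, smul_eq_mul]
  congr 2 <;> ring

lemma ddot_stress (μ lam : ℝ) (A B : Mat d) : ddot (stress μ lam A) (symPart B) =
    2 * μ * ddot (symPart A) (symPart B) + lam * (A.trace * B.trace) := by
  rw [stress, ddot_add_left, ddot_smul_left, ddot_smul_left, ddot_one_left, trace_symPart,
    trace_symPart]
  ring

lemma ddot_stress_symPart (μ lam : ℝ) (A B : Mat d) :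
    ddot (stress μ lam A) (symPart B) = ddot (stress μ lam A) B := by
  rw [ddot_stress, ddot_symPart_symPart, stress, ddot_add_left, ddot_smul_left, ddot_smul_left,
    ddot_one_left, trace_symPart]
  ring

end Frobenius

/-! ## Square integrable matrix fields -/

/-- The Cauchy–Schwarz inequality, from the sign of a quadratic polynomial. -/
lemma abs_le_sqrt_mul_sqrt {a b c : ℝ} (h : ∀ t : ℝ, 0 ≤ a + 2 * t * b + t ^ 2 * c) :
    |b| ≤ Real.sqrt a * Real.sqrt c := by
  have ha : 0 ≤ a := by simpa using h 0
  have := discrim_le_zero (a := c) (b := 2 * b) (c := a) fun t => by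
    have := h t
    nlinarith
  rw [discrim] at this
  rw [← Real.sqrt_mul ha]
  refine Real.abs_le_sqrt ?_
  nlinarith

section MatL2

variable {d : ℕ} {Ω : Set (Euc d)} {G H : Euc d → Mat d}

lemma MatMemL2.add (hG : MatMemL2 Ω G) (hH : MatMemL2 Ω H) : MatMemL2 Ω (fun x => G x + H x) :=
  fun i j => (hG i j).add (hH i j)

lemma MatMemL2.sub (hG : MatMemL2 Ω G) (hH : MatMemL2 Ω H) : MatMemL2 Ω (fun x => G x - H x) :=
  fun i j => (hG i j).sub (hH i j)

lemma MatMemL2.const_smul (hG : MatMemL2 Ω G) (c : ℝ) : MatMemL2 Ω (fun x => c • G x) :=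
  fun i j => (hG i j).const_mul c

lemma MatMemL2.symPart (hG : MatMemL2 Ω G) : MatMemL2 Ω (fun x => symPart (G x)) :=
  MatMemL2.const_smul (MatMemL2.add hG fun i j => hG j i) _

lemma MatMemL2.memLp_trace (hG : MatMemL2 Ω G) :
    MemLp (fun x => (G x).trace) 2 (volume.restrict Ω) :=
  memLp_finsetSum _ fun i _ => hG i i

lemma MatMemL2.stress (hG : MatMemL2 Ω G) (μ lam : ℝ) :
    MatMemL2 Ω (fun x => stress μ lam (G x)) := by
  refine MatMemL2.add (hG.symPart.const_smul _) fun i j => ?_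
  exact (hG.symPart.memLp_trace.const_mul lam).mul_const _

lemma MatMemL2.integrable_ddot (hG : MatMemL2 Ω G) (hH : MatMemL2 Ω H) :
    Integrable (fun x => ddot (G x) (H x)) (volume.restrict Ω) :=
  integrable_finsetSum _ fun i _ => integrable_finsetSum _ fun j _ =>
    (hG i j).integrable_mul (hH i j)

lemma MatMemL2.mono {Ω' : Set (Euc d)} (hG : MatMemL2 Ω G) (h : Ω' ⊆ Ω) : MatMemL2 Ω' G :=
  fun i j => (hG i j).mono_measure (Measure.restrict_mono h le_rfl)

lemma integral_ddot_nonneg : 0 ≤ ∫ x in Ω, ddot (G x) (G x) :=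
  integral_nonneg fun _ => ddot_self_nonneg _

lemma matL2Norm_sq (Ω : Set (Euc d)) (G : Euc d → Mat d) :
    matL2Norm Ω G ^ 2 = ∫ x in Ω, ddot (G x) (G x) :=
  Real.sq_sqrt integral_ddot_nonneg

lemma matL2Norm_nonneg (Ω : Set (Euc d)) (G : Euc d → Mat d) : 0 ≤ matL2Norm Ω G :=
  Real.sqrt_nonneg _

lemma integral_ddot_add_smul (hG : MatMemL2 Ω G) (hH : MatMemL2 Ω H) (t : ℝ) :
    ∫ x in Ω, ddot (G x + t • H x) (G x + t • H x) =
      (∫ x in Ω, ddot (G x) (G x)) + 2 * t * (∫ x in Ω, ddot (G x) (H x)) +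
        t ^ 2 * ∫ x in Ω, ddot (H x) (H x) := by
  have h : ∀ x, ddot (G x + t • H x) (G x + t • H x) =
      ddot (G x) (G x) + 2 * t * ddot (G x) (H x) + t ^ 2 * ddot (H x) (H x) := fun x => by
    simp only [ddot_add_left, ddot_add_right, ddot_smul_left, ddot_smul_right]
    rw [ddot_comm (H x) (G x)]
    ring
  simp only [h]
  have h1 := hG.integrable_ddot hG
  have h2 := (hG.integrable_ddot hH).const_mul (2 * t)
  have h3 := (hH.integrable_ddot hH).const_mul (t ^ 2)
  have h12 : Integrable (fun x => ddot (G x) (G x) + 2 * t * ddot (G x) (H x))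
    (volume.restrict Ω) := h1.add h2
  rw [integral_add h12 h3, integral_add h1 h2, integral_const_mul, integral_const_mul]

lemma abs_integral_ddot_le (hG : MatMemL2 Ω G) (hH : MatMemL2 Ω H) :
    |∫ x in Ω, ddot (G x) (H x)| ≤ matL2Norm Ω G * matL2Norm Ω H :=
  abs_le_sqrt_mul_sqrt fun t => by
    rw [← integral_ddot_add_smul hG hH]
    exact integral_ddot_nonneg

lemma matL2Norm_add_le (hG : MatMemL2 Ω G) (hH : MatMemL2 Ω H) :
    matL2Norm Ω (fun x => G x + H x) ≤ matL2Norm Ω G + matL2Norm Ω H := by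
  refine Real.sqrt_le_iff.2 ⟨add_nonneg (matL2Norm_nonneg _ _) (matL2Norm_nonneg _ _), ?_⟩
  have h1 := integral_ddot_add_smul hG hH 1
  simp only [one_smul] at h1
  rw [h1, ← matL2Norm_sq, ← matL2Norm_sq]
  have := (le_abs_self _).trans (abs_integral_ddot_le hG hH)
  nlinarith

lemma matL2Norm_symPart_le (hG : MatMemL2 Ω G) :
    matL2Norm Ω (fun x => symPart (G x)) ≤ matL2Norm Ω G :=
  Real.sqrt_le_sqrt (integral_mono (hG.symPart.integrable_ddot hG.symPart) (hG.integrable_ddot hG)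
    fun x => ddot_symPart_le (G x))

end MatL2

/-! ## Piecewise constant fields -/

namespace PolyMesh

variable {d : ℕ} {Ω : Set (Euc d)} (D : PolyMesh d Ω)

lemma restrict_eq_iUnion_cell (hΩ : IsPolytope Ω) : Ω =ᵐ[volume] ⋃ K, D.cell K := by
  filter_upwards [D.ae_mem_cell_or] with x hx
  refine propext ⟨fun h => ?_, fun h => ?_⟩
  · exact Set.mem_iUnion.2 (hx.resolve_right fun h' => h' (subset_closure h))
  · obtain ⟨K, hK⟩ := Set.mem_iUnion.1 h
    exact D.cell_subset hΩ K hK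

lemma integrableOn_iff_cells (hΩ : IsPolytope Ω) {g : Euc d → ℝ} :
    IntegrableOn g Ω ↔ ∀ K, IntegrableOn g (D.cell K) := by
  rw [integrableOn_congr_set_ae (D.restrict_eq_iUnion_cell hΩ), integrableOn_finite_iUnion]

lemma integral_eq_sum_cells (hΩ : IsPolytope Ω) {g : Euc d → ℝ} (hg : IntegrableOn g Ω) :
    ∫ x in Ω, g x = ∑ K, ∫ x in D.cell K, g x := by
  rw [setIntegral_congr_set (D.restrict_eq_iUnion_cell hΩ)]
  exact integral_iUnion_fintype (fun K => (D.cell_polytope K).measurableSet)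
    (fun K L h => D.cell_disjoint K L h) ((D.integrableOn_iff_cells hΩ).1 hg)

lemma integrableOn_of_eqOn_cells (hΩ : IsPolytope Ω) {g : Euc d → ℝ} {c : Fin D.nC → ℝ}
    (h : ∀ K, ∀ x ∈ D.cell K, g x = c K) : IntegrableOn g Ω :=
  (D.integrableOn_iff_cells hΩ).2 fun K =>
    (integrableOn_const (D.cell_polytope K).volume_ne_top).congr_fun (fun x hx => (h K x hx).symm)
      (D.cell_polytope K).measurableSet

lemma integral_of_eqOn_cells (hΩ : IsPolytope Ω) {g : Euc d → ℝ} {c : Fin D.nC → ℝ}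
    (h : ∀ K, ∀ x ∈ D.cell K, g x = c K) : ∫ x in Ω, g x = ∑ K, D.measC K * c K := by
  rw [D.integral_eq_sum_cells hΩ (D.integrableOn_of_eqOn_cells hΩ h)]
  refine Finset.sum_congr rfl fun K _ => ?_
  rw [setIntegral_congr_fun (D.cell_polytope K).measurableSet (h K), setIntegral_const, smul_eq_mul]
  rfl

lemma sum_indicator_eq {E : Type*} [AddCommMonoid E] (c : Fin D.nC → E) {K : Fin D.nC} {x : Euc d}
    (hx : x ∈ D.cell K) : ∑ L, (D.cell L).indicator (fun _ => c L) x = c K := by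
  rw [Finset.sum_eq_single K _ (by simp), Set.indicator_of_mem hx]
  intro L _ hL
  exact Set.indicator_of_notMem (fun h => Set.disjoint_left.1 (D.cell_disjoint L K hL) h hx) _

end PolyMesh

/-! ### The discrete Korn inequality -/

namespace Discretization

variable {d : ℕ} {Ω : Set (Euc d)} (D : Discretization d Ω)

lemma gradD_eq (v : D.DOF) {K : Fin D.nC} {x : Euc d} (hx : x ∈ D.cell K) :
    D.gradD v x = D.gradC v K :=
  D.sum_indicator_eq _ hx

lemma matMemL2_gradD (v : D.DOF) : MatMemL2 Ω (D.gradD v) := by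
  intro i j
  have h : (fun x => D.gradD v x i j) =
      fun x => ∑ K, (D.cell K).indicator (fun _ => D.gradC v K i j) x := by
    funext x
    rw [gradD, Matrix.sum_apply]
    refine Finset.sum_congr rfl fun K _ => ?_
    by_cases hx : x ∈ D.cell K <;> simp [hx]
  rw [h]
  refine memLp_finsetSum _ fun K _ => memLp_indicator_const 2 (D.cell_polytope K).measurableSet _
    (Or.inr ?_)
  exact ne_top_of_le_ne_top (D.cell_polytope K).volume_ne_top (Measure.restrict_apply_le _ _)

lemma memLp_dispD (v : D.DOF) : MemLp (D.dispD v) 2 (volume.restrict Ω) :=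
  memLp_finsetSum _ fun K _ => memLp_indicator_const 2 (D.cell_polytope K).measurableSet _
    (Or.inr (ne_top_of_le_ne_top (D.cell_polytope K).volume_ne_top (Measure.restrict_apply_le _ _)))

/-- The Korn inequality for the discrete gradient. -/
theorem integral_gradD_le (hd : d = 2 ∨ d = 3) (hΩ : IsPolytope Ω) {ρ : ℝ} (hρ : 0 < ρ)
    (hreg : D.IsRegular ρ) {v : D.DOF} (hv : v ∈ D.U0) :
    ∫ x in Ω, ddot (D.gradD v x) (D.gradD v x) ≤
      8 * (∫ x in Ω, ddot (symPart (D.gradD v x)) (symPart (D.gradD v x))) +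
        10 * (16 * d / ρ ^ 4 * volume.real (Metric.ball (0 : Euc d) 1)) * D.stab v v := by
  obtain ⟨w, ⟨C, hw⟩, hc, hout, hbound, -⟩ := D.exists_conforming hd hΩ hρ hreg hv
  have hL : MatMemL2 Ω (lineGrad w) := fun i j => (memLp_lineGrad hw hc i j).restrict Ω
  have hA := D.matMemL2_gradD v
  have hE : MatMemL2 Ω (fun x => lineGrad w x - D.gradD v x) := hL.sub hA
  -- Nothing is known of the derivatives of w at points of ∂Ω, which form a null set.
  have hLae : ∀ᵐ x, x ∉ Ω → lineGrad w x = 0 := by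
    filter_upwards [D.ae_mem_cell_or] with x hx hxΩ
    rcases hx with ⟨K, hK⟩ | hx
    · exact absurd (D.cell_subset hΩ K hK) hxΩ
    · exact hout x hx
  -- Korn's inequality for the conforming interpolation
  have hkorn : ∫ x in Ω, ddot (lineGrad w x) (lineGrad w x) ≤
      2 * ∫ x in Ω, ddot (symPart (lineGrad w x)) (symPart (lineGrad w x)) := by
    rw [setIntegral_eq_integral_of_ae_compl_eq_zero, setIntegral_eq_integral_of_ae_compl_eq_zero]
    · exact integral_lineGrad_le hw hc
    · filter_upwards [hLae] with x hx hxΩ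
      simp [hx hxΩ, symPart, ddot]
    · filter_upwards [hLae] with x hx hxΩ
      simp [hx hxΩ, ddot]
  -- the nonconformity
  have hnc : ∫ x in Ω, ddot (lineGrad w x - D.gradD v x) (lineGrad w x - D.gradD v x) ≤
      16 * d / ρ ^ 4 * volume.real (Metric.ball (0 : Euc d) 1) * D.stab v v := by
    have hint := hE.integrable_ddot hE
    rw [D.integral_eq_sum_cells hΩ hint, stab, Finset.mul_sum]
    refine Finset.sum_le_sum fun K _ => ?_
    have hKpos := D.diamC_pos hd K
    have h1 : ∫ x in D.cell K, ddot (lineGrad w x - D.gradD v x) (lineGrad w x - D.gradD v x) ≤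
        ∫ _ in D.cell K, 16 * d / ρ ^ 4 * D.stabC K v v / D.diamC K ^ d := by
      refine setIntegral_mono_on_ae ((D.integrableOn_iff_cells hΩ).1 hint K)
        (integrableOn_const (D.cell_polytope K).volume_ne_top) (D.cell_polytope K).measurableSet ?_
      filter_upwards [hbound] with x hx hxK
      obtain ⟨L, hL, hb⟩ := hx (D.cell_subset hΩ K hxK)
      obtain rfl := D.cell_unique hxK (subset_closure hL)
      rw [D.gradD_eq v hxK, le_div_iff₀ (pow_pos hKpos d), mul_comm]
      exact hb
    refine h1.trans ?_
    rw [setIntegral_const, smul_eq_mul]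
    have h2 : 0 ≤ 16 * d / ρ ^ 4 * D.stabC K v v / D.diamC K ^ d := by
      have := D.stabC_self_nonneg v K
      positivity
    refine (mul_le_mul_of_nonneg_right (D.measC_le K) h2).trans (le_of_eq ?_)
    field_simp
  have hsymE : ∫ x in Ω, ddot (symPart (lineGrad w x)) (symPart (lineGrad w x)) ≤
      ∫ x in Ω, (2 * ddot (symPart (D.gradD v x)) (symPart (D.gradD v x)) +
        2 * ddot (lineGrad w x - D.gradD v x) (lineGrad w x - D.gradD v x)) := by
    refine integral_mono (hL.symPart.integrable_ddot hL.symPart)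
      (((hA.symPart.integrable_ddot hA.symPart).const_mul 2).add
        ((hE.integrable_ddot hE).const_mul 2)) fun x => ?_
    have h1 := ddot_add_self_le (symPart (D.gradD v x)) (symPart (lineGrad w x - D.gradD v x))
    rw [← symPart_add, add_sub_cancel] at h1
    have h2 := ddot_symPart_le (lineGrad w x - D.gradD v x)
    simp only
    linarith
  have hgrad : ∫ x in Ω, ddot (D.gradD v x) (D.gradD v x) ≤
      ∫ x in Ω, (2 * ddot (lineGrad w x) (lineGrad w x) +
        2 * ddot (lineGrad w x - D.gradD v x) (lineGrad w x - D.gradD v x)) := by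
    refine integral_mono (hA.integrable_ddot hA) (((hL.integrable_ddot hL).const_mul 2).add
        ((hE.integrable_ddot hE).const_mul 2)) fun x => ?_
    have h1 := ddot_add_self_le (lineGrad w x) ((-1 : ℝ) • (lineGrad w x - D.gradD v x))
    rw [ddot_smul_left, ddot_smul_right, neg_one_smul, neg_sub, add_sub_cancel] at h1
    simp only
    linarith
  -- With I the integral of |ε_D(v)|² and N that of |∇w − ∇^D v|², the bounds chain as ∫|∇^D v|² ≤
  -- 2∫|∇w|² + 2N, ∫|∇w|² ≤ 2∫|ε(w)|² and ∫|ε(w)|² ≤ 2I + 2N, whence 8I + 10N.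
  rw [integral_add ((hA.symPart.integrable_ddot hA.symPart).const_mul 2)
    ((hE.integrable_ddot hE).const_mul 2), integral_const_mul, integral_const_mul] at hsymE
  rw [integral_add ((hL.integrable_ddot hL).const_mul 2)
    ((hE.integrable_ddot hE).const_mul 2), integral_const_mul, integral_const_mul] at hgrad
  linarith

/-- Vanishing gradients and stabilisations characterise the zero of `U_{0,D}`. -/
lemma eq_zero_of_gradC_stabC (hd : d = 2 ∨ d = 3) (hΩ : IsPolytope Ω) {ρ : ℝ} (hρ : 0 < ρ)
    (hreg : D.IsRegular ρ) {v : D.DOF} (hv : v ∈ D.U0)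
    (h : ∀ K, D.gradC v K = 0 ∧ D.stabC K v v = 0) : v = 0 := by
  obtain ⟨w, -, -, -, -, hdef⟩ := D.exists_conforming hd hΩ hρ hreg hv
  refine Prod.ext (funext fun s => hdef h s) (funext fun σ => ?_)
  obtain ⟨K, hK⟩ := D.exists_mem_facesC σ
  have h1 := D.le_stabC_face (v := v) hK
  rw [(h K).2] at h1
  have h2 : 0 < D.diamC K ^ (d - 2) := pow_pos (D.diamC_pos hd K) _
  have h3 : v.2 σ ^ 2 ≤ 0 := by
    by_contra hn
    push Not at hn
    have := mul_pos h2 hn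
    linarith
  exact pow_eq_zero_iff two_ne_zero |>.1 (le_antisymm h3 (sq_nonneg _))

end Discretization

/-! ## Bilinear forms in finite dimension -/

section Bilinear

variable {V : Type*} [AddCommGroup V] [Module ℝ V]

lemma abs_bilin_le (b : V →ₗ[ℝ] V →ₗ[ℝ] ℝ) (hsymm : ∀ u v, b u v = b v u)
    (hnonneg : ∀ v, 0 ≤ b v v) (u v : V) : |b u v| ≤ Real.sqrt (b u u) * Real.sqrt (b v v) :=
  abs_le_sqrt_mul_sqrt fun t => by
    have := hnonneg (u + t • v)
    simp only [map_add, LinearMap.add_apply, map_smul, LinearMap.smul_apply, smul_eq_mul] at this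
    rw [hsymm v u] at this
    nlinarith

/-- A definite form embeds the space into its dual, and equality of dimensions makes the embedding
onto. -/
lemma existsUnique_bilin_eq [FiniteDimensional ℝ V] (b : V →ₗ[ℝ] V →ₗ[ℝ] ℝ)
    (hb : ∀ v, b v v = 0 → v = 0) (l : V →ₗ[ℝ] ℝ) : ∃! u, ∀ v, b u v = l v := by
  have hinj : Function.Injective (b : V →ₗ[ℝ] Module.Dual ℝ V) :=
    (injective_iff_map_eq_zero _).2 fun u hu => hb u (by rw [hu]; rfl)
  have hsurj := (LinearMap.injective_iff_surjective_of_finrank_eq_finrank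
    (Subspace.dual_finrank_eq (K := ℝ) (V := V)).symm).1 hinj
  obtain ⟨u, hu⟩ := hsurj l
  refine ⟨u, fun v => by rw [hu], fun u' hu' => hinj ?_⟩
  rw [hu]
  exact LinearMap.ext hu'

end Bilinear

lemma memLp_component {d : ℕ} {α : Type*} [MeasurableSpace α] {μ : Measure α} {p : ENNReal}
    {f : α → Euc d} (hf : MemLp f p μ) (i : Fin d) : MemLp (fun x => f x i) p μ :=
  (EuclideanSpace.proj i : Euc d →L[ℝ] ℝ).comp_memLp' hf

lemma integrable_inner_of_memLp {d : ℕ} {α : Type*} [MeasurableSpace α] {μ : Measure α}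
    {f g : α → Euc d} (hf : MemLp f 2 μ) (hg : MemLp g 2 μ) :
    Integrable (fun x => inner ℝ (f x) (g x)) μ := by
  simp only [PiLp.inner_apply]
  exact integrable_finsetSum _ fun i _ =>
    (memLp_component hg i).integrable_mul (memLp_component hf i)

/-- The Frobenius product as a bilinear form. -/
def ddotLin (d : ℕ) : Mat d →ₗ[ℝ] Mat d →ₗ[ℝ] ℝ :=
  LinearMap.mk₂ ℝ ddot ddot_add_left ddot_smul_left ddot_add_right ddot_smul_right

/-- The elastic energy as a bilinear form. -/
def elasticLin (d : ℕ) (μ lam : ℝ) : Mat d →ₗ[ℝ] Mat d →ₗ[ℝ] ℝ :=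
  LinearMap.mk₂ ℝ (fun A B => ddot (stress μ lam A) (symPart B))
    (fun A B C => by rw [stress_add, ddot_add_left])
    (fun c A B => by rw [stress_smul, ddot_smul_left, smul_eq_mul])
    (fun A B C => by rw [symPart_add, ddot_add_right])
    (fun c A B => by rw [symPart_smul, ddot_smul_right, smul_eq_mul])

/-! ### Coercivity and well-posedness of the scheme, finiteness of the adjoint error -/

namespace Discretization

variable {d : ℕ} {Ω : Set (Euc d)} (D : Discretization d Ω)

lemma tens_add_left (a b c : Euc d) : tens (a + b) c = tens a c + tens b c := by
  ext i j
  simp [tens, add_mul]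

lemma tens_smul_left (r : ℝ) (a c : Euc d) : tens (r • a) c = r • tens a c := by
  ext i j
  simp [tens, mul_assoc]

lemma avgF_add (u v : D.DOF) (σ : Fin D.nF) : D.avgF (u + v) σ = D.avgF u σ + D.avgF v σ := by
  simp only [avgF, Prod.fst_add, Pi.add_apply, smul_add, Finset.sum_add_distrib]

lemma avgF_smul (r : ℝ) (v : D.DOF) (σ : Fin D.nF) : D.avgF (r • v) σ = r • D.avgF v σ := by
  simp only [avgF, Prod.smul_fst, Pi.smul_apply, Finset.smul_sum]
  exact Finset.sum_congr rfl fun s _ => smul_comm _ _ _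

lemma avgC_add (u v : D.DOF) (K : Fin D.nC) : D.avgC (u + v) K = D.avgC u K + D.avgC v K := by
  simp only [avgC, Prod.fst_add, Pi.add_apply, smul_add, Finset.sum_add_distrib]

lemma avgC_smul (r : ℝ) (v : D.DOF) (K : Fin D.nC) : D.avgC (r • v) K = r • D.avgC v K := by
  simp only [avgC, Prod.smul_fst, Pi.smul_apply, Finset.smul_sum]
  exact Finset.sum_congr rfl fun s _ => smul_comm _ _ _

lemma gradC_add (u v : D.DOF) (K : Fin D.nC) : D.gradC (u + v) K = D.gradC u K + D.gradC v K := by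
  simp only [gradC, avgF_add, tens_add_left, smul_add, Finset.sum_add_distrib, Prod.snd_add,
    Pi.add_apply, mul_add, add_smul]
  abel

lemma gradC_smul (r : ℝ) (v : D.DOF) (K : Fin D.nC) : D.gradC (r • v) K = r • D.gradC v K := by
  simp only [gradC, avgF_smul, tens_smul_left, smul_add, Finset.smul_sum, Prod.smul_snd,
    Pi.smul_apply, smul_smul, smul_eq_mul]
  congr 1 <;> refine Finset.sum_congr rfl fun σ _ => ?_ <;> congr 1 <;> ring

lemma dispC_add (u v : D.DOF) (K : Fin D.nC) (x : Euc d) :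
    D.dispC (u + v) K x = D.dispC u K x + D.dispC v K x := by
  ext i
  simp only [dispC, gradC_add, avgC_add, matVec, PiLp.add_apply, Matrix.add_apply, add_mul,
    Finset.sum_add_distrib]
  ring

lemma dispC_smul (r : ℝ) (v : D.DOF) (K : Fin D.nC) (x : Euc d) :
    D.dispC (r • v) K x = r • D.dispC v K x := by
  ext i
  simp only [dispC, gradC_smul, avgC_smul, matVec, PiLp.add_apply, PiLp.smul_apply,
    Matrix.smul_apply, smul_eq_mul, mul_add, Finset.mul_sum, mul_assoc]

lemma gradD_add (u v : D.DOF) (x : Euc d) : D.gradD (u + v) x = D.gradD u x + D.gradD v x := by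
  simp only [gradD, gradC_add, ← Finset.sum_add_distrib]
  refine Finset.sum_congr rfl fun K _ => ?_
  by_cases hx : x ∈ D.cell K <;> simp [hx]

lemma gradD_smul (r : ℝ) (v : D.DOF) (x : Euc d) : D.gradD (r • v) x = r • D.gradD v x := by
  simp only [gradD, gradC_smul, Finset.smul_sum]
  refine Finset.sum_congr rfl fun K _ => ?_
  by_cases hx : x ∈ D.cell K <;> simp [hx]

lemma dispD_add (u v : D.DOF) (x : Euc d) : D.dispD (u + v) x = D.dispD u x + D.dispD v x := by
  simp only [dispD, avgC_add, ← Finset.sum_add_distrib]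
  refine Finset.sum_congr rfl fun K _ => ?_
  by_cases hx : x ∈ D.cell K <;> simp [hx]

lemma dispD_smul (r : ℝ) (v : D.DOF) (x : Euc d) : D.dispD (r • v) x = r • D.dispD v x := by
  simp only [dispD, avgC_smul, Finset.smul_sum]
  refine Finset.sum_congr rfl fun K _ => ?_
  by_cases hx : x ∈ D.cell K <;> simp [hx]

lemma stab_comm (u v : D.DOF) : D.stab u v = D.stab v u := by
  refine Finset.sum_congr rfl fun K _ => ?_
  simp only [stabC, real_inner_comm, mul_comm]

lemma stab_self_nonneg (v : D.DOF) : 0 ≤ D.stab v v :=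
  Finset.sum_nonneg fun K _ => D.stabC_self_nonneg v K

lemma stab_add_left (u v w : D.DOF) : D.stab (u + v) w = D.stab u w + D.stab v w := by
  simp only [stab, ← Finset.sum_add_distrib]
  refine Finset.sum_congr rfl fun K _ => ?_
  have h : ∀ s, (u + v).1 s - D.dispC (u + v) K (D.node s) =
      (u.1 s - D.dispC u K (D.node s)) + (v.1 s - D.dispC v K (D.node s)) := fun s => by
    rw [dispC_add, Prod.fst_add, Pi.add_apply]
    abel
  simp only [stabC, h, inner_add_left, Prod.snd_add, Pi.add_apply, add_mul, Finset.sum_add_distrib,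
    mul_add]
  ring

lemma stab_smul_left (r : ℝ) (v w : D.DOF) : D.stab (r • v) w = r * D.stab v w := by
  simp only [stab, Finset.mul_sum]
  refine Finset.sum_congr rfl fun K _ => ?_
  have h : ∀ s, (r • v).1 s - D.dispC (r • v) K (D.node s) =
      r • (v.1 s - D.dispC v K (D.node s)) := fun s => by
    rw [dispC_smul, Prod.smul_fst, Pi.smul_apply, smul_sub]
  simp only [stabC, h, real_inner_smul_left, Prod.smul_snd, Pi.smul_apply, smul_eq_mul, mul_assoc,
    ← Finset.mul_sum]
  ring

lemma stab_add_right (u v w : D.DOF) : D.stab u (v + w) = D.stab u v + D.stab u w := by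
  rw [stab_comm, stab_add_left, D.stab_comm v, D.stab_comm w]

lemma stab_smul_right (r : ℝ) (v w : D.DOF) : D.stab v (r • w) = r * D.stab v w := by
  rw [stab_comm, stab_smul_left, D.stab_comm w]

/-- The bilinear forms on the discrete space that are made of a form in the gradients and of a
multiple of the stabilisation. -/
def form (b : Mat d →ₗ[ℝ] Mat d →ₗ[ℝ] ℝ) (c : ℝ) : D.DOF →ₗ[ℝ] D.DOF →ₗ[ℝ] ℝ :=
  LinearMap.mk₂ ℝ
    (fun u v => ∑ K, D.measC K * b (D.gradC u K) (D.gradC v K) + c * D.stab u v)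
    (fun u v w => by
      simp only [gradC_add, map_add, LinearMap.add_apply, mul_add, Finset.sum_add_distrib,
        stab_add_left]
      ring)
    (fun r u v => by
      simp only [gradC_smul, map_smul, LinearMap.smul_apply, smul_eq_mul, mul_add, Finset.mul_sum,
        stab_smul_left, mul_left_comm _ r])
    (fun u v w => by
      simp only [gradC_add, map_add, mul_add, Finset.sum_add_distrib, stab_add_right]
      ring)
    (fun r u v => by
      simp only [gradC_smul, map_smul, smul_eq_mul, mul_add, Finset.mul_sum,
        stab_smul_right, mul_left_comm _ r])

lemma form_apply (b : Mat d →ₗ[ℝ] Mat d →ₗ[ℝ] ℝ) (c : ℝ) (u v : D.DOF) : D.form b c u v =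
    ∑ K, D.measC K * b (D.gradC u K) (D.gradC v K) + c * D.stab u v := rfl

lemma form_elastic (hΩ : IsPolytope Ω) (μ lam c : ℝ) (u v : D.DOF) :
    D.form (elasticLin d μ lam) c u v =
      (∫ x in Ω, ddot (stress μ lam (D.gradD u x)) (symPart (D.gradD v x))) + c * D.stab u v := by
  rw [form_apply, D.integral_of_eqOn_cells hΩ
    (c := fun K => ddot (stress μ lam (D.gradC u K)) (symPart (D.gradC v K)))
    fun K x hx => by rw [D.gradD_eq u hx, D.gradD_eq v hx]]
  rfl

lemma form_ddot (hΩ : IsPolytope Ω) (c : ℝ) (u v : D.DOF) : D.form (ddotLin d) c u v =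
    (∫ x in Ω, ddot (D.gradD u x) (D.gradD v x)) + c * D.stab u v := by
  rw [form_apply, D.integral_of_eqOn_cells hΩ
    (c := fun K => ddot (D.gradC u K) (D.gradC v K))
    fun K x hx => by rw [D.gradD_eq u hx, D.gradD_eq v hx]]
  rfl

lemma norm1_eq (v : D.DOF) : D.norm1 v = Real.sqrt (D.form (ddotLin d) 1 v v) := by
  rw [norm1, form_apply, one_mul, stab, Finset.sum_add_distrib]
  congr 2
  refine Finset.sum_congr rfl fun K _ => ?_
  rw [matL2Norm_sq, setIntegral_const, smul_eq_mul]
  rfl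

lemma norm1_nonneg (v : D.DOF) : 0 ≤ D.norm1 v := Real.sqrt_nonneg _

lemma form_ddot_nonneg (hΩ : IsPolytope Ω) (v : D.DOF) : 0 ≤ D.form (ddotLin d) 1 v v := by
  rw [form_ddot D hΩ, one_mul]
  exact add_nonneg integral_ddot_nonneg (D.stab_self_nonneg v)

lemma norm1_sq (hΩ : IsPolytope Ω) (v : D.DOF) :
    D.norm1 v ^ 2 = (∫ x in Ω, ddot (D.gradD v x) (D.gradD v x)) + D.stab v v := by
  rw [norm1_eq, Real.sq_sqrt (D.form_ddot_nonneg hΩ v), form_ddot D hΩ, one_mul]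

lemma matL2Norm_gradD_le (hΩ : IsPolytope Ω) (v : D.DOF) : matL2Norm Ω (D.gradD v) ≤ D.norm1 v := by
  refine Real.sqrt_le_iff.2 ⟨D.norm1_nonneg v, ?_⟩
  rw [D.norm1_sq hΩ]
  linarith [D.stab_self_nonneg v]

lemma sqrt_stab_le (hΩ : IsPolytope Ω) (v : D.DOF) : Real.sqrt (D.stab v v) ≤ D.norm1 v := by
  refine Real.sqrt_le_iff.2 ⟨D.norm1_nonneg v, ?_⟩
  rw [D.norm1_sq hΩ]
  linarith [integral_ddot_nonneg (Ω := Ω) (G := D.gradD v)]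

lemma abs_stab_le (u v : D.DOF) : |D.stab u v| ≤ Real.sqrt (D.stab u u) * Real.sqrt (D.stab v v) := by
  have h : ∀ u v, D.form 0 1 u v = D.stab u v := fun u v => by simp [form_apply]
  simp only [← h]
  refine abs_bilin_le _ (fun u v => ?_) (fun v => ?_) u v
  · rw [h, h, stab_comm]
  · rw [h]
    exact D.stab_self_nonneg v

lemma eq_zero_of_norm1 (hd : d = 2 ∨ d = 3) (hΩ : IsPolytope Ω) {ρ : ℝ} (hρ : 0 < ρ)
    (hreg : D.IsRegular ρ) {v : D.DOF} (hv : v ∈ D.U0) (h : D.norm1 v = 0) : v = 0 := by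
  rw [norm1_eq, Real.sqrt_eq_zero (D.form_ddot_nonneg hΩ v), form_apply, one_mul] at h
  have h1 : ∀ K, 0 ≤ D.measC K * ddot (D.gradC v K) (D.gradC v K) := fun K =>
    mul_nonneg (D.measC_pos K).le (ddot_self_nonneg _)
  have h2 := Finset.sum_nonneg fun K (_ : K ∈ Finset.univ) => h1 K
  have h3 := D.stab_self_nonneg v
  have h4 : ∑ K, D.measC K * ddot (D.gradC v K) (D.gradC v K) + D.stab v v = 0 := h
  have h5 : ∑ K, D.measC K * ddot (D.gradC v K) (D.gradC v K) = 0 := by linarith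
  have h6 : ∑ K, D.stabC K v v = 0 := by
    change D.stab v v = 0
    linarith
  rw [Finset.sum_eq_zero_iff_of_nonneg fun K _ => h1 K] at h5
  rw [Finset.sum_eq_zero_iff_of_nonneg fun K _ => D.stabC_self_nonneg v K] at h6
  refine D.eq_zero_of_gradC_stabC hd hΩ hρ hreg hv fun K => ⟨ddot_self_eq_zero ?_, h6 K (by simp)⟩
  exact (mul_eq_zero.1 (h5 K (by simp))).resolve_left (D.measC_pos K).ne'

/-- The subspace `U_{0,D}`. -/
def U0Submodule : Submodule ℝ D.DOF where
  carrier := D.U0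
  zero_mem' := ⟨fun _ _ => rfl, fun _ _ => rfl⟩
  add_mem' hu hv := ⟨fun s hs => by rw [Prod.fst_add, Pi.add_apply, hu.1 s hs, hv.1 s hs, add_zero],
    fun σ hσ => by rw [Prod.snd_add, Pi.add_apply, hu.2 σ hσ, hv.2 σ hσ, add_zero]⟩
  smul_mem' r v hv := ⟨fun s hs => by rw [Prod.smul_fst, Pi.smul_apply, hv.1 s hs, smul_zero],
    fun σ hσ => by rw [Prod.smul_snd, Pi.smul_apply, hv.2 σ hσ, smul_zero]⟩

/-- The coercivity constant of the scheme. -/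
def coercConst (d : ℕ) (ρ : ℝ) : ℝ :=
  10 * (16 * d / ρ ^ 4 * volume.real (Metric.ball (0 : Euc d) 1)) + 4

lemma coercConst_pos (d : ℕ) {ρ : ℝ} (hρ : 0 < ρ) : 0 < coercConst d ρ := by
  have : 0 ≤ volume.real (Metric.ball (0 : Euc d) 1) := measureReal_nonneg
  unfold coercConst
  positivity

/-- The term in λ is nonnegative and is dropped, so the constant does not see λ. With I as the
integral of |ε_D(v)|², S the stabilisation and c as in the proof, μ₁‖v‖² is at most 8μ₁I + (10c +
1)μ₁S, while the form is at least 2μ₁I + μ₁S; the factor 10c + 4 covers both terms. -/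
theorem mul_norm1_sq_le (hd : d = 2 ∨ d = 3) (hΩ : IsPolytope Ω) {ρ : ℝ} (hρ : 0 < ρ)
    (hreg : D.IsRegular ρ) {μ₁ μ lam : ℝ} (hμ₁ : 0 < μ₁) (hμ : μ₁ ≤ μ) (hlam : 0 < lam) {v : D.DOF}
    (hv : v ∈ D.U0) :
    μ₁ * D.norm1 v ^ 2 ≤ coercConst d ρ * D.form (elasticLin d μ lam) μ₁ v v := by
  have hA := D.matMemL2_gradD v
  have hS := hA.symPart.integrable_ddot hA.symPart
  have h1 := D.integral_gradD_le hd hΩ hρ hreg hv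
  have h2 : 2 * μ₁ * (∫ x in Ω, ddot (symPart (D.gradD v x)) (symPart (D.gradD v x))) ≤
      ∫ x in Ω, ddot (stress μ lam (D.gradD v x)) (symPart (D.gradD v x)) := by
    rw [← integral_const_mul]
    refine integral_mono (hS.const_mul _) ((hA.stress μ lam).integrable_ddot hA.symPart) fun x => ?_
    simp only [ddot_stress]
    have h3 := ddot_self_nonneg (symPart (D.gradD v x))
    have h4 := mul_nonneg hlam.le (mul_self_nonneg (D.gradD v x).trace)
    nlinarith
  rw [D.norm1_sq hΩ, form_elastic D hΩ]
  have h0 : 0 ≤ 16 * d / ρ ^ 4 * volume.real (Metric.ball (0 : Euc d) 1) := by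
    have : 0 ≤ volume.real (Metric.ball (0 : Euc d) 1) := measureReal_nonneg
    positivity
  have hs := D.stab_self_nonneg v
  have hi := integral_ddot_nonneg (Ω := Ω) (G := fun x => symPart (D.gradD v x))
  rw [coercConst]
  set c := 16 * d / ρ ^ 4 * volume.real (Metric.ball (0 : Euc d) 1)
  set I := ∫ x in Ω, ddot (symPart (D.gradD v x)) (symPart (D.gradD v x))
  set J := ∫ x in Ω, ddot (stress μ lam (D.gradD v x)) (symPart (D.gradD v x))
  have h5 := mul_le_mul_of_nonneg_left h1 hμ₁.le
  have h6 := mul_le_mul_of_nonneg_left h2 (show (0 : ℝ) ≤ 10 * c + 4 by positivity)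
  have h7 : 0 ≤ μ₁ * (c * I) := by positivity
  have h8 : 0 ≤ μ₁ * D.stab v v := by positivity
  nlinarith

theorem existsUnique_isSolution (hd : d = 2 ∨ d = 3) (hΩ : IsPolytope Ω) {ρ : ℝ} (hρ : 0 < ρ)
    (hreg : D.IsRegular ρ) {μ₁ μ lam : ℝ} (hμ₁ : 0 < μ₁) (hμ : μ₁ ≤ μ) (hlam : 0 < lam)
    {f : Euc d → Euc d} (hf : MemLp f 2 (volume.restrict Ω)) :
    ∃! uD : D.DOF, D.IsSolution μ₁ μ lam f uD := by
  have hint : ∀ v : D.DOF, Integrable (fun x => inner ℝ (f x) (D.dispD v x)) (volume.restrict Ω) :=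
    fun v => integrable_inner_of_memLp hf (D.memLp_dispD v)
  let l : D.U0Submodule →ₗ[ℝ] ℝ :=
    { toFun := fun v => ∫ x in Ω, inner ℝ (f x) (D.dispD v.1 x)
      map_add' := fun u v => by
        simp only [Submodule.coe_add, dispD_add, inner_add_right]
        exact integral_add (hint _) (hint _)
      map_smul' := fun r v => by
        simp only [Submodule.coe_smul, dispD_smul, real_inner_smul_right, RingHom.id_apply,
          smul_eq_mul]
        exact integral_const_mul _ _ }
  let b : D.U0Submodule →ₗ[ℝ] D.U0Submodule →ₗ[ℝ] ℝ :=
    (D.form (elasticLin d μ lam) μ₁).domRestrict₁₂ D.U0Submodule D.U0Submodule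
  have hb : ∀ v, b v v = 0 → v = 0 := by
    intro v hv
    have h1 := D.mul_norm1_sq_le hd hΩ hρ hreg hμ₁ hμ hlam v.2
    have h2 : D.form (elasticLin d μ lam) μ₁ v.1 v.1 = 0 := hv
    rw [h2, mul_zero] at h1
    have h3 : D.norm1 v.1 ^ 2 ≤ 0 := by
      by_contra hn
      push Not at hn
      have := mul_pos hμ₁ hn
      linarith
    exact Subtype.ext (D.eq_zero_of_norm1 hd hΩ hρ hreg v.2
      (pow_eq_zero_iff two_ne_zero |>.1 (le_antisymm h3 (sq_nonneg _))))
  have key : ∀ u v : D.U0Submodule, b u v = l v ↔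
      (∫ x in Ω, ddot (stress μ lam (D.gradD u.1 x)) (symPart (D.gradD v.1 x))) +
        μ₁ * D.stab u.1 v.1 = ∫ x in Ω, inner ℝ (f x) (D.dispD v.1 x) := fun u v => by
    rw [← form_elastic D hΩ]
    rfl
  obtain ⟨u, hu, huniq⟩ := existsUnique_bilin_eq b hb l
  refine ⟨u.1, ⟨u.2, fun v hv => (key u ⟨v, hv⟩).1 (hu _)⟩, fun u' hu' => ?_⟩
  have := huniq ⟨u', hu'.1⟩ fun v => (key _ _).2 (hu'.2 v.1 v.2)
  rw [← this]

lemma memLp_weakDiv (Ω : Set (Euc d)) (τ : Euc d → Mat d) :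
    MemLp (weakDiv Ω τ) 2 (volume.restrict Ω) := by
  unfold weakDiv
  split_ifs with h
  · exact h.choose_spec.1
  · exact MemLp.zero

/-- The adjoint consistency error is a finite supremum. -/
lemma bddAbove_adjForm (hd : d = 2 ∨ d = 3) (hΩ : IsPolytope Ω) {ρ : ℝ} (hρ : 0 < ρ)
    (hreg : D.IsRegular ρ) {τ : Euc d → Mat d} (hτ : MatMemL2 Ω τ) :
    BddAbove (Set.range fun v : D.U0 => D.adjForm τ v / D.norm1 v) := by
  have hint1 : ∀ v : D.DOF, Integrable (fun x => ddot (τ x) (symPart (D.gradD v x)))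
      (volume.restrict Ω) := fun v => hτ.integrable_ddot (D.matMemL2_gradD v).symPart
  have hint2 : ∀ v : D.DOF, Integrable (fun x => inner ℝ (D.dispD v x) (weakDiv Ω τ x))
      (volume.restrict Ω) := fun v => integrable_inner_of_memLp (D.memLp_dispD v) (memLp_weakDiv Ω τ)
  let l : D.U0Submodule →ₗ[ℝ] ℝ :=
    { toFun := fun v => D.adjForm τ v.1
      map_add' := fun u v => by
        simp only [adjForm, Submodule.coe_add, dispD_add, gradD_add, symPart_add, ddot_add_right,
          inner_add_left]
        rw [integral_add (hint1 _) (hint1 _), integral_add (hint2 _) (hint2 _)]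
        ring
      map_smul' := fun r v => by
        simp only [adjForm, Submodule.coe_smul, dispD_smul, gradD_smul, symPart_smul,
          ddot_smul_right, real_inner_smul_left, RingHom.id_apply, smul_eq_mul]
        rw [integral_const_mul, integral_const_mul]
        ring }
  let b : D.U0Submodule →ₗ[ℝ] D.U0Submodule →ₗ[ℝ] ℝ :=
    (D.form (ddotLin d) 1).domRestrict₁₂ D.U0Submodule D.U0Submodule
  have hbn : ∀ v, Real.sqrt (b v v) = D.norm1 v.1 := fun v => by
    rw [norm1_eq]
    rfl
  have hnonneg : ∀ v, 0 ≤ b v v := fun v => D.form_ddot_nonneg hΩ v.1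
  have hb : ∀ v, b v v = 0 → v = 0 := fun v hv =>
    Subtype.ext (D.eq_zero_of_norm1 hd hΩ hρ hreg v.2 (by rw [← hbn, hv, Real.sqrt_zero]))
  have hsymm : ∀ u v, b u v = b v u := fun u v => by
    change D.form (ddotLin d) 1 u.1 v.1 = D.form (ddotLin d) 1 v.1 u.1
    rw [form_ddot D hΩ, form_ddot D hΩ, stab_comm]
    simp only [ddot_comm]
  -- The adjoint form is represented by u in the inner product of ‖·‖_{1,D}; Cauchy–Schwarz then
  -- bounds every quotient by ‖u‖_{1,D}.
  obtain ⟨u, hu, -⟩ := existsUnique_bilin_eq b hb l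
  refine ⟨D.norm1 u.1, ?_⟩
  rintro _ ⟨v, rfl⟩
  refine div_le_of_le_mul₀ (D.norm1_nonneg _) (D.norm1_nonneg _) ?_
  have h1 := abs_bilin_le b hsymm hnonneg u ⟨v.1, v.2⟩
  rw [hu, hbn, hbn] at h1
  exact (le_abs_self _).trans h1

/-- The quotient at v = 0 is 0 / 0 = 0, and it is one of the terms of a finite supremum. -/
lemma adjErr_nonneg (hd : d = 2 ∨ d = 3) (hΩ : IsPolytope Ω) {ρ : ℝ} (hρ : 0 < ρ)
    (hreg : D.IsRegular ρ) {τ : Euc d → Mat d} (hτ : MatMemL2 Ω τ) : 0 ≤ D.adjErr τ := by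
  have h := le_ciSup (D.bddAbove_adjForm hd hΩ hρ hreg hτ) ⟨0, D.U0Submodule.zero_mem⟩
  have h0 : D.norm1 0 = 0 := by rw [norm1_eq, map_zero, Real.sqrt_zero]
  refine le_trans (le_of_eq ?_) h
  simp [h0]

lemma adjForm_le (hd : d = 2 ∨ d = 3) (hΩ : IsPolytope Ω) {ρ : ℝ} (hρ : 0 < ρ)
    (hreg : D.IsRegular ρ) {τ : Euc d → Mat d} (hτ : MatMemL2 Ω τ) {v : D.DOF} (hv : v ∈ D.U0) :
    D.adjForm τ v ≤ D.adjErr τ * D.norm1 v := by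
  by_cases h0 : D.norm1 v = 0
  · have := D.eq_zero_of_norm1 hd hΩ hρ hreg hv h0
    subst this
    have h1 : ∀ x, D.gradD 0 x = 0 := fun x => by
      have := D.gradD_smul 0 0 x
      rwa [zero_smul, zero_smul] at this
    have h2 : ∀ x, D.dispD 0 x = 0 := fun x => by
      have := D.dispD_smul 0 0 x
      rwa [zero_smul, zero_smul] at this
    rw [h0, mul_zero]
    simp [adjForm, h1, h2, symPart, ddot]
  · have hpos := lt_of_le_of_ne (D.norm1_nonneg v) (Ne.symm h0)
    rw [← div_le_iff₀ hpos]
    exact le_ciSup (D.bddAbove_adjForm hd hΩ hρ hreg hτ) ⟨v, hv⟩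

end Discretization

/-! ## Test functions and weak derivatives -/

section WeakDerivatives

variable {d : ℕ} {Ω : Set (Euc d)}

lemma ae_eq_zero_of_forall_test (hΩ : IsOpen Ω) {g : Euc d → ℝ}
    (hg : MemLp g 2 (volume.restrict Ω))
    (h : ∀ ψ : Euc d → ℝ, IsTest Ω ψ → ∫ x in Ω, g x * ψ x = 0) :
    ∀ᵐ x ∂volume.restrict Ω, g x = 0 := by
  rw [ae_restrict_iff' hΩ.measurableSet]
  refine hΩ.ae_eq_zero_of_integral_contDiff_smul_eq_zero
    (locallyIntegrableOn_of_locallyIntegrable_restrict (hg.locallyIntegrable (by norm_num)))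
    fun ψ h1 h2 h3 => ?_
  have h4 := h ψ ⟨h1, h2, h3⟩
  rw [setIntegral_eq_integral_of_forall_compl_eq_zero] at h4
  · simpa only [smul_eq_mul, mul_comm] using h4
  · intro x hx
    rw [image_eq_zero_of_notMem_tsupport fun h => hx (h3 h), mul_zero]

lemma IsTest.isWeakGrad {φ : Euc d → Euc d} (hφ : IsTest Ω φ) :
    IsWeakGrad Ω φ (classicalGrad φ) := by
  intro ψ hψ i j
  have hd1 := hφ.contDiff_one.differentiable one_ne_zero
  have hd2 := hψ.contDiff_one.differentiable one_ne_zero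
  have hfd : ∀ x, fderiv ℝ (fun y => φ y i) x (EuclideanSpace.single j 1) =
      classicalGrad φ x i j := fun x => by
    have : HasFDerivAt (fun y => φ y i)
        ((EuclideanSpace.proj i : Euc d →L[ℝ] ℝ).comp (fderiv ℝ φ x)) x :=
      (EuclideanSpace.proj i : Euc d →L[ℝ] ℝ).hasFDerivAt.comp x (hd1 x).hasFDerivAt
    rw [this.fderiv]
    rfl
  have hφi : MemLp (fun x => φ x i) 2 volume := memLp_component (hφ.memLp volume) i
  have hψ2 : MemLp ψ 2 volume := hψ.1.continuous.memLp_of_hasCompactSupport hψ.2.1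
  have hdψ : MemLp (fun x => fderiv ℝ ψ x (EuclideanSpace.single j 1)) 2 volume :=
    (hψ.continuous_fderiv.clm_apply continuous_const).memLp_of_hasCompactSupport
      (hψ.2.1.fderiv_apply ℝ _)
  have hibp := integral_mul_fderiv_eq_neg_fderiv_mul_of_integrable (μ := (volume : Measure (Euc d)))
    (f := fun y => φ y i) (g := ψ) (v := EuclideanSpace.single j 1) ?_ ?_ ?_ ?_ (fun x _ => hd2 x)
  · rw [setIntegral_eq_integral_of_forall_compl_eq_zero,
      setIntegral_eq_integral_of_forall_compl_eq_zero, hibp]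
    · simp only [hfd]
    · intro x hx
      rw [image_eq_zero_of_notMem_tsupport fun h => hx (hψ.2.2 h), mul_zero]
    · intro x hx
      rw [image_eq_zero_of_notMem_tsupport fun h => hx (hφ.2.2 h), PiLp.zero_apply, zero_mul]
  · simp only [hfd]
    exact (hφ.memLp_classicalGrad i j volume).integrable_mul hψ2
  · exact hφi.integrable_mul hdψ
  · exact hφi.integrable_mul hψ2
  · exact fun x _ => (EuclideanSpace.proj i : Euc d →L[ℝ] ℝ).differentiableAt.comp x (hd1 x)

lemma IsTest.memH1 {φ : Euc d → Euc d} (hφ : IsTest Ω φ) : MemH1 Ω φ :=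
  ⟨hφ.memLp _, classicalGrad φ, fun i j => hφ.memLp_classicalGrad i j _, hφ.isWeakGrad⟩

/-- A weak gradient is unique almost everywhere, so the chosen one agrees with the classical one. -/
lemma IsTest.weakGrad_ae_eq (hΩ : IsOpen Ω) {φ : Euc d → Euc d} (hφ : IsTest Ω φ) (i j : Fin d) :
    (fun x => weakGrad Ω φ x i j) =ᵐ[volume.restrict Ω] fun x => classicalGrad φ x i j := by
  obtain ⟨hG, hW⟩ := weakGrad_spec hφ.memH1
  have hC := hφ.memLp_classicalGrad i j (volume.restrict Ω)
  have := ae_eq_zero_of_forall_test hΩ ((hG i j).sub hC) fun ψ hψ => by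
    have hψ2 : MemLp ψ 2 (volume.restrict Ω) := hψ.1.continuous.memLp_of_hasCompactSupport hψ.2.1
    have i1 : Integrable (fun x => weakGrad Ω φ x i j * ψ x) (volume.restrict Ω) :=
      (hG i j).integrable_mul hψ2
    have i2 : Integrable (fun x => classicalGrad φ x i j * ψ x) (volume.restrict Ω) :=
      hC.integrable_mul hψ2
    simp only [Pi.sub_apply, sub_mul]
    rw [integral_sub i1 i2]
    have h1 := hW ψ hψ i j
    have h2 := hφ.isWeakGrad ψ hψ i j
    linarith
  filter_upwards [this] with x hx
  exact sub_eq_zero.1 hx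

lemma IsTest.memH10 (hΩ : IsOpen Ω) {φ : Euc d → Euc d} (hφ : IsTest Ω φ) : MemH10 Ω φ := by
  refine ⟨hφ.memH1, fun _ => φ, fun _ => hφ, ?_, fun i j => ?_⟩
  · simp
  · have : eLpNorm (fun x => classicalGrad φ x i j - weakGrad Ω φ x i j) 2 (volume.restrict Ω) =
        0 := by
      rw [eLpNorm_congr_ae (g := fun _ => 0), eLpNorm_zero']
      filter_upwards [hφ.weakGrad_ae_eq hΩ i j] with x hx
      rw [hx, sub_self]
    simp only [this]
    exact tendsto_const_nhds

/-- The weak divergence of the stress is the opposite of the load. -/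
lemma IsWeakSolution.weakDiv_ae_eq (hΩ : IsOpen Ω) {μ lam : ℝ} {f u : Euc d → Euc d}
    (hf : MemLp f 2 (volume.restrict Ω)) (hu : IsWeakSolution Ω μ lam f u) :
    ∀ᵐ x ∂volume.restrict Ω,
      weakDiv Ω (fun x => stress μ lam (weakGrad Ω u x)) x = - f x := by
  -- Test functions belong to H¹₀, so the weak formulation applies to them; as the stress is
  -- symmetric, ε(φ) may be replaced by ∇φ.
  have hdiv : IsWeakDiv Ω (fun x => stress μ lam (weakGrad Ω u x)) (fun x => - f x) := by
    intro φ hφ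
    have h1 := hu.2 φ (hφ.memH10 hΩ)
    simp only [inner_neg_left]
    rw [integral_neg, ← h1]
    congr 1
    refine integral_congr_ae ?_
    have h2 : ∀ᵐ x ∂volume.restrict Ω, ∀ i j, weakGrad Ω φ x i j = classicalGrad φ x i j :=
      eventually_all.2 fun i => eventually_all.2 fun j => hφ.weakGrad_ae_eq hΩ i j
    filter_upwards [h2] with x hx
    rw [ddot_stress_symPart, show weakGrad Ω φ x = classicalGrad φ x from Matrix.ext hx]
  have hex : ∃ g, MemLp g 2 (volume.restrict Ω) ∧
      IsWeakDiv Ω (fun x => stress μ lam (weakGrad Ω u x)) g := ⟨_, hf.neg, hdiv⟩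
  have hspec : MemLp (weakDiv Ω fun x => stress μ lam (weakGrad Ω u x)) 2 (volume.restrict Ω) ∧
      IsWeakDiv Ω (fun x => stress μ lam (weakGrad Ω u x))
        (weakDiv Ω fun x => stress μ lam (weakGrad Ω u x)) := by
    rw [weakDiv, dif_pos hex]
    exact hex.choose_spec
  set g := weakDiv Ω fun x => stress μ lam (weakGrad Ω u x)
  have hcomp : ∀ i, ∀ᵐ x ∂volume.restrict Ω, (g x + f x) i = 0 := fun i => by
    refine ae_eq_zero_of_forall_test hΩ (memLp_component (hspec.1.add hf) i) fun ψ hψ => ?_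
    have hφ : IsTest Ω fun x => ψ x • (EuclideanSpace.single i (1 : ℝ) : Euc d) :=
      ⟨hψ.1.smul contDiff_const, hψ.2.1.smul_right, (tsupport_smul_subset_left _ _).trans hψ.2.2⟩
    have h1 := hspec.2 _ hφ
    rw [← hdiv _ hφ] at h1
    have hφ2 := hφ.memLp (volume.restrict Ω)
    have h2 := integral_sub (integrable_inner_of_memLp hspec.1 hφ2)
      (integrable_inner_of_memLp hf.neg hφ2)
    simp only [Pi.neg_apply] at h2
    rw [h1, sub_self] at h2
    rw [← h2]
    refine integral_congr_ae (Eventually.of_forall fun x => ?_)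
    simp [real_inner_smul_right, EuclideanSpace.inner_single_right]
    ring
  filter_upwards [eventually_all.2 hcomp] with x hx
  exact eq_neg_of_add_eq_zero_left (by ext i; exact hx i)

lemma contRep_frontier (Ω : Set (Euc d)) (u : Euc d → Euc d) {x : Euc d} (hx : x ∈ frontier Ω) :
    contRep Ω u x = 0 := by
  unfold contRep
  split_ifs with h
  · exact h.choose_spec.2.1 x hx
  · rfl

end WeakDerivatives

/-! ### Consistency of the interpolator and the error estimate -/

namespace Discretization

variable {d : ℕ} {Ω : Set (Euc d)} (D : Discretization d Ω)

lemma trace_tens (a b : Euc d) : (tens a b).trace = inner ℝ a b := by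
  simp only [Matrix.trace, Matrix.diag, tens, Matrix.of_apply, PiLp.inner_apply]
  exact Finset.sum_congr rfl fun i _ => mul_comm _ _

/-- Nodal values vanish on ∂Ω by the choice of the representative. On a boundary face the trace has
zero normal mean and all the nodes are on ∂Ω. -/
lemma interp_mem_U0 (hΩ : IsPolytope Ω) {u : Euc d → Euc d} (hu : MemH10 Ω u) :
    D.interp u ∈ D.U0 := by
  refine ⟨fun s hs => contRep_frontier Ω u hs, fun σ hσ => ?_⟩
  have h1 : ∑ s ∈ D.nodesF σ, D.wF σ s • contRep Ω u (D.node s) = 0 := by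
    refine Finset.sum_eq_zero fun s hs => ?_
    rw [contRep_frontier Ω u (closure_minimal hσ isClosed_frontier (D.mem_nodesF.1 hs)), smul_zero]
  simp only [interp]
  rw [D.integral_trace_boundary hΩ.isOpen hσ hu, h1, inner_zero_left, mul_zero, sub_zero]

/-- The reconstructed divergence of the interpolate is the mean of the divergence. -/
lemma measC_mul_trace_gradC_interp (hd : d = 2 ∨ d = 3) (hΩ : IsPolytope Ω) {u : Euc d → Euc d}
    (hu : MemH10 Ω u) (K : Fin D.nC) :
    D.measC K * (D.gradC (D.interp u) K).trace = ∫ x in D.cell K, (weakGrad Ω u x).trace := by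
  rw [D.integral_cell_trace_weakGrad hd hΩ K hu, gradC, Matrix.trace_add, Matrix.trace_smul,
    Matrix.trace_smul, smul_eq_mul, smul_eq_mul, ← mul_add, one_div,
    mul_inv_cancel_left₀ (D.measC_pos K).ne', Matrix.trace_sum, Matrix.trace_sum,
    ← Finset.sum_add_distrib]
  refine Finset.sum_congr rfl fun σ _ => ?_
  have hn : inner ℝ (D.normal σ) (D.normal σ) = (1 : ℝ) := by
    rw [real_inner_self_eq_norm_sq, D.normal_unit, one_pow]
  simp only [Matrix.trace_smul, trace_tens, smul_eq_mul, PolyMesh.outNormal, real_inner_smul_right,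
    hn]
  rw [integral_const_mul]
  -- A face of measure zero contributes nothing to either side, so the division by |σ| is harmless.
  by_cases h0 : D.measF σ = 0
  · have hz : (surfMeasure d).restrict (D.face σ) = 0 := by
      rw [← Measure.measure_univ_eq_zero, ← measureReal_eq_zero_iff, measureReal_restrict_apply_univ]
      exact h0
    rw [h0, hz, integral_zero_measure]
    ring
  · have h1 : (D.interp u).2 σ = (D.measF σ)⁻¹ *
        (∫ x in D.face σ, inner ℝ (trace Ω u (D.face σ) x) (D.normal σ) ∂(surfMeasure d)) -
        inner ℝ (D.avgF (D.interp u) σ) (D.normal σ) := by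
      rw [← one_div]
      rfl
    rw [h1]
    field_simp
    ring

/-- The volumetric part of the consistency error vanishes. -/
lemma integral_trace_interp (hd : d = 2 ∨ d = 3) (hΩ : IsPolytope Ω) {u : Euc d → Euc d}
    (hu : MemH10 Ω u) (v : D.DOF) :
    ∫ x in Ω, (D.gradD (D.interp u) x - weakGrad Ω u x).trace * (D.gradD v x).trace = 0 := by
  have hG := (weakGrad_spec hu.1).1
  have hM := (D.matMemL2_gradD (D.interp u)).sub hG
  have hint : Integrable (fun x => (D.gradD (D.interp u) x - weakGrad Ω u x).trace *
      (D.gradD v x).trace) (volume.restrict Ω) :=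
    hM.memLp_trace.integrable_mul (D.matMemL2_gradD v).memLp_trace
  rw [D.integral_eq_sum_cells hΩ hint]
  refine Finset.sum_eq_zero fun K _ => ?_
  have hGK : Integrable (fun x => (weakGrad Ω u x).trace) (volume.restrict (D.cell K)) :=
    (hG.mono (D.cell_subset hΩ K)).memLp_trace.integrable (by norm_num)
  rw [setIntegral_congr_fun (g := fun x => ((D.gradC (D.interp u) K).trace -
    (weakGrad Ω u x).trace) * (D.gradC v K).trace) (D.cell_polytope K).measurableSet,
    integral_mul_const, integral_sub (integrable_const _) hGK, setIntegral_const, smul_eq_mul]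
  · have h := D.measC_mul_trace_gradC_interp hd hΩ hu K
    rw [PolyMesh.measC] at h
    rw [h, sub_self, zero_mul]
  · intro x hx
    simp only [D.gradD_eq _ hx, Matrix.trace_sub]

/-- With κ = `coercConst d ρ`, coercivity at e = I_D u − u_D and the error equation give μ₁‖e‖ ≤ κ(W
+ 3μ₂P). The triangle inequality adds μ₁P ≤ μ₂P, whence the constant 3κ + 1. -/
theorem norm_gradD_sub_le (hd : d = 2 ∨ d = 3) (hΩ : IsPolytope Ω) {ρ : ℝ} (hρ : 0 < ρ)
    (hreg : D.IsRegular ρ) {μ₁ μ₂ μ lam : ℝ} (hμ₁ : 0 < μ₁) (hμ : μ₁ ≤ μ) (hμ₂ : μ ≤ μ₂)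
    (hlam : 0 < lam) {f : Euc d → Euc d} (hf : MemLp f 2 (volume.restrict Ω)) {uD : D.DOF}
    (huD : D.IsSolution μ₁ μ lam f uD) {u : Euc d → Euc d} (hu : IsWeakSolution Ω μ lam f u) :
    μ₁ * matL2Norm Ω (fun x => D.gradD uD x - weakGrad Ω u x) ≤
      (3 * coercConst d ρ + 1) * (D.adjErr (fun x => stress μ lam (weakGrad Ω u x)) +
        μ₂ * D.primalErr u (D.interp u)) := by
  have hG := (weakGrad_spec hu.1.1).1
  set w := D.interp u
  set e : D.DOF := w - uD
  have heU : e ∈ D.U0 := D.U0Submodule.sub_mem (D.interp_mem_U0 hΩ hu.1) huD.1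
  have hwe : w = uD + e := (add_sub_cancel uD w).symm
  have hτ := hG.stress μ lam
  have hM := (D.matMemL2_gradD w).sub hG
  have hN := D.matMemL2_gradD e
  set W := D.adjErr (fun x => stress μ lam (weakGrad Ω u x))
  set P := D.primalErr u w
  have hW0 : 0 ≤ W := D.adjErr_nonneg hd hΩ hρ hreg hτ
  have hP0 : 0 ≤ P := Real.sqrt_nonneg _
  have hadj : D.adjForm (fun x => stress μ lam (weakGrad Ω u x)) e ≤ W * D.norm1 e :=
    D.adjForm_le hd hΩ hρ hreg hτ heU
  have hMP : matL2Norm Ω (fun x => D.gradD w x - weakGrad Ω u x) ≤ P := by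
    refine Real.le_sqrt_of_sq_le ?_
    have h1 : ∀ x, ddot (D.gradD w x - weakGrad Ω u x) (D.gradD w x - weakGrad Ω u x) =
        ddot (weakGrad Ω u x - D.gradD w x) (weakGrad Ω u x - D.gradD w x) := fun x => by
      simp only [ddot, Matrix.sub_apply]
      exact Finset.sum_congr rfl fun i _ => Finset.sum_congr rfl fun j _ => by ring
    rw [matL2Norm_sq, matL2Norm_sq]
    simp only [h1]
    linarith [D.stab_self_nonneg w]
  have hSP : Real.sqrt (D.stab w w) ≤ P :=
    Real.sqrt_le_sqrt (by linarith [sq_nonneg (matL2Norm Ω fun x => weakGrad Ω u x - D.gradD w x)])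
  -- the error equation
  have hload : ∫ x in Ω, inner ℝ (D.dispD e x)
      (weakDiv Ω (fun x => stress μ lam (weakGrad Ω u x)) x) =
      - ∫ x in Ω, inner ℝ (f x) (D.dispD e x) := by
    rw [← integral_neg]
    refine integral_congr_ae ?_
    filter_upwards [hu.weakDiv_ae_eq hΩ.isOpen hf] with x hx
    rw [hx, inner_neg_right, real_inner_comm]
  have hsol := huD.2 e heU
  rw [← form_elastic D hΩ] at hsol
  have hform : D.form (elasticLin d μ lam) μ₁ e e =
      D.form (elasticLin d μ lam) μ₁ w e - D.form (elasticLin d μ lam) μ₁ uD e := by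
    rw [← LinearMap.sub_apply, ← map_sub]
  have hcons : (∫ x in Ω, ddot (stress μ lam (D.gradD w x)) (symPart (D.gradD e x))) =
      (∫ x in Ω, ddot (stress μ lam (weakGrad Ω u x)) (symPart (D.gradD e x))) +
      2 * μ * ∫ x in Ω, ddot (symPart (D.gradD w x - weakGrad Ω u x)) (symPart (D.gradD e x)) := by
    have h1 : ∀ x, ddot (stress μ lam (D.gradD w x)) (symPart (D.gradD e x)) =
        ddot (stress μ lam (weakGrad Ω u x)) (symPart (D.gradD e x)) +
        (2 * μ * ddot (symPart (D.gradD w x - weakGrad Ω u x)) (symPart (D.gradD e x)) +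
        lam * ((D.gradD w x - weakGrad Ω u x).trace * (D.gradD e x).trace)) := fun x => by
      rw [← ddot_stress, ← ddot_add_left, ← stress_add, add_sub_cancel]
    have i1 := hτ.integrable_ddot hN.symPart
    have i2 := (hM.symPart.integrable_ddot hN.symPart).const_mul (2 * μ)
    have i3 : Integrable (fun x => lam * ((D.gradD w x - weakGrad Ω u x).trace *
        (D.gradD e x).trace)) (volume.restrict Ω) :=
      (hM.memLp_trace.integrable_mul hN.memLp_trace).const_mul lam
    have i23 : Integrable (fun x =>
        2 * μ * ddot (symPart (D.gradD w x - weakGrad Ω u x)) (symPart (D.gradD e x)) +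
        lam * ((D.gradD w x - weakGrad Ω u x).trace * (D.gradD e x).trace)) (volume.restrict Ω) :=
      i2.add i3
    simp only [h1]
    rw [integral_add i1 i23, integral_add i2 i3, integral_const_mul, integral_const_mul]
    -- Here λ leaves the estimate: its factor is exactly zero, not merely small.
    have h2 := D.integral_trace_interp hd hΩ hu.1 e
    rw [h2, mul_zero, add_zero]
  have hen := D.norm1_nonneg e
  have hbound1 : ∫ x in Ω, ddot (symPart (D.gradD w x - weakGrad Ω u x)) (symPart (D.gradD e x)) ≤
      P * D.norm1 e := by
    refine (le_abs_self _).trans ((abs_integral_ddot_le hM.symPart hN.symPart).trans ?_)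
    exact mul_le_mul ((matL2Norm_symPart_le hM).trans hMP)
      ((matL2Norm_symPart_le hN).trans (D.matL2Norm_gradD_le hΩ e)) (matL2Norm_nonneg _ _) hP0
  have hbound2 : D.stab w e ≤ P * D.norm1 e :=
    (le_abs_self _).trans ((D.abs_stab_le w e).trans
      (mul_le_mul hSP (D.sqrt_stab_le hΩ e) (Real.sqrt_nonneg _) hP0))
  -- The 3 is 2 + 1: a factor 2μ from the strain term and a factor μ₁ from the stabilisation, with
  -- both μ and μ₁ at most μ₂.
  have henergy : D.form (elasticLin d μ lam) μ₁ e e ≤ (W + 3 * μ₂ * P) * D.norm1 e := by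
    rw [hform, hsol, form_elastic D hΩ, hcons]
    rw [adjForm, hload] at hadj
    have hPe : 0 ≤ P * D.norm1 e := mul_nonneg hP0 hen
    have h1 := mul_le_mul_of_nonneg_left hbound1 (by linarith : 0 ≤ 2 * μ)
    have h2 := mul_le_mul_of_nonneg_left hbound2 hμ₁.le
    have h3 := mul_le_mul_of_nonneg_right hμ₂ hPe
    have h4 := mul_le_mul_of_nonneg_right (hμ.trans hμ₂) hPe
    linarith
  have hcoer := D.mul_norm1_sq_le hd hΩ hρ hreg hμ₁ hμ hlam heU
  have hκ := coercConst_pos d hρ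
  have hμ₂0 : 0 ≤ μ₂ := by linarith
  have hmain : μ₁ * D.norm1 e ≤ coercConst d ρ * (W + 3 * μ₂ * P) := by
    rcases hen.eq_or_lt with h0 | hpos
    · rw [← h0, mul_zero]
      positivity
    · refine le_of_mul_le_mul_right ?_ hpos
      have := mul_le_mul_of_nonneg_left henergy hκ.le
      linarith
  have htri : matL2Norm Ω (fun x => D.gradD uD x - weakGrad Ω u x) ≤ P + D.norm1 e := by
    have h1 : ∀ x, D.gradD uD x - weakGrad Ω u x =
        (D.gradD w x - weakGrad Ω u x) + (-1 : ℝ) • D.gradD e x := fun x => by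
      rw [hwe, gradD_add, neg_one_smul]
      abel
    simp only [h1]
    refine (matL2Norm_add_le hM (hN.const_smul (-1))).trans (add_le_add hMP ?_)
    refine le_trans (le_of_eq ?_) (D.matL2Norm_gradD_le hΩ e)
    simp only [matL2Norm, ddot_smul_left, ddot_smul_right]
    simp
  have h1 := mul_le_mul_of_nonneg_left htri hμ₁.le
  have h2 := mul_le_mul_of_nonneg_right (hμ.trans hμ₂) hP0
  have h3 := mul_nonneg hκ.le hW0
  nlinarith

end Discretization

end

theorem mainTheorem2 (d : ℕ) (hd : d = 2 ∨ d = 3) (Ω : Set (Euc d)) (hΩ : IsPolytope Ω)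
    (ρ : ℝ) (hρ : 0 < ρ) (hρ1 : ρ < 1) :
    ∃ C : ℝ, 0 < C ∧
      ∀ D : Discretization d Ω, D.IsRegular ρ →
      ∀ μ₁ μ₂ μ lam : ℝ, 0 < μ₁ → μ₁ ≤ μ → μ ≤ μ₂ → 0 < lam →
      ∀ f : Euc d → Euc d, MemLp f 2 (volume.restrict Ω) →
        (∃! uD : D.DOF, D.IsSolution μ₁ μ lam f uD) ∧
        ∀ uD : D.DOF, D.IsSolution μ₁ μ lam f uD →
        ∀ u : Euc d → Euc d, IsWeakSolution Ω μ lam f u →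
          μ₁ * matL2Norm Ω (fun x => D.gradD uD x - weakGrad Ω u x) ≤
            C * (D.adjErr (fun x => stress μ lam (weakGrad Ω u x)) +
              μ₂ * D.primalErr u (D.interp u)) := by
  -- This constant depends on d and ρ only, not even on the shape of Ω.
  refine ⟨3 * Discretization.coercConst d ρ + 1, ?_, fun D hreg μ₁ μ₂ μ lam hμ₁ hμ hμ₂ hlam f hf =>
    ⟨D.existsUnique_isSolution hd hΩ hρ hreg hμ₁ hμ hlam hf, fun uD huD u hu =>
      D.norm_gradD_sub_le hd hΩ hρ hreg hμ₁ hμ hμ₂ hlam hf huD hu⟩⟩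
  have := Discretization.coercConst_pos d hρ
  positivity
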